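/- Let $L$ be a quartic number field whose Galois closure $\widetilde L$ over $\mathbb{Q}$ has Galois group $A_4$ or $S_4$, and let $k$ be its cubic resolvent, i.e. the cubic field (unique up to isomorphism) that embeds in $\widetilde L$. Let $K_6=k(\sqrt\alpha)$ be a quadratic extension of $k$ that embeds in $\widetilde L$, where $\alpha\in k^*$ is not a square in $k$ and its norm to $\mathbb{Q}$ is a square in $\mathbb{Q}$. A prime number $p$ is said to have splitting type $(f_1^{e_1}\cdots f_g^{e_g})$ in a number field if it factors there as $\mathfrak p_1^{e_1}\cdots\mathfrak p_g^{e_g}$ with $\mathfrak p_i$ distinct primes of residue degree $f_i$; if $2$ is $(1^21)$ in $k$ we say that $2$ is $(1^21)_0$ or $(1^21)_4$ in $k$ according as $\mathrm{Disc}(k)\equiv 0$ or $4 \pmod 8$. (a) Let $p\ge 3$ be a prime. 1. If $p$ is $(3)$ in $k$, then $p$ is $(31)$ in $L$. 2. If $p$ is $(21)$ in $k$, then $p$ is $(4)$, $(211)$, $(2^2)$ or $(1^21^2)$ in $L$. 3. If $p$ is $(111)$ in $k$, then $p$ is $(1111)$, $(22)$, $(2^2)$ or $(1^21^2)$ in $L$.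 4. If $p$ is $(1^21)$ in $k$, then $p$ is $(21^2)$, $(1^211)$ or $(1^4)$ in $L$. 5. If $p$ is $(1^3)$ in $k$, then $p$ is $(1^31)$ in $L$. Each of these combinations occurs for some odd prime $p$ and some $L$ with cubic resolvent $k$. (b) For $p=2$ the possible combinations are those listed in (a), together with the following: $2$ can be $(1^4)$ in $L$ whatever its type in $k$; if $2$ is $(1^21)$ in $k$, then $2$ can also be $(1^21^2)$ in $L$; if $2$ is $(1^21)_4$ in $k$, then $2$ can also be $(2^2)$ in $L$. No other combination is possible for any $L$, and each of these occurs for some $L$ with cubic resolvent $k$ (those with $2$ of type $(1^21)$ in $k$ occur both with $(1^21)_0$ and with $(1^21)_4$, except that $(2^2)$ in $L$ occurs only with $(1^21)_4$). (c) The Dedekind zeta functions satisfy $$\zeta_L(s)=\frac{\zeta(s)\,\zeta_{K_6}(s)}{\zeta_k(s)}$$ for $\mathrm{Re}(s)>1$ (where $\zeta_k(s)\neq0$), and hence also for their meromorphic continuations. (d) The splitting type of a prime $p$ in any one of $k$, $L$, $K_6$ is determined by its splitting types in the other two: if two triples $(L,k,K_6)$ and $(L',k',K_6')$ as above and two primes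 $p$, $p'$ are such that the type of $p$ agrees with that of $p'$ in two of the three corresponding pairs of fields, then it also agrees in the third. -/

import Mathlib

open NumberField

universe u v w

noncomputable section

/-- A splitting type: one pair `(f, e)` = (residue degree, ramification index) for each prime
above `p`, counted with multiplicity. In the usual notation the pair `(f, e)` is written `f ^ e`,
so that e.g. `(21²)` is `{(2, 1), (1, 2)}`, `(22)` is `{(2, 1), (2, 1)}` and `(2²)` is
`{(2, 2)}`. -/
abbrev SplittingType : Type := Multiset (ℕ × ℕ)

/-- The splitting type of the rational prime `p` in the number field `K`. -/
def splittingType (p : ℕ) (K : Type*) [Field K] [NumberField K] : SplittingType :=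
  (IsDedekindDomain.primesOverFinset (Ideal.span {(p : ℤ)}) (𝓞 K)).val.map
    fun P => (P.inertiaDeg ℤ, P.ramificationIdx ℤ)

/-- The Galois closure over `ℚ` of the field `L`, inside an algebraic closure of `L`. -/
abbrev GaloisClosure (L : Type*) [Field L] [NumberField L] :
    IntermediateField ℚ (AlgebraicClosure L) :=
  IntermediateField.normalClosure ℚ L (AlgebraicClosure L)

/-- `L` is an `A₄`- or `S₄`-quartic field: a quartic number field whose Galois closure has Galois
group `A₄` or `S₄` over `ℚ`. -/
def IsA4OrS4Quartic (L : Type*) [Field L] [NumberField L] : Prop :=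
  Module.finrank ℚ L = 4 ∧
    (Nonempty (Gal(GaloisClosure L/ℚ) ≃* alternatingGroup (Fin 4)) ∨
      Nonempty (Gal(GaloisClosure L/ℚ) ≃* Equiv.Perm (Fin 4)))

/-- `k` is (up to isomorphism) the cubic resolvent of the `A₄`- or `S₄`-quartic field `L`: a cubic
field which embeds in the Galois closure of `L`. -/
def IsCubicResolvent (k L : Type*) [Field k] [NumberField k] [Field L] [NumberField L] : Prop :=
  Module.finrank ℚ k = 3 ∧ Nonempty (k →ₐ[ℚ] GaloisClosure L)

/-- `K₆ / k` is a quadratic extension of trivial norm: `K₆ = k(√α)` for some nonzero nonsquare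
`α ∈ k` whose absolute norm is a square in `ℚ`. -/
def IsTrivialNormQuadratic (k K₆ : Type*) [Field k] [NumberField k] [Field K₆] [NumberField K₆]
    [Algebra k K₆] : Prop :=
  ∃ α : k, α ≠ 0 ∧ ¬ IsSquare α ∧ IsSquare (Algebra.norm ℚ α) ∧
    ∃ θ : K₆, θ ^ 2 = algebraMap k K₆ α ∧ IntermediateField.adjoin k {θ} = ⊤

/-- `(k, K₆)` is a pair corresponding to the `A₄`- or `S₄`-quartic field `L`: `k` is the cubic
resolvent of `L`, and `K₆ / k` is a quadratic extension of trivial norm which embeds in the Galois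
closure of `L`. -/
def IsAssociatedPair (L k K₆ : Type*) [Field L] [NumberField L] [Field k] [NumberField k]
    [Field K₆] [NumberField K₆] [Algebra k K₆] : Prop :=
  IsCubicResolvent k L ∧ IsTrivialNormQuadratic k K₆ ∧ Nonempty (K₆ →ₐ[ℚ] GaloisClosure L)

/-- The combinations (`tk` in the cubic resolvent, `tL` in the quartic field) of splitting types
listed for an odd prime. -/
def OddListed (tk tL : SplittingType) : Prop :=
  (tk = {(3, 1)} ∧ tL = {(3, 1), (1, 1)}) ∨
  (tk = {(2, 1), (1, 1)} ∧
    (tL = {(4, 1)} ∨ tL = {(2, 1), (1, 1), (1, 1)} ∨ tL = {(2, 2)} ∨ tL = {(1, 2), (1, 2)})) ∨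
  (tk = {(1, 1), (1, 1), (1, 1)} ∧
    (tL = {(1, 1), (1, 1), (1, 1), (1, 1)} ∨ tL = {(2, 1), (2, 1)} ∨ tL = {(2, 2)} ∨
      tL = {(1, 2), (1, 2)})) ∨
  (tk = {(1, 2), (1, 1)} ∧
    (tL = {(2, 1), (1, 2)} ∨ tL = {(1, 2), (1, 1), (1, 1)} ∨ tL = {(1, 4)})) ∨
  (tk = {(1, 3)} ∧ tL = {(1, 3), (1, 1)})

/-- The five splitting types in a cubic field. -/
def IsCubicType (tk : SplittingType) : Prop :=
  tk = {(3, 1)} ∨ tk = {(2, 1), (1, 1)} ∨ tk = {(1, 1), (1, 1), (1, 1)} ∨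
    tk = {(1, 2), (1, 1)} ∨ tk = {(1, 3)}

/-- The combinations (`tk` in the cubic resolvent, `tL` in the quartic field) of splitting types
listed for the prime `2`, when the cubic resolvent has discriminant `d`: those of `OddListed`,
together with `(1⁴)` in all cases, `(1²1²)` if `2` is `(1²1)` in the cubic resolvent, and `(2²)`
if `2` is `(1²1)` in the cubic resolvent and `d ≡ 4 (mod 8)`. -/
def TwoListed (d : ℤ) (tk tL : SplittingType) : Prop :=
  OddListed tk tL ∨
  (IsCubicType tk ∧ tL = {(1, 4)}) ∨
  (tk = {(1, 2), (1, 1)} ∧ tL = {(1, 2), (1, 2)}) ∨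
  (tk = {(1, 2), (1, 1)} ∧ d ≡ 4 [ZMOD 8] ∧ tL = {(2, 2)})

end

/-! Fix a Galois number field `N` containing the fields in play and a prime `P` of `N` above `p`,
with decomposition group D and inertia group I. The primes above `p` in a subfield `K` are the
D-orbits on the embeddings `K → N`: a prime with invariants (f, e) is a D-orbit of length fe made of
I-orbits of length e (`weighted_splittingType`). Here the Galois group is a subgroup of S₄
containing A₄, and the three sets of embeddings are the natural ones: four points for `L`, the three
partitions into pairs for `k` (`exists_equiv_pairing`), the six two-element subsets for `K₆`
(`exists_equiv_twoSubset`). It is the square norm that singles out `K₆` among the quadratic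
extensions of `k` in the Galois closure. So all three types depend only on (D, I), where D/I is
cyclic, and a search over subgroups I of S₄ and lifts of a generator of D/I produces the finite
table `rows` (`exists_splittingType_row`).

Several assertions are then inspections of the table. Two entries of a row determine the third. The
residue degrees in `L` and `k` together are those in `K₆` and an additional 1 (`rows_inertiaDeg`),
which is the zeta relation at the level of Euler factors; the identity theorem extends it to the
plane.

At an odd prime the inertia group contains no Klein four-group, because two commuting involutions in
it would both act as -1 on P/P² (`eq_of_commuting_involutions`). Deleting those classes leaves list
(a). At 2 they remain, with one restriction: (2²) over (1²1) forces Disc(k) ≡ 4 mod 8. Indeed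
Disc(k) is 4 mod 8 or 8 mod 16 (`discr_mod_of_splittingType`), Disc(L)Disc(k) is a square
(`isSquare_discr_mul_discr`), and (2²) makes the 2-adic valuation of Disc(L) even
(`even_padicValNat_discr`).

Existence is by explicit quartics with their cubic resolvents, treated by Dedekind's criterion
(`IsIntegralGenerator.splittingType_eq`). When 2 has more primes of one degree than there are
irreducible polynomials over 𝔽₂ to label them, auxiliary integers outside ℤ[θ] separate the primes
(`three_le_card_splittingType`, `IsIntegralGenerator.splittingType_two_of_norm_residue`). -/

noncomputable section

/-! ### Primes of a subfield as orbits of the decomposition group on embeddings. -/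

section Decomposition

open MulAction Pointwise

variable {K N : Type*} [Field K] [NumberField K] [Field N] [NumberField N]

/-- The Galois group of `N` acts on the embeddings of `K` into `N` by composition. -/
instance embeddingAction : MulAction Gal(N/ℚ) (K →ₐ[ℚ] N) where
  smul σ φ := (σ : N →ₐ[ℚ] N).comp φ
  one_smul _ := rfl
  mul_smul _ _ _ := rfl

@[simp] lemma embedding_smul_apply (σ : Gal(N/ℚ)) (φ : K →ₐ[ℚ] N) (x : K) :
    (σ • φ) x = σ (φ x) := rfl

/-- The prime of `K` below a prime of `N`, along an embedding `K → N`. -/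
def primeBelow (P : Ideal (𝓞 N)) (φ : K →ₐ[ℚ] N) : Ideal (𝓞 K) :=
  P.comap (RingOfIntegers.mapRingHom (φ : K →+* N))

lemma mem_primeBelow {P : Ideal (𝓞 N)} {φ : K →ₐ[ℚ] N} {x : 𝓞 K} :
    x ∈ primeBelow P φ ↔ RingOfIntegers.mapRingHom (φ : K →+* N) x ∈ P := Iff.rfl

instance (P : Ideal (𝓞 N)) [P.IsPrime] (φ : K →ₐ[ℚ] N) : (primeBelow P φ).IsPrime :=
  inferInstanceAs (P.comap _).IsPrime

instance primeBelow_liesOver (P : Ideal (𝓞 N)) (p : Ideal ℤ) [P.LiesOver p] (φ : K →ₐ[ℚ] N) :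
    (primeBelow P φ).LiesOver p := by
  constructor
  rw [Ideal.over_def P p]
  ext x
  simp [Ideal.under, primeBelow, Ideal.mem_comap]

lemma primeBelow_smul (P : Ideal (𝓞 N)) (σ : Gal(N/ℚ)) (φ : K →ₐ[ℚ] N) :
    primeBelow (σ • P) (σ • φ) = primeBelow P φ := by
  ext x
  rw [mem_primeBelow, mem_primeBelow, ← Ideal.smul_mem_pointwise_smul_iff (a := σ) (S := P)]
  rfl

section Galois

variable [IsGalois ℚ N]

/-- The stabilizer of `φ` is H = Gal(N/φ(K)), which meets the inertia and decomposition groups of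
`P` over ℚ in those of `P` over `K`. Orbit-stabilizer and the multiplicativity of e and f in the
tower give both lengths. -/
lemma card_orbit_inertia_eq (p : Ideal ℤ) [p.IsPrime] (P : Ideal (𝓞 N)) [P.IsPrime]
    [P.LiesOver p] (φ : K →ₐ[ℚ] N) :
    Nat.card (orbit (P.inertia Gal(N/ℚ)) φ) = (primeBelow P φ).ramificationIdx ℤ ∧
    Nat.card (orbit (stabilizer Gal(N/ℚ) P) φ) =
      (primeBelow P φ).inertiaDeg ℤ * (primeBelow P φ).ramificationIdx ℤ := by
  let := φ.toRingHom.toAlgebra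
  have hφ : ∀ x, algebraMap K N x = φ x := fun _ => rfl
  have hst : IsScalarTower ℚ K N := IsScalarTower.of_algebraMap_eq' (Subsingleton.elim _ _)
  let H := fixingSubgroup Gal(N/ℚ) (Set.range (algebraMap K N))
  have hH : IsGaloisGroup H K N := IsGaloisGroup.of_isScalarTower _ ℚ N K
  have hHO : IsGaloisGroup H (𝓞 K) (𝓞 N) := IsGaloisGroup.of_isFractionRing H _ _ K N
  have hHφ : ∀ σ : Gal(N/ℚ), σ ∈ H ↔ σ • φ = φ := fun σ => by
    rw [mem_fixingSubgroup_iff]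
    constructor
    · intro h; ext x; exact h _ ⟨x, rfl⟩
    · rintro h _ ⟨x, rfl⟩; exact DFunLike.congr_fun h x
  set q := primeBelow P φ with hq
  have hqP : P.LiesOver q := ⟨by
    ext x
    rfl⟩
  have e1 := Ideal.card_inertia_eq_ramificationIdxIn (G := Gal(N/ℚ)) p P
  rw [Ideal.ramificationIdxIn_eq_ramificationIdx p P Gal(N/ℚ)] at e1
  have e2 := Ideal.card_inertia_eq_ramificationIdxIn (G := H) q P
  rw [Ideal.ramificationIdxIn_eq_ramificationIdx q P H] at e2
  have f1 := Ideal.card_stabilizer_eq_card_inertia_mul_finrank (G := Gal(N/ℚ)) p P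
  have f2 := Ideal.card_stabilizer_eq_card_inertia_mul_finrank (G := H) q P
  have e3 := Ideal.ramificationIdx_tower (R := ℤ) q P
  have f3 := Ideal.inertiaDeg_tower (R := ℤ) q P
  have c1 : Nat.card (stabilizer (P.inertia Gal(N/ℚ)) φ) = Nat.card (P.inertia H) :=
    Nat.card_congr
      { toFun := fun σ => ⟨⟨σ.1.1, (hHφ _).2 σ.2⟩, σ.1.2⟩
        invFun := fun σ => ⟨⟨σ.1.1, σ.2⟩, (hHφ _).1 σ.1.2⟩
        left_inv := fun _ => rfl
        right_inv := fun _ => rfl }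
  have c2 : Nat.card (stabilizer (stabilizer Gal(N/ℚ) P) φ) = Nat.card (stabilizer H P) :=
    Nat.card_congr
      { toFun := fun σ => ⟨⟨σ.1.1, (hHφ _).2 σ.2⟩, σ.1.2⟩
        invFun := fun σ => ⟨⟨σ.1.1, σ.2⟩, (hHφ _).1 σ.1.2⟩
        left_inv := fun _ => rfl
        right_inv := fun _ => rfl }
  have o1 : Nat.card (orbit (P.inertia Gal(N/ℚ)) φ) *
      Nat.card (stabilizer (P.inertia Gal(N/ℚ)) φ) = Nat.card (P.inertia Gal(N/ℚ)) := by
    rw [← Nat.card_prod]; exact Nat.card_congr (orbitProdStabilizerEquivGroup _ _)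
  have o2 : Nat.card (orbit (stabilizer Gal(N/ℚ) P) φ) *
      Nat.card (stabilizer (stabilizer Gal(N/ℚ) P) φ) = Nat.card (stabilizer Gal(N/ℚ) P) := by
    rw [← Nat.card_prod]; exact Nat.card_congr (orbitProdStabilizerEquivGroup _ _)
  have pe : 0 < Nat.card (P.inertia H) := Nat.card_pos
  rw [c1] at o1
  have c3 := c2.trans f2
  have pf' : 0 < Nat.card (stabilizer (stabilizer Gal(N/ℚ) P) φ) := Nat.card_pos
  constructor
  · apply Nat.eq_of_mul_eq_mul_right pe
    rw [o1, e1, e2, e3]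
  · apply Nat.eq_of_mul_eq_mul_right pf'
    rw [o2, f1, c3, e1, e2, e3, f3]
    ring

lemma exists_smul_embedding_eq (φ ψ : K →ₐ[ℚ] N) : ∃ σ : Gal(N/ℚ), σ • φ = ψ := by
  let := φ.toRingHom.toAlgebra
  have hst : IsScalarTower ℚ K N := IsScalarTower.of_algebraMap_eq' (Subsingleton.elim _ _)
  refine ⟨AlgEquiv.ofBijective (ψ.liftNormal N) (AlgHom.normal_bijective ℚ N N _), ?_⟩
  ext x
  exact ψ.liftNormal_commutes N x

/-- If `τ` relates two embeddings that cut out the same prime, then `P` and `τ⁻¹ • P` lie over one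
prime of `K`. Some `σ` in Gal(N/K) carries the first to the second, and `τ * σ` lies in the
decomposition group. -/
lemma primeBelow_eq_iff (p : Ideal ℤ) [p.IsPrime] (P : Ideal (𝓞 N)) [P.IsPrime]
    [P.LiesOver p] (φ ψ : K →ₐ[ℚ] N) :
    primeBelow P ψ = primeBelow P φ ↔ ψ ∈ orbit (stabilizer Gal(N/ℚ) P) φ := by
  constructor
  · intro h
    obtain ⟨τ, rfl⟩ := exists_smul_embedding_eq ψ φ
    let := ψ.toRingHom.toAlgebra
    have hst : IsScalarTower ℚ K N := IsScalarTower.of_algebraMap_eq' (Subsingleton.elim _ _)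
    let H := fixingSubgroup Gal(N/ℚ) (Set.range (algebraMap K N))
    have hH : IsGaloisGroup H K N := IsGaloisGroup.of_isScalarTower _ ℚ N K
    have hHO : IsGaloisGroup H (𝓞 K) (𝓞 N) := IsGaloisGroup.of_isFractionRing H _ _ K N
    have h1 : P.LiesOver (primeBelow P ψ) := ⟨by ext x; rfl⟩
    have h2 : (τ⁻¹ • P).LiesOver (primeBelow P ψ) := ⟨by
      rw [h, ← primeBelow_smul P τ⁻¹, inv_smul_smul]; rfl⟩
    obtain ⟨σ, hσ⟩ := Ideal.exists_smul_eq_of_isGaloisGroup (primeBelow P ψ) P (τ⁻¹ • P) H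
    have hσψ : σ.1 • ψ = ψ := by
      ext x
      exact (mem_fixingSubgroup_iff _).1 σ.2 _ ⟨x, rfl⟩
    have hmem : τ * σ.1 ∈ stabilizer Gal(N/ℚ) P := by
      rw [mem_stabilizer_iff, mul_smul, show σ.1 • P = τ⁻¹ • P from hσ, smul_inv_smul]
    refine ⟨⟨_, hmem⟩⁻¹, ?_⟩
    show (τ * σ.1)⁻¹ • τ • ψ = ψ
    rw [inv_smul_eq_iff, mul_smul, hσψ]
  · rintro ⟨⟨σ, hσ⟩, rfl⟩
    have : σ • P = P := hσ
    show primeBelow P (σ • φ) = _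
    conv_lhs => rw [← this]
    exact primeBelow_smul _ _ _

/-- Lift `q` to a prime of `N` along `φ₀`. The Galois group moves this prime to `P`, and moving the
embedding along with it does not change the prime below. -/
lemma exists_primeBelow_eq (p : Ideal ℤ) [p.IsPrime] (P : Ideal (𝓞 N)) [P.IsPrime]
    [P.LiesOver p] (q : Ideal (𝓞 K)) [q.IsPrime] [q.LiesOver p] (φ₀ : K →ₐ[ℚ] N) :
    ∃ φ : K →ₐ[ℚ] N, primeBelow P φ = q := by
  let := φ₀.toRingHom.toAlgebra
  have hst : IsScalarTower ℚ K N := IsScalarTower.of_algebraMap_eq' (Subsingleton.elim _ _)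
  obtain ⟨Q, hQ⟩ := (inferInstance : Nonempty (q.primesOver (𝓞 N)))
  have := hQ.1
  have := hQ.2
  have : Q.LiesOver p := Ideal.LiesOver.trans Q q p
  obtain ⟨σ, hσ⟩ := Ideal.exists_smul_eq_of_isGaloisGroup p Q P Gal(N/ℚ)
  refine ⟨σ • φ₀, ?_⟩
  rw [← hσ, primeBelow_smul]
  exact (Ideal.over_def Q q).symm

end Galois

end Decomposition

/-! ### Splitting types as orbit data. -/

section SplittingTypes

open MulAction Pointwise

/-- The multiset in which each entry `(f, e)` of a splitting type is repeated `f * e` times. -/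
def weighted (s : SplittingType) : SplittingType :=
  s.bind fun x => Multiset.replicate (x.1 * x.2) x

lemma count_weighted (s : SplittingType) (x : ℕ × ℕ) :
    (weighted s).count x = s.count x * (x.1 * x.2) := by
  induction s using Multiset.induction with
  | empty => simp [weighted]
  | cons a s ih =>
    rw [weighted, Multiset.cons_bind, Multiset.count_add, ← weighted, ih, Multiset.count_cons,
      Multiset.count_replicate]
    by_cases h : a = x
    · subst h; simp; ring
    · simp [h, Ne.symm h]

/-- Multiplicities are recovered on dividing by f·e, which is why positivity is needed. -/
lemma weighted_injective {s t : SplittingType} (hs : ∀ x ∈ s, 0 < x.1 * x.2)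
    (ht : ∀ x ∈ t, 0 < x.1 * x.2) (h : weighted s = weighted t) : s = t := by
  ext x
  by_cases hx : 0 < x.1 * x.2
  · apply Nat.eq_of_mul_eq_mul_right hx
    rw [← count_weighted, ← count_weighted, h]
  · rw [Multiset.count_eq_zero_of_notMem fun h => hx (hs x h),
      Multiset.count_eq_zero_of_notMem fun h => hx (ht x h)]

/-- For subgroups `I ≤ D` of a group acting on a finite set, the multiset over the points of
`(length of the D-orbit / length of the I-orbit, length of the I-orbit)`. -/
def orbitType {Γ : Type*} [Group Γ] (D I : Subgroup Γ) (Y : Type*) [Fintype Y] [MulAction Γ Y] :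
    Multiset (ℕ × ℕ) :=
  Finset.univ.val.map fun y : Y =>
    (Nat.card (orbit D y) / Nat.card (orbit I y), Nat.card (orbit I y))

variable {K N : Type*} [Field K] [NumberField K] [Field N] [NumberField N]

lemma mem_primesOverFinset_span {p : ℕ} (hp : p.Prime) {P : Ideal (𝓞 K)} :
    P ∈ IsDedekindDomain.primesOverFinset (Ideal.span {(p : ℤ)}) (𝓞 K) ↔
      P.IsPrime ∧ P.LiesOver (Ideal.span {(p : ℤ)}) := by
  have h0 : Ideal.span {(p : ℤ)} ≠ ⊥ := by simpa using hp.ne_zero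
  have : Fact p.Prime := ⟨hp⟩
  have : (Ideal.span {(p : ℤ)}).IsMaximal := Int.ideal_span_isMaximal_of_prime p
  exact IsDedekindDomain.mem_primesOverFinset_iff h0 _

lemma isPrime_span_natCast {p : ℕ} (hp : p.Prime) : (Ideal.span {(p : ℤ)}).IsPrime := by
  have : Fact p.Prime := ⟨hp⟩
  exact (Int.ideal_span_isMaximal_of_prime p).isPrime

lemma mem_splittingType {p : ℕ} (hp : p.Prime) {x : ℕ × ℕ} :
    x ∈ splittingType p K ↔ ∃ P : Ideal (𝓞 K), P.IsPrime ∧ P.LiesOver (Ideal.span {(p : ℤ)}) ∧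
      (P.inertiaDeg ℤ, P.ramificationIdx ℤ) = x := by
  rw [splittingType, Multiset.mem_map]
  refine exists_congr fun P => ?_
  rw [Finset.mem_val, mem_primesOverFinset_span hp, and_assoc]

lemma splittingType_pos {p : ℕ} (hp : p.Prime) : ∀ x ∈ splittingType p K, 0 < x.1 * x.2 := by
  intro x hx
  obtain ⟨P, hP, -, rfl⟩ := (mem_splittingType hp).1 hx
  exact Nat.mul_pos (P.inertiaDeg_pos ℤ) (P.ramificationIdx_pos ℤ)

lemma sum_primesOverFinset {p : ℕ} (hp : p.Prime) :
    ∑ P ∈ IsDedekindDomain.primesOverFinset (Ideal.span {(p : ℤ)}) (𝓞 K),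
      P.inertiaDeg ℤ * P.ramificationIdx ℤ = Module.finrank ℚ K := by
  classical
  have := isPrime_span_natCast hp
  let : Fintype ((Ideal.span {(p : ℤ)}).primesOver (𝓞 K)) :=
    (Algebra.QuasiFinite.finite_primesOver _).fintype
  have h := Ideal.sum_ramification_inertia_eq_finrank (Ideal.span {(p : ℤ)}) (𝓞 K)
  rw [RingOfIntegers.rank] at h
  rw [← h]
  symm
  refine Finset.sum_bij (fun q _ => q.1) ?_ ?_ ?_ ?_
  · intro q _; exact (mem_primesOverFinset_span hp).2 q.2
  · intro _ _ _ _ h; exact Subtype.ext h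
  · intro q hq; exact ⟨⟨q, (mem_primesOverFinset_span hp).1 hq⟩, Finset.mem_univ _, rfl⟩
  · intro q _; rw [mul_comm]

/-- Distinct primes whose residue degrees and ramification indices are large enough to account for
the whole degree determine the splitting type. -/
lemma splittingType_eq_of_primes {p : ℕ} (hp : p.Prime) {ι : Type*} [Fintype ι]
    (P : ι → Ideal (𝓞 K)) (hinj : Function.Injective P) (hP : ∀ i, (P i).IsPrime)
    (hPp : ∀ i, (P i).LiesOver (Ideal.span {(p : ℤ)})) (f e : ι → ℕ)
    (hf : ∀ i, f i ≤ (P i).inertiaDeg ℤ) (he : ∀ i, e i ≤ (P i).ramificationIdx ℤ)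
    (hsum : Module.finrank ℚ K ≤ ∑ i, f i * e i) :
    splittingType p K = Finset.univ.val.map fun i => (f i, e i) := by
  classical
  set S := IsDedekindDomain.primesOverFinset (Ideal.span {(p : ℤ)}) (𝓞 K) with hS
  have htot := sum_primesOverFinset (K := K) hp
  rw [← hS] at htot
  have hsub : Finset.univ.image P ⊆ S := by
    intro Q hQ
    obtain ⟨i, -, rfl⟩ := Finset.mem_image.1 hQ
    exact (mem_primesOverFinset_span hp).2 ⟨hP i, hPp i⟩
  have hpos : ∀ Q ∈ S, 0 < Q.inertiaDeg ℤ * Q.ramificationIdx ℤ := fun Q hQ => by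
    have := ((mem_primesOverFinset_span hp).1 hQ).1
    exact Nat.mul_pos (Q.inertiaDeg_pos ℤ) (Q.ramificationIdx_pos ℤ)
  have h1 : ∑ i, (P i).inertiaDeg ℤ * (P i).ramificationIdx ℤ =
      ∑ Q ∈ Finset.univ.image P, Q.inertiaDeg ℤ * Q.ramificationIdx ℤ := by
    rw [Finset.sum_image fun _ _ _ _ h => hinj h]
  have h2 : ∀ i, f i * e i ≤ (P i).inertiaDeg ℤ * (P i).ramificationIdx ℤ := fun i =>
    Nat.mul_le_mul (hf i) (he i)
  have h3 := Finset.sum_le_sum fun i (_ : i ∈ Finset.univ) => h2 i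
  have h4 := Finset.sum_le_sum_of_subset (f := fun Q : Ideal (𝓞 K) =>
    Q.inertiaDeg ℤ * Q.ramificationIdx ℤ) hsub
  have himg : Finset.univ.image P = S := by
    -- A further prime would add a positive term and push the sum of the products fe beyond the
    -- degree.
    refine Finset.Subset.antisymm hsub fun Q hQ => ?_
    by_contra hn
    have h5 := Finset.sum_le_sum_of_subset (f := fun Q : Ideal (𝓞 K) =>
      Q.inertiaDeg ℤ * Q.ramificationIdx ℤ) (Finset.insert_subset hQ hsub)
    rw [Finset.sum_insert hn] at h5
    have := hpos Q hQ
    omega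
  have h6 : ∀ i, f i * e i = (P i).inertiaDeg ℤ * (P i).ramificationIdx ℤ := by
    have := (Finset.sum_eq_sum_iff_of_le fun i (_ : i ∈ Finset.univ) => h2 i).1 (by omega)
    exact fun i => this i (Finset.mem_univ i)
  have h7 : ∀ i, (f i, e i) = ((P i).inertiaDeg ℤ, (P i).ramificationIdx ℤ) := fun i => by
    have hpi := hpos _ (hsub (Finset.mem_image_of_mem P (Finset.mem_univ i)))
    have := h6 i
    have hfi := hf i
    have hei := he i
    have hF := Nat.pos_of_mul_pos_right hpi
    have hE := Nat.pos_of_mul_pos_left hpi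
    have a1 : f i = (P i).inertiaDeg ℤ := by
      refine le_antisymm hfi (Nat.le_of_mul_le_mul_right ?_ hE)
      rw [← this]; exact Nat.mul_le_mul_left _ hei
    have a2 : e i = (P i).ramificationIdx ℤ := by
      refine le_antisymm hei (Nat.le_of_mul_le_mul_left ?_ hF)
      rw [← this]; exact Nat.mul_le_mul_right _ hfi
    rw [a1, a2]
  rw [splittingType, ← hS, ← himg, Finset.image_val_of_injOn hinj.injOn, Multiset.map_map]
  exact Multiset.map_congr rfl fun i _ => (h7 i).symm

/-- The splitting type of `p` in `K`, from the action of decomposition and inertia groups on the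
embeddings of `K` into a Galois field. -/
theorem weighted_splittingType [IsGalois ℚ N] {p : ℕ} (hp : p.Prime) (P : Ideal (𝓞 N))
    [P.IsPrime] [P.LiesOver (Ideal.span {(p : ℤ)})] [Nonempty (K →ₐ[ℚ] N)] :
    weighted (splittingType p K) =
      orbitType (stabilizer Gal(N/ℚ) P) (P.inertia Gal(N/ℚ)) (K →ₐ[ℚ] N) := by
  classical
  have := isPrime_span_natCast hp
  set S := IsDedekindDomain.primesOverFinset (Ideal.span {(p : ℤ)}) (𝓞 K) with hS
  have hor := card_orbit_inertia_eq (K := K) (Ideal.span {(p : ℤ)}) P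
  have htype : orbitType (stabilizer Gal(N/ℚ) P) (P.inertia Gal(N/ℚ)) (K →ₐ[ℚ] N) =
      Finset.univ.val.map fun φ : K →ₐ[ℚ] N =>
        ((primeBelow P φ).inertiaDeg ℤ, (primeBelow P φ).ramificationIdx ℤ) := by
    refine Multiset.map_congr rfl fun φ _ => ?_
    rw [(hor φ).1, (hor φ).2, Nat.mul_div_cancel _ ((primeBelow P φ).ramificationIdx_pos ℤ)]
  rw [htype]
  ext x
  rw [count_weighted, splittingType, Multiset.count_map, Multiset.count_map, ← Finset.filter_val,
    ← Finset.filter_val, Finset.card_val, Finset.card_val, ← hS]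
  have hmaps : Set.MapsTo (primeBelow (K := K) P)
      (Finset.univ.filter fun φ : K →ₐ[ℚ] N =>
        x = ((primeBelow P φ).inertiaDeg ℤ, (primeBelow P φ).ramificationIdx ℤ))
      (S.filter fun Q => x = (Q.inertiaDeg ℤ, Q.ramificationIdx ℤ)) := by
    intro φ hφ
    simp only [Finset.coe_filter, Finset.mem_univ, true_and, Set.mem_ofPred_eq] at hφ ⊢
    exact ⟨(mem_primesOverFinset_span hp).2 ⟨inferInstance, inferInstance⟩, hφ⟩
  -- Embeddings are counted prime by prime: the fibre of `primeBelow P` over a prime of type (f, e)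
  -- is a single D-orbit, of length fe.
  rw [Finset.card_eq_sum_card_fiberwise hmaps, ← smul_eq_mul, ← Finset.sum_const]
  refine Finset.sum_congr rfl fun Q hQ => ?_
  obtain ⟨hQ1, rfl⟩ := Finset.mem_filter.1 hQ
  obtain ⟨_, _⟩ := (mem_primesOverFinset_span hp).1 hQ1
  obtain ⟨φ, rfl⟩ := exists_primeBelow_eq (Ideal.span {(p : ℤ)}) P Q
    (Classical.arbitrary (K →ₐ[ℚ] N))
  rw [← (hor φ).2, Finset.filter_filter]
  rw [Nat.card_eq_card_toFinset]
  refine congrArg Finset.card ?_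
  ext ψ
  simp only [Set.mem_toFinset, Finset.mem_filter, Finset.mem_univ, true_and]
  rw [← primeBelow_eq_iff (Ideal.span {(p : ℤ)})]
  constructor
  · intro h; exact ⟨by rw [h], h⟩
  · exact fun h => h.2

end SplittingTypes

/-! ### The finite table: subgroups of S₄ acting on points, pairings and two-element subsets. -/

section Combinatorics

open MulAction Equiv

/-- The three partitions of `Fin 4` into two pairs, given as fixed point free involutions. -/
def Pairing : Type := {v : Perm (Fin 4) // v * v = 1 ∧ ∀ i, v i ≠ i}

/-- The six two-element subsets of `Fin 4`. -/
def TwoSubset : Type := {s : Finset (Fin 4) // s.card = 2}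

/-- A pairing is determined by the partner of `0`. -/
instance : DecidableEq Pairing := fun v w =>
  decidable_of_iff (v.1 0 = w.1 0) ⟨fun h => Subtype.ext <| by
    obtain ⟨v, hv⟩ := v
    obtain ⟨w, hw⟩ := w
    revert v w
    decide +kernel, fun h => h ▸ rfl⟩
instance : Fintype Pairing :=
  inferInstanceAs (Fintype {v : Perm (Fin 4) // v * v = 1 ∧ ∀ i, v i ≠ i})
-- A subset is compared through the binary number whose digits mark its elements.
instance : DecidableEq TwoSubset := fun v w =>
  decidable_of_iff (∑ i ∈ v.1, 2 ^ i.1 = ∑ i ∈ w.1, 2 ^ i.1) ⟨fun h => Subtype.ext <| by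
    obtain ⟨v, hv⟩ := v
    obtain ⟨w, hw⟩ := w
    revert v w
    decide +kernel, fun h => h ▸ rfl⟩
instance : Fintype TwoSubset := inferInstanceAs (Fintype {s : Finset (Fin 4) // s.card = 2})

instance : MulAction (Perm (Fin 4)) Pairing where
  smul g v := ⟨g * v.1 * g⁻¹, by
    constructor
    · calc g * v.1 * g⁻¹ * (g * v.1 * g⁻¹) = g * (v.1 * v.1) * g⁻¹ := by group
        _ = 1 := by rw [v.2.1]; group
    · intro i h
      apply v.2.2 (g⁻¹ i)
      rw [Perm.mul_apply, Perm.mul_apply] at h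
      rw [Perm.eq_inv_iff_eq]; exact h⟩
  one_smul v := Subtype.ext (by change 1 * v.1 * 1⁻¹ = v.1; group)
  mul_smul g h v := Subtype.ext (by
    change g * h * v.1 * (g * h)⁻¹ = g * (h * v.1 * h⁻¹) * g⁻¹; group)

instance : MulAction (Perm (Fin 4)) TwoSubset where
  smul g s := ⟨s.1.map g.toEmbedding, by rw [Finset.card_map, s.2]⟩
  one_smul s := Subtype.ext (by change s.1.map _ = s.1; ext; simp [Perm.one_def])
  mul_smul g h s := Subtype.ext (by
    change s.1.map _ = (s.1.map _).map _
    rw [Finset.map_map]; rfl)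

/-- `(splitting type in the quartic field, in its cubic resolvent, in the sextic field)`. -/
abbrev TypeRow : Type := SplittingType × SplittingType × SplittingType

/-- Up to conjugation, a subgroup of `Perm (Fin 4)` lies between the sets `innerPerms j` and `outerPerms j`
for one `j`. -/
def innerPerms : Fin 8 → List (Perm (Fin 4))
  | 0 => [1]
  | 1 => [1, swap 0 1]
  | 2 => [1, swap 0 1 * swap 2 3]
  | 3 => [1, swap 0 1, swap 2 3, swap 0 1 * swap 2 3]
  | 4 => [1, swap 0 1 * swap 2 3, swap 0 2 * swap 1 3, swap 0 3 * swap 1 2]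
  | 5 => [1, swap 0 1 * swap 1 2, swap 1 2 * swap 0 1]
  | 6 => [1, swap 0 1 * swap 1 2 * swap 2 3, swap 0 2 * swap 1 3, swap 2 3 * swap 1 2 * swap 0 1]
  | 7 => [1, swap 0 1 * swap 2 3, swap 0 2 * swap 1 3, swap 0 3 * swap 1 2].flatMap
      fun v => [v, v * (swap 0 1 * swap 1 2), v * (swap 1 2 * swap 0 1)]

/-- See `innerPerms`. -/
def outerPerms (j : Fin 8) (g : Perm (Fin 4)) : Bool :=
  match j with
  -- The bounds differ in three classes only: C₃ and S₃; C₄ and D₄, the latter being the centralizer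
  -- of (0 2)(1 3); A₄ and S₄.
  | 5 => g 3 = 3
  | 6 => g * (swap 0 2 * swap 1 3) = swap 0 2 * swap 1 3 * g
  | 7 => true
  | j => g ∈ innerPerms j

/-- The splitting types that belong to an inertia group of the given class. -/
def rows : Fin 8 → List TypeRow
  | 0 => [
      ({(1, 1), (1, 1), (1, 1), (1, 1)}, {(1, 1), (1, 1), (1, 1)},
        {(1, 1), (1, 1), (1, 1), (1, 1), (1, 1), (1, 1)}),
      ({(2, 1), (1, 1), (1, 1)}, {(2, 1), (1, 1)}, {(1, 1), (1, 1), (2, 1), (2, 1)}),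
      ({(2, 1), (2, 1)}, {(1, 1), (1, 1), (1, 1)}, {(1, 1), (1, 1), (2, 1), (2, 1)}),
      ({(3, 1), (1, 1)}, {(3, 1)}, {(3, 1), (3, 1)}),
      ({(4, 1)}, {(2, 1), (1, 1)}, {(4, 1), (2, 1)})]
  | 1 => [
      ({(1, 2), (1, 1), (1, 1)}, {(1, 2), (1, 1)}, {(1, 1), (1, 1), (1, 2), (1, 2)}),
      ({(2, 1), (1, 2)}, {(1, 2), (1, 1)}, {(1, 1), (1, 1), (2, 2)})]
  | 2 => [
      ({(1, 2), (1, 2)}, {(1, 1), (1, 1), (1, 1)}, {(1, 1), (1, 1), (1, 2), (1, 2)}),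
      ({(1, 2), (1, 2)}, {(2, 1), (1, 1)}, {(1, 1), (1, 1), (2, 2)}),
      ({(2, 2)}, {(1, 1), (1, 1), (1, 1)}, {(2, 1), (1, 2), (1, 2)}),
      ({(2, 2)}, {(2, 1), (1, 1)}, {(2, 1), (2, 2)})]
  | 3 => [
      ({(1, 2), (1, 2)}, {(1, 2), (1, 1)}, {(1, 1), (1, 1), (1, 4)}),
      ({(2, 2)}, {(1, 2), (1, 1)}, {(2, 1), (1, 4)})]
  | 4 => [
      ({(1, 4)}, {(1, 1), (1, 1), (1, 1)}, {(1, 2), (1, 2), (1, 2)}),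
      ({(1, 4)}, {(2, 1), (1, 1)}, {(1, 2), (2, 2)}),
      ({(1, 4)}, {(3, 1)}, {(3, 2)})]
  | 5 => [({(1, 3), (1, 1)}, {(1, 3)}, {(1, 3), (1, 3)})]
  | 6 => [({(1, 4)}, {(1, 2), (1, 1)}, {(1, 2), (1, 4)})]
  | 7 => [({(1, 4)}, {(1, 3)}, {(1, 6)})]

/-- The computable counterpart of `orbitType`. -/
def listOrbitType (R : List (Perm (Fin 4))) (φ : Perm (Fin 4)) (Y : Type*) [Fintype Y]
    [DecidableEq Y] [MulAction (Perm (Fin 4)) Y] : Multiset (ℕ × ℕ) :=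
  Finset.univ.val.map fun y : Y =>
    let l := (R.map fun r => r • y).dedup
    (((List.range 4).flatMap fun n => l.map fun z => (φ ^ n) • z).dedup.length / l.length,
      l.length)

set_option maxRecDepth 100000 in
-- When I lies between the two bounds, normality of I under `φ` says at least that `φ` conjugates
-- the lower bound into the upper one. This weaker condition does not mention I and already
-- suffices, so only finitely many pairs (class, permutation) have to be inspected.
lemma listOrbitType_mem_rows : ∀ j : Fin 8, ∀ φ : Perm (Fin 4),
    (∀ r ∈ innerPerms j, outerPerms j (φ * r * φ⁻¹)) → ∃ row ∈ rows j,
      listOrbitType (innerPerms j) φ (Fin 4) = weighted row.1 ∧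
      listOrbitType (innerPerms j) φ Pairing = weighted row.2.1 ∧
      listOrbitType (innerPerms j) φ TwoSubset = weighted row.2.2 := by
  decide +kernel

set_option maxRecDepth 100000 in
-- This is why the eleven conjugacy classes of subgroups of S₄ can be grouped into eight: two groups
-- put in the same class have the same orbits on each of the three sets.
lemma exists_inner_smul_eq : ∀ j : Fin 8, ∀ g : Perm (Fin 4), outerPerms j g →
    (∀ y : Fin 4, ∃ r ∈ innerPerms j, g • y = r • y) ∧
    (∀ y : Pairing, ∃ r ∈ innerPerms j, g • y = r • y) ∧
    (∀ y : TwoSubset, ∃ r ∈ innerPerms j, g • y = r • y) := by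
  decide +kernel

end Combinatorics

/-! ### Classification of the subgroups of S₄ and evaluation of their orbit data. -/

section Combinatorics

open MulAction Equiv

lemma card_orbit_eq_of_equivariant {Γ Γ' Y Y' : Type*} [Group Γ] [Group Γ'] [MulAction Γ Y]
    [MulAction Γ' Y'] (ρ : Γ →* Γ') (e : Y ≃ Y') (he : ∀ (g : Γ) (y : Y), e (g • y) = ρ g • e y)
    (H : Subgroup Γ) (y : Y) : Nat.card (orbit (H.map ρ) (e y)) = Nat.card (orbit H y) := by
  symm
  refine Nat.card_congr (e.subtypeEquiv fun z => ?_)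
  constructor
  · rintro ⟨g, rfl⟩
    exact ⟨⟨ρ g, Subgroup.mem_map_of_mem ρ g.2⟩, (he g.1 y).symm⟩
  · rintro ⟨⟨_, g, hg, rfl⟩, h⟩
    exact ⟨⟨g, hg⟩, e.injective ((he g y).trans h)⟩

lemma orbitType_map {Γ Γ' Y Y' : Type*} [Group Γ] [Group Γ'] [MulAction Γ Y] [MulAction Γ' Y']
    [Fintype Y] [Fintype Y'] (ρ : Γ →* Γ') (e : Y ≃ Y')
    (he : ∀ (g : Γ) (y : Y), e (g • y) = ρ g • e y) (D I : Subgroup Γ) :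
    orbitType (D.map ρ) (I.map ρ) Y' = orbitType D I Y := by
  rw [orbitType, orbitType, ← Finset.map_univ_equiv e, Finset.map_val, Multiset.map_map]
  refine Multiset.map_congr rfl fun y _ => ?_
  simp only [Function.comp_apply, Equiv.coe_toEmbedding]
  rw [card_orbit_eq_of_equivariant ρ e he, card_orbit_eq_of_equivariant ρ e he]

lemma orbitType_conj {Γ Y : Type*} [Group Γ] [MulAction Γ Y] [Fintype Y] (g : Γ)
    (D I : Subgroup Γ) : orbitType (D.map (MulAut.conj g).toMonoidHom)
      (I.map (MulAut.conj g).toMonoidHom) Y = orbitType D I Y :=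
  orbitType_map _ (MulAction.toPerm g) (fun x y => by simp [mul_smul]) D I

lemma card_orbit_eq_length {Γ Y : Type*} [Group Γ] [MulAction Γ Y] [DecidableEq Y]
    (H : Subgroup Γ) (y : Y) (l : List Y) (hl : ∀ z, z ∈ l ↔ ∃ g ∈ H, g • y = z) :
    Nat.card (orbit H y) = l.dedup.length := by
  rw [← List.card_toFinset, ← Set.ncard_coe_finset, ← Nat.card_coe_set_eq]
  refine Nat.card_congr (Equiv.setCongr ?_)
  ext z
  simp only [mem_orbit_iff, Finset.mem_coe, List.mem_toFinset, hl]
  exact ⟨fun ⟨g, hg⟩ => ⟨g.1, g.2, hg⟩, fun ⟨g, hg, h⟩ => ⟨⟨g, hg⟩, h⟩⟩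

/-- D is a union of cosets φⁿI, so a D-orbit is the union of the φⁿ-translates of an I-orbit, and
the elements of `R` already sweep out every I-orbit. -/
lemma orbitType_eq_listOrbitType (D I : Subgroup (Perm (Fin 4))) (φ : Perm (Fin 4)) (hφ : φ ∈ D)
    (hID : I ≤ D) (hD : ∀ d ∈ D, ∃ n : ℕ, ∃ i ∈ I, d = φ ^ n * i) (R : List (Perm (Fin 4)))
    (hR : ∀ r ∈ R, r ∈ I) (Y : Type*) [Fintype Y] [DecidableEq Y] [MulAction (Perm (Fin 4)) Y]
    (hRI : ∀ g ∈ I, ∀ y : Y, ∃ r ∈ R, g • y = r • y) :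
    orbitType D I Y = listOrbitType R φ Y := by
  have hord : ∀ ψ : Perm (Fin 4), ∀ n : ℕ, ∃ m ∈ List.range 4, ψ ^ n = ψ ^ m := by
    intro ψ n
    -- Permutations of four points have order at most 4, so exponents below 4 exhaust the powers.
    have h : ∃ k ∈ List.range 4, ψ ^ (k + 1) = 1 := by revert ψ; decide +kernel
    obtain ⟨k, hk, h⟩ := h
    refine ⟨n % (k + 1), ?_, pow_eq_pow_mod n h⟩
    rw [List.mem_range] at hk ⊢
    exact (Nat.mod_lt _ k.succ_pos).trans_le hk
  refine Multiset.map_congr rfl fun y _ => ?_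
  have h1 : ∀ z, z ∈ R.map (fun r => r • y) ↔ ∃ g ∈ I, g • y = z := by
    intro z
    rw [List.mem_map]
    constructor
    · rintro ⟨r, hr, rfl⟩; exact ⟨r, hR r hr, rfl⟩
    · rintro ⟨g, hg, rfl⟩
      obtain ⟨r, hr, h⟩ := hRI g hg y
      exact ⟨r, hr, h.symm⟩
  rw [card_orbit_eq_length I y _ h1, card_orbit_eq_length D y]
  intro z
  rw [List.mem_flatMap]
  constructor
  · rintro ⟨n, -, hz⟩
    obtain ⟨w, hw, rfl⟩ := List.mem_map.1 hz
    obtain ⟨g, hg, rfl⟩ := (h1 w).1 (List.mem_dedup.1 hw)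
    exact ⟨φ ^ n * g, mul_mem (pow_mem hφ n) (hID hg), mul_smul _ _ _⟩
  · rintro ⟨d, hd, rfl⟩
    obtain ⟨n, i, hi, rfl⟩ := hD d hd
    obtain ⟨m, hm, h⟩ := hord φ n
    exact ⟨m, hm, List.mem_map.2 ⟨i • y, List.mem_dedup.2 ((h1 _).2 ⟨i, hi, rfl⟩), by
      rw [h, mul_smul]⟩⟩

/-- `I` is conjugate, by `g`, to a subgroup of class `j`. -/
def HasClass (I : Subgroup (Perm (Fin 4))) (j : Fin 8) (g : Perm (Fin 4)) : Prop :=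
  (∀ r ∈ innerPerms j, g * r * g⁻¹ ∈ I) ∧ ∀ x ∈ I, outerPerms j (g⁻¹ * x * g)

/-- Allows a chosen element of I to be conjugated into a standard position. -/
lemma exists_hasClass_of_comap {I : Subgroup (Perm (Fin 4))} (g : Perm (Fin 4))
    (h : ∃ j h, HasClass (I.comap (MulAut.conj g).toMonoidHom) j h) : ∃ j h, HasClass I j h := by
  obtain ⟨j, h, h1, h2⟩ := h
  refine ⟨j, g * h, fun r hr => ?_, fun x hx => ?_⟩
  · have := h1 r hr
    rw [Subgroup.mem_comap] at this
    convert this using 1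
    simp [mul_assoc]
  · have := h2 (g⁻¹ * x * g) (by rw [Subgroup.mem_comap]; simpa [mul_assoc] using hx)
    convert this using 2
    group

lemma hasClass_one {I : Subgroup (Perm (Fin 4))} {j : Fin 8} (h1 : ∀ r ∈ innerPerms j, r ∈ I)
    (h2 : ∀ x ∈ I, outerPerms j x) : ∃ j h, HasClass I j h :=
  ⟨j, 1, by simpa using h1, by simpa using h2⟩

set_option maxRecDepth 100000 in
-- If I fixes the point 3 it lies between C₃ and S₃. Otherwise an element moving 3 yields, by a
-- short word in it and the 3-cycle, a fixed point free involution. The conjugates of this under the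
-- 3-cycle fill the normal Klein group, so I contains A₄.
lemma exists_hasClass_of_threeCycle (I : Subgroup (Perm (Fin 4)))
    (hc : swap 0 1 * swap 1 2 ∈ I) : ∃ j h, HasClass I j h := by
  set c : Perm (Fin 4) := swap 0 1 * swap 1 2 with hcdef
  by_cases h : ∀ x ∈ I, x 3 = 3
  · refine hasClass_one (j := 5) (fun r hr => ?_) fun x hx => by simpa [outerPerms] using h x hx
    simp only [innerPerms, List.mem_cons, List.not_mem_nil, or_false] at hr
    rcases hr with rfl | rfl | rfl
    · exact one_mem _
    · exact hc
    · have : swap 1 2 * swap 0 1 = c⁻¹ := by decide +kernel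
      rw [this]; exact inv_mem hc
  · push Not at h
    obtain ⟨x, hx, hx3⟩ := h
    have h1 : ∃ w ∈ [x * c, x * c⁻¹, x, x * x, x * c * (x * c)], w * w = 1 ∧ ∀ i, w i ≠ i := by
      rw [hcdef]; clear hx; revert x; decide +kernel
    obtain ⟨w, hw, hw1⟩ := h1
    have hwI : w ∈ I := by
      simp only [List.mem_cons, List.not_mem_nil, or_false] at hw
      rcases hw with rfl | rfl | rfl | rfl | rfl
      · exact mul_mem hx hc
      · exact mul_mem hx (inv_mem hc)
      · exact hx
      · exact mul_mem hx hx
      · exact mul_mem (mul_mem hx hc) (mul_mem hx hc)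
    refine hasClass_one (j := 7) (fun r hr => ?_) fun x hx => rfl
    have h2 : ∃ v ∈ [1, w, c * w * c⁻¹, c⁻¹ * w * c], ∃ u ∈ [1, c, c⁻¹], v * u = r := by
      rw [hcdef]; clear hw hwI; revert r w; decide +kernel
    obtain ⟨v, hv, u, hu, rfl⟩ := h2
    refine mul_mem ?_ ?_
    · simp only [List.mem_cons, List.not_mem_nil, or_false] at hv
      rcases hv with rfl | rfl | rfl | rfl
      · exact one_mem _
      · exact hwI
      · exact mul_mem (mul_mem hc hwI) (inv_mem hc)
      · exact mul_mem (mul_mem (inv_mem hc) hwI) hc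
    · simp only [List.mem_cons, List.not_mem_nil, or_false] at hu
      rcases hu with rfl | rfl | rfl
      · exact one_mem _
      · exact hc
      · exact inv_mem hc

set_option maxRecDepth 100000 in
/-- Every subgroup of `Perm (Fin 4)` belongs to one of the eight classes. -/
theorem exists_hasClass (I : Subgroup (Perm (Fin 4))) : ∃ j h, HasClass I j h := by
  -- The cases are separated by the kind of element present: one of order 3; failing that a 4-cycle;
  -- failing that a transposition. What remains lies in the normal Klein group.
  by_cases h3 : ∃ x ∈ I, x ≠ 1 ∧ x * x * x = 1
  · obtain ⟨x, hx, hx1⟩ := h3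
    have : ∃ g, g * (swap 0 1 * swap 1 2) * g⁻¹ = x := by
      clear hx; revert x; decide +kernel
    obtain ⟨g, rfl⟩ := this
    exact exists_hasClass_of_comap g (exists_hasClass_of_threeCycle _ hx)
  push Not at h3
  by_cases h4 : ∃ x ∈ I, x * x ≠ 1
  · obtain ⟨x, hx, hx1⟩ := h4
    have : ∃ g, g * (swap 0 1 * swap 1 2 * swap 2 3) * g⁻¹ = x := by
      have := h3 x hx
      clear hx h3; revert x; decide +kernel
    obtain ⟨g, rfl⟩ := this
    refine exists_hasClass_of_comap g (hasClass_one (j := 6) (fun r hr => ?_) fun y hy => ?_)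
    · rw [Subgroup.mem_comap]
      have h2 : ∃ n : Fin 4, (swap 0 1 * swap 1 2 * swap 2 3) ^ n.1 = r := by
        revert r; decide +kernel
      obtain ⟨n, rfl⟩ := h2
      rw [map_pow]
      exact pow_mem hx _
    · rw [Subgroup.mem_comap] at hy
      by_contra hn
      -- An element outside the centralizer D₄ has an element of order 3 in its coset modulo the
      -- 4-cycle, and these have been excluded.
      have h2 : ∃ n : Fin 4, y * (swap 0 1 * swap 1 2 * swap 2 3) ^ n.1 ≠ 1 ∧
          y * (swap 0 1 * swap 1 2 * swap 2 3) ^ n.1 * (y * (swap 0 1 * swap 1 2 * swap 2 3) ^ n.1)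
            * (y * (swap 0 1 * swap 1 2 * swap 2 3) ^ n.1) = 1 := by
        clear hy; revert y; decide +kernel
      obtain ⟨n, hn1, hn2⟩ := h2
      have hmem := mul_mem hy (pow_mem hx n.1)
      change (MulAut.conj g).toMonoidHom y * ((MulAut.conj g).toMonoidHom _) ^ n.1 ∈ I at hmem
      rw [← map_pow, ← map_mul] at hmem
      refine h3 _ hmem ?_ ?_
      · exact fun h => hn1 ((MulAut.conj g).map_eq_one_iff.1 h)
      · rw [← map_mul, ← map_mul, hn2, map_one]
  push Not at h4
  by_cases ht : ∃ x ∈ I, x ≠ 1 ∧ ∃ i, x i = i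
  · obtain ⟨x, hx, hx1⟩ := ht
    have : ∃ g, g * swap 0 1 * g⁻¹ = x := by
      have := h4 x hx
      clear hx; revert x; decide +kernel
    obtain ⟨g, rfl⟩ := this
    apply exists_hasClass_of_comap g
    set J := I.comap (MulAut.conj g).toMonoidHom
    have htJ : swap 0 1 ∈ J := hx
    have hJ : ∀ y ∈ J, y * y = 1 := fun y hy => by
      have := h4 _ hy
      rw [← map_mul] at this
      exact (MulAut.conj g).map_eq_one_iff.1 this
    -- Both y and y(0 1) square to the identity, so y commutes with (0 1).
    have hout : ∀ y ∈ J, y ∈ innerPerms 3 := fun y hy => by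
      have h1 := hJ y hy
      have h2 := hJ _ (mul_mem hy htJ)
      clear hy; revert y; decide +kernel
    by_cases hsub : ∀ y ∈ J, y ∈ innerPerms 1
    · refine hasClass_one (j := 1) (fun r hr => ?_) fun y hy => by simpa [outerPerms] using hsub y hy
      simp only [innerPerms, List.mem_cons, List.not_mem_nil, or_false] at hr
      rcases hr with rfl | rfl
      exacts [one_mem _, htJ]
    · push Not at hsub
      obtain ⟨y, hy, hyn⟩ := hsub
      refine hasClass_one (j := 3) (fun r hr => ?_) fun y hy => by simpa [outerPerms] using hout y hy
      have h2 : r ∈ [1, swap 0 1, y, swap 0 1 * y] := by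
        have := hout y hy
        clear hy; revert r y; decide +kernel
      simp only [List.mem_cons, List.not_mem_nil, or_false] at h2
      rcases h2 with rfl | rfl | rfl | rfl
      exacts [one_mem _, htJ, hy, mul_mem htJ hy]
  push Not at ht
  have hV : ∀ x ∈ I, x ∈ innerPerms 4 := fun x hx => by
    have h1 := h4 x hx
    have h2 := ht x hx
    clear hx; revert x; decide +kernel
  by_cases hz : ∃ x ∈ I, x ≠ 1
  · obtain ⟨x, hx, hx1⟩ := hz
    have : ∃ g, g * (swap 0 1 * swap 2 3) * g⁻¹ = x := by
      have := hV x hx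
      clear hx; revert x; decide +kernel
    obtain ⟨g, rfl⟩ := this
    apply exists_hasClass_of_comap g
    have hconj : ∀ g y : Perm (Fin 4), g * y * g⁻¹ ∈ innerPerms 4 → y ∈ innerPerms 4 := by
      decide +kernel
    set J := I.comap (MulAut.conj g).toMonoidHom
    have hzJ : swap 0 1 * swap 2 3 ∈ J := hx
    have hout : ∀ y ∈ J, y ∈ innerPerms 4 := fun y hy => hconj g y (hV _ hy)
    by_cases hsub : ∀ y ∈ J, y ∈ innerPerms 2
    · refine hasClass_one (j := 2) (fun r hr => ?_) fun y hy => by simpa [outerPerms] using hsub y hy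
      simp only [innerPerms, List.mem_cons, List.not_mem_nil, or_false] at hr
      rcases hr with rfl | rfl
      exacts [one_mem _, hzJ]
    · push Not at hsub
      obtain ⟨y, hy, hyn⟩ := hsub
      refine hasClass_one (j := 4) (fun r hr => ?_) fun y hy => by simpa [outerPerms] using hout y hy
      have h2 : r ∈ [1, swap 0 1 * swap 2 3, y, swap 0 1 * swap 2 3 * y] := by
        have := hout y hy
        clear hy; revert r y; decide +kernel
      simp only [List.mem_cons, List.not_mem_nil, or_false] at h2
      rcases h2 with rfl | rfl | rfl | rfl
      exacts [one_mem _, hzJ, hy, mul_mem hzJ hy]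
  · push Not at hz
    exact hasClass_one (j := 0) (by simp [innerPerms, one_mem]) fun y hy => by
      rw [hz y hy]; decide

/-- The splitting types that can be read off from a pair (decomposition group, inertia group) in
`Perm (Fin 4)`. -/
theorem exists_row (D I : Subgroup (Perm (Fin 4))) (φ : Perm (Fin 4)) (hφ : φ ∈ D)
    (hID : I ≤ D) (hD : ∀ d ∈ D, ∃ n : ℕ, ∃ i ∈ I, d = φ ^ n * i)
    (hnorm : ∀ i ∈ I, φ * i * φ⁻¹ ∈ I) :
    ∃ j g, HasClass I j g ∧ ∃ row ∈ rows j,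
      orbitType D I (Fin 4) = weighted row.1 ∧ orbitType D I Pairing = weighted row.2.1 ∧
      orbitType D I TwoSubset = weighted row.2.2 := by
  obtain ⟨j, g, h1, h2⟩ := exists_hasClass I
  refine ⟨j, g, ⟨h1, h2⟩, ?_⟩
  let κ := (MulAut.conj g⁻¹).toMonoidHom
  have hκ : ∀ x, κ x = g⁻¹ * x * g := fun x => by simp [κ]
  have hR : ∀ r ∈ innerPerms j, r ∈ I.map κ := fun r hr =>
    ⟨_, h1 r hr, by rw [hκ]; group⟩
  have hS : ∀ x ∈ I.map κ, outerPerms j x := by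
    rintro _ ⟨x, hx, rfl⟩; rw [hκ]; exact h2 x hx
  obtain ⟨row, hrow, e1, e2, e3⟩ := listOrbitType_mem_rows j (κ φ) (fun r hr => by
    obtain ⟨x, hx, rfl⟩ := hR r hr
    rw [← map_inv, ← map_mul, ← map_mul]
    exact hS _ ⟨_, hnorm x hx, rfl⟩)
  have hφ' : κ φ ∈ D.map κ := ⟨φ, hφ, rfl⟩
  have hID' : I.map κ ≤ D.map κ := Subgroup.map_mono hID
  have hD' : ∀ d ∈ D.map κ, ∃ n : ℕ, ∃ i ∈ I.map κ, d = κ φ ^ n * i := by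
    rintro _ ⟨d, hd, rfl⟩
    obtain ⟨n, i, hi, rfl⟩ := hD d hd
    exact ⟨n, κ i, ⟨i, hi, rfl⟩, by rw [map_mul, map_pow]⟩
  have hS' := fun x hx => exists_inner_smul_eq j x (hS x hx)
  refine ⟨row, hrow, ?_, ?_, ?_⟩
  · rw [← e1, ← orbitType_conj g⁻¹]
    exact orbitType_eq_listOrbitType _ _ _ hφ' hID' hD' _ hR _ fun x hx => (hS' x hx).1
  · rw [← e2, ← orbitType_conj g⁻¹]
    exact orbitType_eq_listOrbitType _ _ _ hφ' hID' hD' _ hR _ fun x hx => (hS' x hx).2.1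
  · rw [← e3, ← orbitType_conj g⁻¹]
    exact orbitType_eq_listOrbitType _ _ _ hφ' hID' hD' _ hR _ fun x hx => (hS' x hx).2.2

end Combinatorics

/-! ### Embeddings as Galois sets: roots and the cubic resolvent. -/

section GaloisSets

open MulAction Equiv

instance (L : Type*) [Field L] [NumberField L] : IsGalois ℚ (GaloisClosure L) where
  to_isSeparable := inferInstance
  to_normal := by
    have : IsAlgClosure ℚ (AlgebraicClosure L) := IsAlgClosure.ofAlgebraic ℚ L _
    have := IsAlgClosure.normal ℚ (AlgebraicClosure L)
    exact normalClosure.normal ℚ L (AlgebraicClosure L)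

instance (L : Type*) [Field L] [NumberField L] : NumberField (GaloisClosure L) where
  to_charZero := inferInstance
  to_finiteDimensional := normalClosure.is_finiteDimensional ℚ L (AlgebraicClosure L)

lemma nonempty_embedding_galoisClosure (L : Type*) [Field L] [NumberField L] :
    Nonempty (L →ₐ[ℚ] GaloisClosure L) :=
  ⟨(IsScalarTower.toAlgHom ℚ L (AlgebraicClosure L)).codRestrict
    (GaloisClosure L).toSubalgebra fun x =>
      AlgHom.fieldRange_le_normalClosure (IsScalarTower.toAlgHom ℚ L (AlgebraicClosure L)) ⟨x, rfl⟩⟩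

/-- The fixed field of `σ` contains the images of all embeddings of `L`, and these generate the
Galois closure. -/
lemma eq_one_of_smul_embedding_eq {L : Type*} [Field L] [NumberField L]
    (σ : Gal(GaloisClosure L/ℚ)) (h : ∀ φ : L →ₐ[ℚ] GaloisClosure L, σ • φ = φ) : σ = 1 := by
  let F : IntermediateField ℚ (GaloisClosure L) :=
    IntermediateField.fixedField (Subgroup.zpowers σ)
  have hF : ∀ x, x ∈ F ↔ σ x = x := by
    intro x
    rw [IntermediateField.mem_fixedField_iff]
    constructor
    · intro h; exact h σ (Subgroup.mem_zpowers σ)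
    · rintro h _ ⟨n, rfl⟩
      have : σ ∈ MulAction.stabilizer Gal(GaloisClosure L/ℚ) x := h
      exact Subgroup.zpow_mem _ this n
  have htop : F.map (GaloisClosure L).val = GaloisClosure L := by
    apply le_antisymm
    · rintro _ ⟨x, -, rfl⟩; exact x.2
    · refine iSup_le fun f => ?_
      rintro _ ⟨x, rfl⟩
      let f' : L →ₐ[ℚ] GaloisClosure L := f.codRestrict (GaloisClosure L).toSubalgebra
        fun x => AlgHom.fieldRange_le_normalClosure f ⟨x, rfl⟩
      exact ⟨f' x, (hF _).2 (DFunLike.congr_fun (h f') x), rfl⟩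
  ext x
  have hx : (x : AlgebraicClosure L) ∈ F.map (GaloisClosure L).val := by rw [htop]; exact x.2
  obtain ⟨y, hy, hyx⟩ := hx
  have : y = x := Subtype.ext hyx
  subst this
  rw [(hF y).1 hy]; rfl

section

variable {K N : Type*} [Field K] [NumberField K] [Field N] [NumberField N] [IsGalois ℚ N]

lemma card_embedding_mul_card_stabilizer (φ : K →ₐ[ℚ] N) :
    Nat.card (K →ₐ[ℚ] N) * Nat.card (stabilizer Gal(N/ℚ) φ) = Nat.card Gal(N/ℚ) := by
  rw [← Nat.card_congr (orbitProdStabilizerEquivGroup Gal(N/ℚ) φ), Nat.card_prod]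
  congr 1
  refine Nat.card_congr (Equiv.Set.univ _).symm |>.trans (Nat.card_congr (Equiv.setCongr ?_))
  ext ψ
  simpa [mem_orbit_iff] using exists_smul_embedding_eq φ ψ

lemma card_embedding (φ : K →ₐ[ℚ] N) : Nat.card (K →ₐ[ℚ] N) = Module.finrank ℚ K := by
  have h1 := card_embedding_mul_card_stabilizer φ
  let := φ.toRingHom.toAlgebra
  have hst : IsScalarTower ℚ K N := IsScalarTower.of_algebraMap_eq' (Subsingleton.elim _ _)
  have hH : IsGaloisGroup (fixingSubgroup Gal(N/ℚ) (Set.range (algebraMap K N))) K N :=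
    IsGaloisGroup.of_isScalarTower _ ℚ N K
  have h2 : stabilizer Gal(N/ℚ) φ = fixingSubgroup Gal(N/ℚ) (Set.range (algebraMap K N)) := by
    ext σ
    rw [mem_fixingSubgroup_iff]
    constructor
    · rintro h _ ⟨x, rfl⟩; exact DFunLike.congr_fun h x
    · intro h; ext x; exact h _ ⟨x, rfl⟩
  rw [h2, IsGaloisGroup.card_eq_finrank (fixingSubgroup Gal(N/ℚ) _) K N,
    IsGaloisGroup.card_eq_finrank Gal(N/ℚ) ℚ N, ← Module.finrank_mul_finrank ℚ K N] at h1
  exact Nat.eq_of_mul_eq_mul_right Module.finrank_pos h1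

end

/-- The map `g • y ↦ ρ g • z` is well defined once the stabilizer of `y` fixes `z`. Transitivity
makes it onto and equal cardinality bijective. So a set of embeddings is identified with a
combinatorial set as soon as one stabilizer is shown to have a fixed point there. -/
lemma exists_equivariant_equiv {Γ Γ' Y Z : Type*} [Group Γ] [Group Γ'] [MulAction Γ Y]
    [MulAction Γ' Z] [Finite Y] (ρ : Γ →* Γ') (hY : ∀ y y' : Y, ∃ g : Γ, g • y = y')
    (hZ : ∀ z z' : Z, ∃ g : Γ, ρ g • z = z') (hcard : Nat.card Y = Nat.card Z) (y : Y) (z : Z)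
    (h : ∀ g : Γ, g • y = y → ρ g • z = z) :
    ∃ e : Y ≃ Z, ∀ (g : Γ) (x : Y), e (g • x) = ρ g • e x := by
  choose γ hγ using hY y
  have key : ∀ g g' : Γ, g • y = g' • y → ρ g • z = ρ g' • z := fun g g' hg => by
    have := h (g'⁻¹ * g) (by rw [mul_smul, hg, inv_smul_smul])
    rw [map_mul, map_inv, mul_smul, inv_smul_eq_iff] at this
    exact this
  let f : Y → Z := fun x => ρ (γ x) • z
  have hf : ∀ (g : Γ) (x : Y), f (g • x) = ρ g • f x := fun g x => by
    simp only [f]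
    rw [← mul_smul, ← map_mul]
    apply key
    rw [hγ, mul_smul, hγ]
  have hsurj : Function.Surjective f := fun w => by
    obtain ⟨g, rfl⟩ := hZ z w
    exact ⟨g • y, key _ _ (hγ _)⟩
  have : Finite Z := Finite.of_surjective f hsurj
  have hbij : Function.Bijective f :=
    (Nat.bijective_iff_surjective_and_card f).2 ⟨hsurj, hcard⟩
  exact ⟨Equiv.ofBijective f hbij, hf⟩

/-- A faithful action of the Galois group on the four roots whose image contains the alternating
group. -/
lemma exists_rootAction {L : Type*} [Field L] [NumberField L] (hL : Module.finrank ℚ L = 4) :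
    ∃ ρ : Gal(GaloisClosure L/ℚ) →* Perm (Fin 4), Function.Injective ρ ∧
      ∃ e : (L →ₐ[ℚ] GaloisClosure L) ≃ Fin 4, ∀ σ φ, e (σ • φ) = ρ σ • e φ := by
  obtain ⟨φ⟩ := nonempty_embedding_galoisClosure L
  have hc := card_embedding φ
  rw [hL] at hc
  let e : (L →ₐ[ℚ] GaloisClosure L) ≃ Fin 4 := Finite.equivFinOfCardEq hc
  let ρ := (e.permCongrHom).toMonoidHom.comp
    (MulAction.toPermHom Gal(GaloisClosure L/ℚ) (L →ₐ[ℚ] GaloisClosure L))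
  have he : ∀ σ φ, e (σ • φ) = ρ σ • e φ := fun σ φ => by
    simp [ρ, Equiv.permCongrHom]
  refine ⟨ρ, ?_, e, he⟩
  rw [injective_iff_map_eq_one]
  intro σ hσ
  refine eq_one_of_smul_embedding_eq σ fun φ => e.injective ?_
  rw [he, hσ, one_smul]

lemma alternatingGroup_le_of_card {H : Subgroup (Perm (Fin 4))}
    (h : Nat.card H = 12 ∨ Nat.card H = 24) : alternatingGroup (Fin 4) ≤ H := by
  have h1 := H.index_mul_card
  rw [Nat.card_perm, Nat.card_fin, show Nat.factorial 4 = 24 from rfl] at h1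
  rcases h with h | h
  · rw [h] at h1
    exact (Equiv.Perm.eq_alternatingGroup_of_index_eq_two (by omega)).ge
  · rw [h] at h1
    rw [Subgroup.index_eq_one.1 (by omega : H.index = 1)]
    exact le_top

lemma IsA4OrS4Quartic.card {L : Type*} [Field L] [NumberField L] (hL : IsA4OrS4Quartic L) :
    Nat.card Gal(GaloisClosure L/ℚ) = 12 ∨ Nat.card Gal(GaloisClosure L/ℚ) = 24 := by
  rcases hL.2 with ⟨⟨e⟩⟩ | ⟨⟨e⟩⟩
  · left
    rw [Nat.card_congr e.toEquiv, nat_card_alternatingGroup]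
    simp [Nat.factorial]
  · right
    rw [Nat.card_congr e.toEquiv, Nat.card_perm, Nat.card_fin]
    rfl

/-- A quartic field whose Galois closure contains a cubic field is an `A₄`- or `S₄`-quartic
field. -/
lemma isA4OrS4Quartic_of_cubic {L k : Type*} [Field L] [NumberField L] [Field k] [NumberField k]
    (hL : Module.finrank ℚ L = 4) (hk : IsCubicResolvent k L) : IsA4OrS4Quartic L := by
  refine ⟨hL, ?_⟩
  obtain ⟨ρ, hρ, e, -⟩ := exists_rootAction hL
  obtain ⟨φ⟩ := nonempty_embedding_galoisClosure L
  obtain ⟨hk3, ⟨ψ⟩⟩ := hk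
  have h4 : 4 ∣ Nat.card Gal(GaloisClosure L/ℚ) := by
    rw [← card_embedding_mul_card_stabilizer φ, card_embedding φ, hL]; exact dvd_mul_right _ _
  have h3 : 3 ∣ Nat.card Gal(GaloisClosure L/ℚ) := by
    rw [← card_embedding_mul_card_stabilizer ψ, card_embedding ψ, hk3]; exact dvd_mul_right _ _
  have hcard : Nat.card ρ.range = Nat.card Gal(GaloisClosure L/ℚ) :=
    (Nat.card_congr (MonoidHom.ofInjective hρ).toEquiv).symm
  have h24 := ρ.range.card_subgroup_dvd_card
  rw [Nat.card_perm, Nat.card_fin, show Nat.factorial 4 = 24 from rfl, hcard] at h24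
  -- The order is divisible by the degrees 4 and 3 and, through the action on the roots, divides 24.
  have h12 : 12 ∣ Nat.card Gal(GaloisClosure L/ℚ) :=
    Nat.Coprime.mul_dvd_of_dvd_of_dvd (by norm_num : Nat.Coprime 4 3) h4 h3
  obtain ⟨m, hm⟩ := h12
  rw [hm] at h24
  have hm2 : m ∣ 2 := Nat.dvd_of_mul_dvd_mul_left (by norm_num : 0 < 12) (by simpa using h24)
  have hm' : m = 1 ∨ m = 2 := (Nat.dvd_prime Nat.prime_two).1 hm2
  have hidx := ρ.range.index_mul_card
  rw [Nat.card_perm, Nat.card_fin, show Nat.factorial 4 = 24 from rfl, hcard, hm] at hidx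
  rcases hm' with rfl | rfl
  · left
    exact ⟨(MonoidHom.ofInjective hρ).trans (MulEquiv.subgroupCongr
      (Equiv.Perm.eq_alternatingGroup_of_index_eq_two (by omega)))⟩
  · right
    exact ⟨(MonoidHom.ofInjective hρ).trans ((MulEquiv.subgroupCongr
      (Subgroup.index_eq_one.1 (by omega))).trans Subgroup.topEquiv)⟩

variable {N : Type*} [Field N] [NumberField N] [IsGalois ℚ N]

omit [IsGalois ℚ N] in
lemma exists_smul_eq_of_alternating {Z : Type*} [MulAction (Perm (Fin 4)) Z]
    {ρ : Gal(N/ℚ) →* Perm (Fin 4)} (hρA : alternatingGroup (Fin 4) ≤ ρ.range)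
    (hZ : ∀ z z' : Z, ∃ g : Perm (Fin 4), Perm.sign g = 1 ∧ g • z = z') (z z' : Z) :
    ∃ g : Gal(N/ℚ), ρ g • z = z' := by
  obtain ⟨g, hg, h⟩ := hZ z z'
  obtain ⟨σ, rfl⟩ := hρA (Perm.mem_alternatingGroup.2 hg)
  exact ⟨σ, h⟩

set_option maxRecDepth 100000 in
lemma pairing_transitive : ∀ z z' : Pairing, ∃ g : Perm (Fin 4), Perm.sign g = 1 ∧ g • z = z' := by
  decide +kernel

set_option maxRecDepth 100000 in
lemma twoSubset_transitive :
    ∀ z z' : TwoSubset, ∃ g : Perm (Fin 4), Perm.sign g = 1 ∧ g • z = z' := by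
  decide +kernel

lemma card_pairing : Nat.card Pairing = 3 := by
  rw [Nat.card_eq_fintype_card]; decide +kernel

lemma card_twoSubset : Nat.card TwoSubset = 6 := by
  rw [Nat.card_eq_fintype_card]; decide +kernel

/-- The embeddings of the cubic resolvent correspond to the partitions of the four roots into two
pairs. -/
lemma exists_equiv_pairing {k : Type*} [Field k] [NumberField k] (hk : Module.finrank ℚ k = 3)
    (ρ : Gal(N/ℚ) →* Perm (Fin 4)) (hρA : alternatingGroup (Fin 4) ≤ ρ.range)
    (hcard : Nat.card Gal(N/ℚ) = 12 ∨ Nat.card Gal(N/ℚ) = 24) (φ : k →ₐ[ℚ] N) :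
    ∃ e : (k →ₐ[ℚ] N) ≃ Pairing, ∀ σ φ, e (σ • φ) = ρ σ • e φ := by
  have h3 := card_embedding φ
  rw [hk] at h3
  have hJ := card_embedding_mul_card_stabilizer φ
  rw [h3] at hJ
  have : Fact (Nat.Prime 2) := ⟨Nat.prime_two⟩
  -- The stabilizer has order 12/3 or 24/3, so it is a 2-group, and a 2-group acting on three
  -- pairings fixes one of them.
  have hp : IsPGroup 2 (stabilizer Gal(N/ℚ) φ) := by
    rcases hcard with h | h
    · exact IsPGroup.of_card (n := 2) (by omega)
    · exact IsPGroup.of_card (n := 3) (by omega)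
  let : MulAction (stabilizer Gal(N/ℚ) φ) Pairing :=
    MulAction.compHom Pairing (ρ.comp (stabilizer Gal(N/ℚ) φ).subtype)
  have hmod := hp.card_modEq_card_fixedPoints Pairing
  rw [card_pairing] at hmod
  have hne : (fixedPoints (stabilizer Gal(N/ℚ) φ) Pairing).Nonempty := by
    by_contra hn
    rw [Set.not_nonempty_iff_eq_empty] at hn
    rw [hn] at hmod
    simp [Nat.ModEq] at hmod
  obtain ⟨z, hz⟩ := hne
  exact exists_equivariant_equiv ρ (fun y y' => exists_smul_embedding_eq y y')
    (exists_smul_eq_of_alternating hρA pairing_transitive) (h3.trans card_pairing.symm) φ z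
    fun g hg => hz ⟨g, hg⟩

end GaloisSets

/-! ### The quadratic extension of trivial norm and the two-element subsets. -/

section Sextic

open MulAction Equiv

lemma finrank_quadratic {k K₆ : Type*} [Field k] [Field K₆] [Algebra k K₆] {α : k}
    (hα : ¬ IsSquare α) {θ : K₆} (hθ : θ ^ 2 = algebraMap k K₆ α)
    (htop : IntermediateField.adjoin k {θ} = ⊤) : Module.finrank k K₆ = 2 := by
  have hdeg : (Polynomial.X ^ 2 - Polynomial.C α).natDegree = 2 :=
    Polynomial.natDegree_X_pow_sub_C
  have hmon : (Polynomial.X ^ 2 - Polynomial.C α).Monic :=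
    Polynomial.monic_X_pow_sub_C α two_ne_zero
  have hirr : Irreducible (Polynomial.X ^ 2 - Polynomial.C α) := by
    refine Polynomial.irreducible_of_degree_le_three_of_not_isRoot (by rw [hdeg]; decide) ?_
    intro x hx
    apply hα
    refine ⟨x, ?_⟩
    simp only [Polynomial.IsRoot, Polynomial.eval_sub, Polynomial.eval_pow, Polynomial.eval_X,
      Polynomial.eval_C, sub_eq_zero] at hx
    rw [← hx, sq]
  have hroot : Polynomial.aeval θ (Polynomial.X ^ 2 - Polynomial.C α) = 0 := by
    simp [hθ]
  have hmin := minpoly.eq_of_irreducible_of_monic hirr hroot hmon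
  have hint : IsIntegral k θ := ⟨_, hmon, hroot⟩
  have := IntermediateField.adjoin.finrank hint
  rw [htop, IntermediateField.finrank_top', ← hmin, hdeg] at this
  exact this

set_option maxRecDepth 100000 in
-- Provides the copy of S₃, generated by a transposition fixing the given pairing and a 3-cycle that
-- it inverts, with which the normal Klein group is excluded as the stabilizer of an embedding of
-- `K₆`.
lemma exists_transposition_pairing : ∀ z : Pairing, ∃ t c : Perm (Fin 4),
    t * t = 1 ∧ t • z = z ∧ t ∉ innerPerms 4 ∧ c * c * c = 1 ∧ c ≠ 1 ∧ t * c = c * c * t := by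
  decide +kernel

set_option maxRecDepth 100000 in
lemma smul_pairing_ne : ∀ c : Perm (Fin 4), c * c * c = 1 → c ≠ 1 → ∀ z : Pairing, c • z ≠ z := by
  decide +kernel

set_option maxRecDepth 100000 in
-- Used to exclude the cyclic group of order 4 as a stabilizer: conjugating the square of the
-- 4-cycle by a 3-cycle gives a different double transposition.
lemma fourCycle_pairing : ∀ (h c : Perm (Fin 4)) (z : Pairing), h * h ≠ 1 → h * h * (h * h) = 1 →
    c * c * c = 1 → c ≠ 1 → h • z = z → h • c • z = c • c • z ∧ h • c • c • z = c • z ∧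
      ([1, h, h * h, h * h * h].contains (c⁻¹ * (h * h) * c)) = false := by
  decide +kernel

set_option maxRecDepth 100000 in
-- In these classes {0, 1} is preserved.
lemma exists_fixed_twoSubset : ∀ j : Fin 8, j = 0 ∨ j = 1 ∨ j = 2 ∨ j = 3 →
    ∃ s : TwoSubset, ∀ g, outerPerms j g → g • s = s := by
  decide +kernel

set_option maxRecDepth 100000 in
lemma three_mem_innerPerms : ∀ j : Fin 8, j = 5 ∨ j = 7 →
    ∃ c ∈ innerPerms j, c * c * c = 1 ∧ c ≠ 1 := by
  decide +kernel

lemma innerPerms_card (j : Fin 8) (hj : j = 4 ∨ j = 6) : (innerPerms j).toFinset.card = 4 := by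
  revert j; decide +kernel

/-- If `H` belongs to class `j` and has as few elements as possible, then it is a conjugate of
`innerPerms j`. -/
lemma mem_of_hasClass_of_card {H : Subgroup (Perm (Fin 4))} {j : Fin 8} {g : Perm (Fin 4)}
    (h : HasClass H j g) (hc : Nat.card H ≤ (innerPerms j).toFinset.card) (x : Perm (Fin 4)) :
    x ∈ H ↔ g⁻¹ * x * g ∈ innerPerms j := by
  classical
  set S := (innerPerms j).toFinset.image fun r => g * r * g⁻¹
  have hS : S.card = (innerPerms j).toFinset.card :=
    Finset.card_image_of_injective _ fun a b hab => by simpa using hab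
  have hsub : (S : Set (Perm (Fin 4))) ⊆ H := by
    intro y hy
    obtain ⟨r, hr, rfl⟩ := Finset.mem_image.1 (Finset.mem_coe.1 hy)
    exact h.1 r (List.mem_toFinset.1 hr)
  have heq : (S : Set (Perm (Fin 4))) = H := by
    refine Set.eq_of_subset_of_ncard_le hsub ?_ (Set.toFinite _)
    rw [Set.ncard_coe_finset, hS]
    exact hc
  constructor
  · intro hx
    have : x ∈ (S : Set (Perm (Fin 4))) := by rw [heq]; exact hx
    obtain ⟨r, hr, rfl⟩ := Finset.mem_image.1 (Finset.mem_coe.1 this)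
    simpa [mul_assoc] using hr
  · intro hx
    have := h.1 _ hx
    simpa [mul_assoc] using this

lemma norm_eq_prod_three {k N : Type*} [Field k] [NumberField k] [Field N] [NumberField N]
    [IsGalois ℚ N] (hk : Module.finrank ℚ k = 3) (φ : Fin 3 → (k →ₐ[ℚ] N))
    (hφ : Function.Injective φ) (α : k) :
    algebraMap ℚ N (Algebra.norm ℚ α) = φ 0 α * φ 1 α * φ 2 α := by
  let ι := IsScalarTower.toAlgHom ℚ N (AlgebraicClosure N)
  apply (algebraMap N (AlgebraicClosure N)).injective
  rw [← IsScalarTower.algebraMap_apply, Algebra.norm_eq_prod_embeddings ℚ (AlgebraicClosure N)]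
  have hinj : Function.Injective fun i => ι.comp (φ i) := fun i j h => hφ <| by
    ext x
    exact (algebraMap N (AlgebraicClosure N)).injective (DFunLike.congr_fun h x)
  have hbij : Function.Bijective fun i => ι.comp (φ i) := by
    rw [Fintype.bijective_iff_injective_and_card]
    refine ⟨hinj, ?_⟩
    rw [AlgHom.card, hk, Fintype.card_fin]
  rw [← (Equiv.ofBijective _ hbij).prod_comp, Fin.prod_univ_three, map_mul, map_mul]
  rfl

lemma algHom_ext_quadratic {k K₆ N : Type*} [Field k] [Field K₆] [CharZero K₆] [Algebra k K₆] [Field N]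
    [CharZero N] {θ : K₆} (htop : IntermediateField.adjoin k {θ} = ⊤)
    {φ ψ : K₆ →ₐ[ℚ] N} (h : ∀ x : k, φ (algebraMap k K₆ x) = ψ (algebraMap k K₆ x))
    (hθ : φ θ = ψ θ) : φ = ψ := by
  let := ((φ : K₆ →+* N).comp (algebraMap k K₆)).toAlgebra
  let φ' : K₆ →ₐ[k] N := { (φ : K₆ →+* N) with commutes' := fun _ => rfl }
  let ψ' : K₆ →ₐ[k] N := { (ψ : K₆ →+* N) with commutes' := fun x => (h x).symm }
  have : φ' = ψ' := by
    have hext : ∀ x ∈ IntermediateField.adjoin k {θ}, φ' x = ψ' x := by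
      intro x hx
      refine IntermediateField.adjoin_induction k (p := fun x _ => φ' x = ψ' x) ?_ ?_ ?_ ?_ ?_ hx
      · rintro y (rfl : y = θ); exact hθ
      · intro y; exact (φ'.commutes y).trans (ψ'.commutes y).symm
      · intro y z _ _ hy hz; rw [map_add, map_add, hy, hz]
      · intro y _ hy; rw [map_inv₀, map_inv₀, hy]
      · intro y z _ _ hy hz; rw [map_mul, map_mul, hy, hz]
    ext x
    exact hext x (by rw [htop]; trivial)
  ext x
  exact DFunLike.congr_fun this x

section

variable {k K₆ : Type*} [Field k] [NumberField k]
    [Field K₆] [NumberField K₆] [Algebra k K₆] {N : Type*} [Field N] [NumberField N] [IsGalois ℚ N]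

/-- The embeddings of the quadratic extension of trivial norm of the cubic resolvent correspond to
the pairs of roots. -/
lemma exists_equiv_twoSubset (hk : Module.finrank ℚ k = 3)
    (ρ : Gal(N/ℚ) →* Perm (Fin 4)) (hρ : Function.Injective ρ)
    (hρA : alternatingGroup (Fin 4) ≤ ρ.range)
    (hcard : Nat.card Gal(N/ℚ) = 12 ∨ Nat.card Gal(N/ℚ) = 24)
    (hK : IsTrivialNormQuadratic k K₆) (φ₆ : K₆ →ₐ[ℚ] N) :
    ∃ e : (K₆ →ₐ[ℚ] N) ≃ TwoSubset, ∀ σ φ, e (σ • φ) = ρ σ • e φ := by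
  obtain ⟨α, hα0, hα, ⟨r, hr⟩, θ, hθ, htop⟩ := hK
  have hst : IsScalarTower ℚ k K₆ := IsScalarTower.of_algebraMap_eq' (Subsingleton.elim _ _)
  have hfin : Module.finrank ℚ K₆ = 6 := by
    have hq := finrank_quadratic hα hθ htop
    have : FiniteDimensional k K₆ := Module.finite_of_finrank_pos (by omega)
    rw [← Module.finrank_mul_finrank ℚ k K₆, hk, hq]
  have h6 := card_embedding φ₆
  rw [hfin] at h6
  have hstab := card_embedding_mul_card_stabilizer φ₆
  rw [h6] at hstab
  set φ : k →ₐ[ℚ] N := φ₆.comp (IsScalarTower.toAlgHom ℚ k K₆) with hφdef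
  obtain ⟨e₃, he₃⟩ := exists_equiv_pairing hk ρ hρA hcard φ
  set S := stabilizer Gal(N/ℚ) φ₆ with hS
  set H := S.map ρ with hH
  have hHcard : Nat.card H = Nat.card S := Nat.card_congr
    (S.equivMapOfInjective ρ hρ).toEquiv.symm
  have hmemS : ∀ σ : Gal(N/ℚ), σ ∈ S ↔ σ • φ = φ ∧ σ (φ₆ θ) = φ₆ θ := by
    intro σ
    constructor
    · intro h
      have h : σ • φ₆ = φ₆ := h
      refine ⟨?_, DFunLike.congr_fun h θ⟩
      ext x
      exact DFunLike.congr_fun h (algebraMap k K₆ x)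
    · rintro ⟨h1, h2⟩
      exact algHom_ext_quadratic htop (fun x => DFunLike.congr_fun h1 x) h2
  have hmemH : ∀ σ : Gal(N/ℚ), ρ σ ∈ H ↔ σ ∈ S := fun σ =>
    Subgroup.mem_map_iff_mem hρ
  have hfix3 : ∀ σ (ψ : k →ₐ[ℚ] N), ρ σ • e₃ ψ = e₃ ψ ↔ σ • ψ = ψ := fun σ ψ => by
    rw [← he₃, e₃.apply_eq_iff_eq]
  -- The stabilizer has order 2 or 4. The only subgroups of S₄ of such order that fix no two-element
  -- subset are the normal Klein group and the cyclic groups of order 4; the square norm rules them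
  -- out.
  suffices hs : ∃ s : TwoSubset, ∀ g ∈ H, g • s = s by
    obtain ⟨s, hs⟩ := hs
    exact exists_equivariant_equiv ρ (fun y y' => exists_smul_embedding_eq y y')
      (exists_smul_eq_of_alternating hρA twoSubset_transitive) (h6.trans card_twoSubset.symm) φ₆ s
      fun g hg => hs _ ((hmemH g).2 hg)
  obtain ⟨j, g, hj⟩ := exists_hasClass H
  have hfixed : j = 0 ∨ j = 1 ∨ j = 2 ∨ j = 3 → ∃ s : TwoSubset, ∀ g ∈ H, g • s = s := by
    intro h
    obtain ⟨s, hs⟩ := exists_fixed_twoSubset j h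
    refine ⟨g • s, fun x hx => ?_⟩
    have := hs _ (hj.2 x hx)
    rw [mul_smul, mul_smul, inv_smul_eq_iff] at this
    exact this
  have hthree : ¬ (j = 5 ∨ j = 7) := by
    intro h
    obtain ⟨c, hc, hc3, hc1⟩ := three_mem_innerPerms j h
    have hcH := hj.1 c hc
    have hord : orderOf (⟨_, hcH⟩ : H) = 3 := by
      have : Fact (Nat.Prime 3) := ⟨Nat.prime_three⟩
      rw [Subgroup.orderOf_mk]
      refine orderOf_eq_prime ?_ ?_
      · rw [← MulAut.conj_apply, ← map_pow, pow_succ, sq, hc3, map_one]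
      · intro h
        rw [← MulAut.conj_apply] at h
        exact hc1 ((MulAut.conj g).map_eq_one_iff.1 h)
    have := orderOf_dvd_natCard (⟨_, hcH⟩ : H)
    rw [hord, hHcard] at this
    omega
  by_cases hj4 : ¬ (j = 4 ∨ j = 6)
  · apply hfixed
    clear hj hfixed
    revert hj4 hthree
    clear_value H
    revert j
    decide
  push Not at hj4
  exfalso
  have hic := innerPerms_card j hj4
  have hle : 4 ≤ Nat.card H := by
    classical
    refine hic.symm.le.trans ((Finset.card_image_of_injective (innerPerms j).toFinset
      (f := fun r => g * r * g⁻¹) fun a b hab => by simpa using hab).symm.le.trans ?_)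
    rw [← Set.ncard_coe_finset]
    refine Set.ncard_le_ncard (t := (H : Set (Perm (Fin 4)))) ?_ (Set.toFinite _)
    intro y hy
    obtain ⟨r, hr, rfl⟩ := Finset.mem_image.1 (Finset.mem_coe.1 hy)
    exact hj.1 r (List.mem_toFinset.1 hr)
  -- Order at least 4 and index 6 leave only the full group S₄, with a stabilizer of order exactly
  -- 4.
  have hG : Nat.card Gal(N/ℚ) = 24 := by omega
  have hH4 : Nat.card H ≤ (innerPerms j).toFinset.card := by omega
  have hsurj : Function.Surjective ρ := by
    refine ((Nat.bijective_iff_injective_and_card ρ).2 ⟨hρ, ?_⟩).2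
    rw [hG, Nat.card_perm, Nat.card_fin]; rfl
  have hmem := mem_of_hasClass_of_card hj hH4
  have hθ0 : φ₆ θ ≠ 0 := by
    intro h
    apply hα0
    apply (algebraMap k K₆).injective
    rw [← hθ, (map_eq_zero φ₆).1 h]; simp
  have hsq : ∀ σ : Gal(N/ℚ), σ (φ₆ θ) ^ 2 = (σ • φ) α := fun σ => by
    rw [← map_pow, ← map_pow, hθ]; rfl
  -- the product of the three square roots is rational
  have hP : ∀ c : Gal(N/ℚ), ρ c * ρ c * ρ c = 1 → ρ c ≠ 1 → ∀ σ : Gal(N/ℚ),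
      σ (φ₆ θ * c (φ₆ θ) * c (c (φ₆ θ))) = φ₆ θ * c (φ₆ θ) * c (c (φ₆ θ)) := by
    intro c hc3 hc1 σ
    have hne := smul_pairing_ne (ρ c) hc3 hc1
    have h01 : c • φ ≠ φ := fun h => hne _ ((hfix3 c φ).2 h)
    have h12 : c • c • φ ≠ c • φ := fun h => hne _ ((hfix3 c (c • φ)).2 h)
    have hc : c * c * c = 1 := hρ (by rw [map_mul, map_mul, hc3, map_one])
    have h20 : c • c • φ ≠ φ := fun h => h01 <| by
      have : c • c • c • φ = φ := by rw [smul_smul, smul_smul, hc, one_smul]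
      rw [h] at this
      exact this
    have hn := norm_eq_prod_three hk ![φ, c • φ, c • c • φ] (by
      intro a b hab
      fin_cases a <;> fin_cases b
      · rfl
      · exact absurd hab.symm h01
      · exact absurd hab.symm h20
      · exact absurd hab h01
      · rfl
      · exact absurd hab.symm h12
      · exact absurd hab h20
      · exact absurd hab h12
      · rfl) α
    have hsq' : (φ₆ θ * c (φ₆ θ) * c (c (φ₆ θ))) ^ 2 = (algebraMap ℚ N r) ^ 2 := by
      rw [← map_pow, sq r, ← hr, hn, mul_pow, mul_pow, hsq c]
      have h1 := hsq 1
      have h2 := hsq (c * c)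
      rw [one_smul] at h1
      rw [mul_smul] at h2
      rw [show φ₆ θ ^ 2 = φ α from h1, show c (c (φ₆ θ)) ^ 2 = (c • c • φ) α from h2]
      rfl
    rcases sq_eq_sq_iff_eq_or_eq_neg.1 hsq' with h | h
    · rw [h, AlgEquiv.commutes]
    · rw [h, map_neg, AlgEquiv.commutes]
  rcases hj4 with rfl | rfl
  -- The normal Klein group: t fixes the embedding of `k` but not that of `K₆`, so tθ = -θ. As t
  -- inverts c, it sends cθ to -c²θ and c²θ to -cθ. Hence t changes the sign of the nonzero product
  -- θ·cθ·c²θ, which is rational because its square is the norm of α, a square.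
  · obtain ⟨t, c, ht2, htz, htn, hc3, hc1, htc⟩ := exists_transposition_pairing (e₃ φ)
    obtain ⟨t, rfl⟩ := hsurj t
    obtain ⟨c, rfl⟩ := hsurj c
    have htS : t ∉ S := by
      rw [← hmemH, hmem]
      intro h
      have hconj : ∀ g y : Perm (Fin 4), g⁻¹ * y * g ∈ innerPerms 4 → y ∈ innerPerms 4 := by
        decide +kernel
      exact htn (hconj _ _ h)
    have htφ : t • φ = φ := (hfix3 t φ).1 htz
    have htθ : t (φ₆ θ) = - φ₆ θ := by
      have h1 := hsq t
      have h2 := hsq 1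
      rw [htφ] at h1
      rw [one_smul, ← h1] at h2
      rcases sq_eq_sq_iff_eq_or_eq_neg.1 h2.symm with h | h
      · exact absurd ((hmemS t).2 ⟨htφ, h⟩) htS
      · exact h
    have htc' : t * c = c * c * t := hρ (by rw [map_mul, map_mul, map_mul, htc])
    have hc : c * c * c = 1 := hρ (by rw [map_mul, map_mul, hc3, map_one])
    have e1 : t (c (φ₆ θ)) = - c (c (φ₆ θ)) := by
      have : (t * c) (φ₆ θ) = (c * c * t) (φ₆ θ) := by rw [htc']
      calc t (c (φ₆ θ)) = (c * c * t) (φ₆ θ) := this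
        _ = c (c (t (φ₆ θ))) := rfl
        _ = _ := by rw [htθ, map_neg, map_neg]
    have e2 : t (c (c (φ₆ θ))) = - c (φ₆ θ) := by
      have h1 : t * (c * c) = c * t := by
        calc t * (c * c) = t * c * c := (mul_assoc _ _ _).symm
          _ = c * c * (t * c) := by rw [htc']; simp only [mul_assoc]; rw [htc']; simp only [mul_assoc]
          _ = (c * c * c) * (c * t) := by rw [htc']; simp only [mul_assoc]
          _ = c * t := by rw [hc, one_mul]
      have : (t * (c * c)) (φ₆ θ) = (c * t) (φ₆ θ) := by rw [h1]
      calc t (c (c (φ₆ θ))) = (c * t) (φ₆ θ) := this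
        _ = c (t (φ₆ θ)) := rfl
        _ = _ := by rw [htθ, map_neg]
    have h := hP c hc3 hc1 t
    rw [map_mul, map_mul, htθ, e1, e2] at h
    have hne : φ₆ θ * c (φ₆ θ) * c (c (φ₆ θ)) ≠ 0 := by simp [hθ0]
    apply hne
    have h2 : (2 : N) * (φ₆ θ * c (φ₆ θ) * c (c (φ₆ θ))) = 0 := by linear_combination -h
    simpa using h2
  -- The cyclic group: its generator h fixes θ and interchanges the conjugates cα and c²α, so h(cθ)
  -- = ±c²θ. Invariance of the product forces the same sign in h(c²θ) = ±cθ, so h² fixes cθ. Then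
  -- c⁻¹h²c stabilizes the embedding of `K₆` without being a power of h.
  · set h₀ : Perm (Fin 4) := g * (swap 0 1 * swap 1 2 * swap 2 3) * g⁻¹ with hh₀
    have hconj : ∀ n : ℕ, h₀ ^ n = g * (swap 0 1 * swap 1 2 * swap 2 3) ^ n * g⁻¹ := fun n => by
      rw [hh₀, ← MulAut.conj_apply, ← map_pow, MulAut.conj_apply]
    have hh : h₀ ∈ H := hj.1 _ (by decide +kernel)
    have hh2 : h₀ * h₀ ≠ 1 := by
      rw [hh₀]; clear hh hh₀ hmem hj hfixed hconj; revert g; decide +kernel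
    have hh4 : h₀ * h₀ * (h₀ * h₀) = 1 := by
      rw [hh₀]; clear hh hh₀ hmem hj hfixed hconj hh2; revert g; decide +kernel
    have hHh : ∀ x ∈ H, x ∈ [1, h₀, h₀ * h₀, h₀ * h₀ * h₀] := by
      intro x hx
      have := (hmem x).1 hx
      rw [hh₀]; clear hx hh hh₀ hmem hj hfixed hconj hh2 hh4; revert g x; decide +kernel
    obtain ⟨h₁, hh₁⟩ := hsurj h₀
    rw [← hh₁, hmemH, hmemS] at hh
    obtain ⟨c, hc3, hc1⟩ : ∃ c : Perm (Fin 4), c * c * c = 1 ∧ c ≠ 1 :=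
      ⟨swap 0 1 * swap 1 2, by decide +kernel⟩
    obtain ⟨c, rfl⟩ := hsurj c
    obtain ⟨a1, a2, a3⟩ := fourCycle_pairing h₀ (ρ c) (e₃ φ) hh2 hh4 hc3 hc1 (by
      rw [← hh₁, hfix3]; exact hh.1)
    rw [← hh₁, ← he₃, ← he₃, ← he₃, e₃.apply_eq_iff_eq] at a1
    rw [← hh₁, ← he₃, ← he₃, ← he₃, e₃.apply_eq_iff_eq] at a2
    have hP' := hP c hc3 hc1 h₁
    have b1 : h₁ (c (φ₆ θ)) ^ 2 = c (c (φ₆ θ)) ^ 2 := by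
      have h1 := hsq (h₁ * c)
      have h2 := hsq (c * c)
      rw [mul_smul] at h1 h2
      rw [a1, ← h2] at h1
      exact h1
    have hmul : h₁ (c (φ₆ θ)) * h₁ (c (c (φ₆ θ))) = c (φ₆ θ) * c (c (φ₆ θ)) := by
      rw [map_mul, map_mul, hh.2] at hP'
      apply mul_left_cancel₀ hθ0
      linear_combination hP'
    have hc0 : c (c (φ₆ θ)) ≠ 0 := by simp [hθ0]
    have b2 : h₁ (h₁ (c (φ₆ θ))) = c (φ₆ θ) := by
      rcases sq_eq_sq_iff_eq_or_eq_neg.1 b1 with h | h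
      · rw [h] at hmul ⊢
        apply mul_left_cancel₀ hc0
        linear_combination hmul
      · rw [h] at hmul ⊢
        rw [map_neg]
        apply mul_left_cancel₀ hc0
        linear_combination hmul
    have hfin : c⁻¹ * (h₁ * h₁) * c ∈ S := by
      rw [hmemS]
      constructor
      · rw [mul_smul, mul_smul, mul_smul, a1, a2, inv_smul_smul]
      · show c⁻¹ (h₁ (h₁ (c (φ₆ θ)))) = φ₆ θ
        rw [b2]
        exact c.symm_apply_apply _
    rw [← hmemH, map_mul, map_mul, map_mul, map_inv, hh₁] at hfin
    have := List.elem_eq_true_of_mem (hHh _ hfin)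
    exact Bool.false_ne_true (a3.symm.trans this)

end

end Sextic

/-! ### The possible triples of splitting types. -/

section SplittingRows

open MulAction Equiv Pointwise

attribute [local instance] Ideal.Quotient.field in
/-- Modulo inertia, the decomposition group is generated by a single element. -/
lemma exists_frobenius {N : Type*} [Field N] [NumberField N] [IsGalois ℚ N] {p : ℕ}
    (hp : p.Prime) (P : Ideal (𝓞 N)) [P.IsPrime] [P.LiesOver (Ideal.span {(p : ℤ)})] :
    ∃ φ ∈ stabilizer Gal(N/ℚ) P,
      (∀ d ∈ stabilizer Gal(N/ℚ) P, ∃ n : ℕ, ∃ i ∈ P.inertia Gal(N/ℚ), d = φ ^ n * i) ∧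
      ∀ i ∈ P.inertia Gal(N/ℚ), φ * i * φ⁻¹ ∈ P.inertia Gal(N/ℚ) := by
  have : Fact p.Prime := ⟨hp⟩
  set 𝔭 := Ideal.span {(p : ℤ)} with h𝔭
  have hmax : 𝔭.IsMaximal := Int.ideal_span_isMaximal_of_prime p
  have hPmax : P.IsMaximal := Ideal.IsMaximal.of_liesOver_isMaximal P 𝔭
  have h0 : P ≠ ⊥ := by
    rintro rfl
    have := Ideal.eq_bot_of_liesOver_bot (A := ℤ) (⊥ : Ideal (𝓞 N))
    have h2 := Ideal.LiesOver.over (P := (⊥ : Ideal (𝓞 N))) (p := 𝔭)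
    rw [Ideal.under_bot] at h2
    simp [h𝔭, hp.ne_zero] at h2
  have : Finite (𝓞 N ⧸ P) := Ideal.finiteQuotientOfFreeOfNeBot P h0
  let π := Ideal.Quotient.stabilizerHom P 𝔭 Gal(N/ℚ)
  have hπ : Function.Surjective π := Ideal.Quotient.stabilizerHom_surjective Gal(N/ℚ) 𝔭 P
  have hker : ∀ x, π x = 1 → x.1 ∈ P.inertia Gal(N/ℚ) := by
    intro x hx
    have : x ∈ π.ker := hx
    rw [Ideal.Quotient.ker_stabilizerHom] at this
    exact this
  -- The automorphism group of the finite residue field extension is cyclic. Any generator serves;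
  -- it need not be the Frobenius itself.
  obtain ⟨γ, hγ⟩ : ∃ γ : (𝓞 N ⧸ P) ≃ₐ[ℤ ⧸ 𝔭] (𝓞 N ⧸ P), ∀ x, x ∈ Subgroup.zpowers γ :=
    IsCyclic.exists_generator
  obtain ⟨φ, hφ⟩ := hπ γ
  refine ⟨φ.1, φ.2, ?_, ?_⟩
  · intro d hd
    have := hγ (π ⟨d, hd⟩)
    rw [← mem_powers_iff_mem_zpowers] at this
    obtain ⟨n, hn⟩ := this
    have h1 : π (φ ^ n) = π ⟨d, hd⟩ := by rw [map_pow, hφ]; exact hn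
    have h2 := hker ((φ ^ n)⁻¹ * ⟨d, hd⟩) (by rw [map_mul, map_inv, h1, inv_mul_cancel])
    rw [Subgroup.coe_mul, Subgroup.coe_inv, Subgroup.coe_pow] at h2
    exact ⟨n, _, h2, (mul_inv_cancel_left _ _).symm⟩
  · intro i hi
    have h1 : (φ.1 * i * φ.1⁻¹) ∈ P.inertia Gal(N/ℚ) := by
      intro x
      have h2 := Ideal.smul_mem_pointwise_smul φ.1 _ P (hi (φ.1⁻¹ • x))
      rw [φ.2] at h2
      rw [smul_sub, smul_inv_smul, ← mul_smul, ← mul_smul] at h2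
      exact h2
    exact h1

lemma rows_pos : ∀ j, ∀ row ∈ rows j, (∀ x ∈ row.1, 0 < x.1 * x.2) ∧
    (∀ x ∈ row.2.1, 0 < x.1 * x.2) ∧ ∀ x ∈ row.2.2, 0 < x.1 * x.2 := by
  decide +kernel

/-- The splitting types of `p` in an `A₄`- or `S₄`-quartic field, in its cubic resolvent and in a
quadratic extension of trivial norm of the latter form one of the triples in `rows`. -/
theorem exists_splittingType_row {L N : Type*} [Field L] [NumberField L] [Field N] [NumberField N]
    [IsGalois ℚ N] (hcard : Nat.card Gal(N/ℚ) = 12 ∨ Nat.card Gal(N/ℚ) = 24)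
    (ρ : Gal(N/ℚ) →* Perm (Fin 4)) (hρ : Function.Injective ρ) [Nonempty (L →ₐ[ℚ] N)]
    (e : (L →ₐ[ℚ] N) ≃ Fin 4) (he : ∀ σ φ, e (σ • φ) = ρ σ • e φ)
    {p : ℕ} (hp : p.Prime) (P : Ideal (𝓞 N)) [P.IsPrime]
    [P.LiesOver (Ideal.span {(p : ℤ)})] :
    ∃ j g, HasClass ((P.inertia Gal(N/ℚ)).map ρ) j g ∧ ∃ row ∈ rows j,
      splittingType p L = row.1 ∧
      (∀ (k : Type v) [Field k] [NumberField k], Module.finrank ℚ k = 3 → Nonempty (k →ₐ[ℚ] N) →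
        splittingType p k = row.2.1) ∧
      ∀ (k : Type v) (K₆ : Type w) [Field k] [NumberField k] [Field K₆] [NumberField K₆]
        [Algebra k K₆], Module.finrank ℚ k = 3 → IsTrivialNormQuadratic k K₆ →
        Nonempty (K₆ →ₐ[ℚ] N) → splittingType p K₆ = row.2.2 := by
  have hA : alternatingGroup (Fin 4) ≤ ρ.range := by
    apply alternatingGroup_le_of_card
    rwa [← Nat.card_congr (MonoidHom.ofInjective hρ).toEquiv]
  set D := stabilizer Gal(N/ℚ) P with hD
  set I := P.inertia Gal(N/ℚ) with hI
  obtain ⟨φ, hφ, hgen, hnorm⟩ := exists_frobenius hp P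
  obtain ⟨j, g, hj, row, hrow, h1, h2, h3⟩ := exists_row (D.map ρ) (I.map ρ) (ρ φ) ⟨φ, hφ, rfl⟩
    (Subgroup.map_mono (Ideal.inertia_le_stabilizer P))
    (by
      rintro _ ⟨d, hd, rfl⟩
      obtain ⟨n, i, hi, rfl⟩ := hgen d hd
      exact ⟨n, ρ i, ⟨i, hi, rfl⟩, by rw [map_mul, map_pow]⟩)
    (by
      rintro _ ⟨i, hi, rfl⟩
      exact ⟨_, hnorm i hi, by rw [map_mul, map_mul, map_inv]⟩)
  obtain ⟨p1, p2, p3⟩ := rows_pos j row hrow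
  refine ⟨j, g, hj, row, hrow, ?_, ?_, ?_⟩
  · refine weighted_injective (splittingType_pos hp) p1 ?_
    rw [weighted_splittingType hp P, ← h1, orbitType_map ρ e he]
  · rintro k _ _ hk3 ⟨ψ⟩
    have : Nonempty (k →ₐ[ℚ] N) := ⟨ψ⟩
    obtain ⟨e', he'⟩ := exists_equiv_pairing hk3 ρ hA hcard ψ
    refine weighted_injective (splittingType_pos hp) p2 ?_
    rw [weighted_splittingType hp P, ← h2, orbitType_map ρ e' he']
  · rintro k K₆ _ _ _ _ _ hk3 hK ⟨ψ⟩
    have : Nonempty (K₆ →ₐ[ℚ] N) := ⟨ψ⟩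
    obtain ⟨e', he'⟩ := exists_equiv_twoSubset hk3 ρ hρ hA hcard hK ψ
    refine weighted_injective (splittingType_pos hp) p3 ?_
    rw [weighted_splittingType hp P, ← h3, orbitType_map ρ e' he']

lemma exists_prime_liesOver (N : Type*) [Field N] [NumberField N] {p : ℕ} (hp : p.Prime) :
    ∃ P : Ideal (𝓞 N), P.IsPrime ∧ P.LiesOver (Ideal.span {(p : ℤ)}) := by
  have := isPrime_span_natCast hp
  obtain ⟨⟨P, hP, h⟩⟩ := (Ideal.span {(p : ℤ)}).nonempty_primesOver (S := 𝓞 N)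
  exact ⟨P, hP, h⟩

theorem exists_row_of_isAssociatedPair {L : Type u} {k : Type v} {K₆ : Type w} [Field L]
    [NumberField L] [Field k] [NumberField k] [Field K₆] [NumberField K₆] [Algebra k K₆]
    (hL : IsA4OrS4Quartic L) (h : IsAssociatedPair L k K₆) {p : ℕ} (hp : p.Prime) :
    ∃ j, (splittingType p L, splittingType p k, splittingType p K₆) ∈ rows j := by
  obtain ⟨ρ, hρ, e, he⟩ := exists_rootAction hL.1
  have := nonempty_embedding_galoisClosure L
  obtain ⟨P, _, _⟩ := exists_prime_liesOver (GaloisClosure L) hp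
  obtain ⟨j, g, -, row, hrow, h1, h2, h3⟩ :=
    exists_splittingType_row hL.card ρ hρ e he hp P
  refine ⟨j, ?_⟩
  rw [h1, h2 k h.1.1 h.1.2, h3 k K₆ h.1.1 h.2.1 h.2.2]
  exact hrow

set_option maxRecDepth 100000 in
-- This and the next two statements are comparisons of the nineteen rows with one another.
lemma rows_determine_sextic : ∀ j j' : Fin 8, ∀ r ∈ rows j, ∀ r' ∈ rows j',
    r.2.1 = r'.2.1 → r.1 = r'.1 → r.2.2 = r'.2.2 := by
  decide +kernel

set_option maxRecDepth 100000 in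
lemma rows_determine_quartic : ∀ j j' : Fin 8, ∀ r ∈ rows j, ∀ r' ∈ rows j',
    r.2.1 = r'.2.1 → r.2.2 = r'.2.2 → r.1 = r'.1 := by
  decide +kernel

set_option maxRecDepth 100000 in
lemma rows_determine_cubic : ∀ j j' : Fin 8, ∀ r ∈ rows j, ∀ r' ∈ rows j',
    r.1 = r'.1 → r.2.2 = r'.2.2 → r.2.1 = r'.2.1 := by
  decide +kernel

/-- Two of the three splitting types determine the third. -/
theorem splittingType_determined {L L' : Type u} {k k' : Type v} {K₆ K₆' : Type w}
    [Field L] [NumberField L] [Field k] [NumberField k]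
    [Field K₆] [NumberField K₆] [Algebra k K₆]
    [Field L'] [NumberField L'] [Field k'] [NumberField k']
    [Field K₆'] [NumberField K₆'] [Algebra k' K₆'] {p p' : ℕ}
    (hL : IsA4OrS4Quartic L) (h : IsAssociatedPair L k K₆)
    (hL' : IsA4OrS4Quartic L') (h' : IsAssociatedPair L' k' K₆') (hp : p.Prime) (hp' : p'.Prime) :
    (splittingType p k = splittingType p' k' → splittingType p L = splittingType p' L' →
      splittingType p K₆ = splittingType p' K₆') ∧
    (splittingType p k = splittingType p' k' → splittingType p K₆ = splittingType p' K₆' →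
      splittingType p L = splittingType p' L') ∧
    (splittingType p L = splittingType p' L' → splittingType p K₆ = splittingType p' K₆' →
      splittingType p k = splittingType p' k') := by
  obtain ⟨j, hj⟩ := exists_row_of_isAssociatedPair hL h hp
  obtain ⟨j', hj'⟩ := exists_row_of_isAssociatedPair hL' h' hp'
  exact ⟨rows_determine_sextic j j' _ hj _ hj', rows_determine_quartic j j' _ hj _ hj',
    rows_determine_cubic j j' _ hj _ hj'⟩

end SplittingRows

/-! ### Inertia at odd primes contains no Klein four-group. -/

section OddInertia

open MulAction Equiv Pointwise

variable {N : Type*} [Field N] [NumberField N] {P : Ideal (𝓞 N)}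

lemma smul_mem_of_mem_inertia {σ : Gal(N/ℚ)} (hσ : σ ∈ P.inertia Gal(N/ℚ)) (n : ℕ) {x : 𝓞 N}
    (hx : x ∈ P ^ n) : σ • x ∈ P ^ n := by
  have h : σ • P = P := Ideal.inertia_le_stabilizer P hσ
  have h2 : σ • (P ^ n) = P ^ n := by
    have : ∀ J : Ideal (𝓞 N), σ • J = J.map (MulSemiringAction.toRingHom Gal(N/ℚ) (𝓞 N) σ) :=
      fun _ => rfl
    rw [this, Ideal.map_pow, ← this, h]
  rw [← h2]
  exact Ideal.smul_mem_pointwise_smul σ x _ hx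

/-- An inertia element acting trivially on `P / P²` acts trivially on all `Pⁿ / Pⁿ⁺¹`. -/
lemma smul_sub_mem_pow_succ {σ : Gal(N/ℚ)} (hσ : σ ∈ P.inertia Gal(N/ℚ))
    (h : ∀ x ∈ P, σ • x - x ∈ P ^ 2) (n : ℕ) : ∀ x ∈ P ^ n, σ • x - x ∈ P ^ (n + 1) := by
  induction n with
  | zero => intro x _; rw [zero_add, pow_one]; exact hσ x
  | succ n ih =>
    intro x hx
    rw [pow_succ] at hx
    refine Submodule.mul_induction_on hx ?_ ?_
    · intro a ha b hb
      -- σ - 1 is a twisted derivation, so triviality on Pⁿ/Pⁿ⁺¹ and on P/P² passes to products.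
      have e : σ • (a * b) - a * b = (σ • a - a) * σ • b + a * (σ • b - b) := by
        rw [smul_mul']; ring
      rw [e]
      refine Ideal.add_mem _ ?_ ?_
      · rw [pow_succ]
        refine Ideal.mul_mem_mul (ih a ha) ?_
        have := smul_mem_of_mem_inertia hσ 1 (x := b) (by rwa [pow_one])
        rwa [pow_one] at this
      · rw [show n + 1 + 1 = n + 2 by ring, pow_add]
        exact Ideal.mul_mem_mul ha (h b hb)
    · intro a b ha hb
      rw [smul_add, add_sub_add_comm]
      exact Ideal.add_mem _ ha hb

/-- The odd number pⁿ lies in Pⁿ, so 2 is invertible modulo Pⁿ. -/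
lemma mem_pow_of_two_mul_mem {p : ℕ} (hp : Odd p) [P.LiesOver (Ideal.span {(p : ℤ)})] {n : ℕ}
    {x : 𝓞 N} (hx : 2 * x ∈ P ^ n) : x ∈ P ^ n := by
  have hpP : (p : 𝓞 N) ∈ P := by
    have : (p : ℤ) ∈ P.under ℤ := by
      rw [← Ideal.LiesOver.over (P := P) (p := Ideal.span {(p : ℤ)})]
      exact Ideal.mem_span_singleton_self _
    simpa [Ideal.mem_comap] using this
  have hpn : (p : 𝓞 N) ^ n ∈ P ^ n := Ideal.pow_mem_pow hpP n
  obtain ⟨m, hm⟩ := hp.pow (n := n)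
  have hm' : (p : 𝓞 N) ^ n = 2 * m + 1 := by exact_mod_cast congrArg (Nat.cast (R := 𝓞 N)) hm
  have : x = p ^ n * x - m * (2 * x) := by rw [hm']; ring
  rw [this]
  exact Ideal.sub_mem _ (Ideal.mul_mem_right _ _ hpn) (Ideal.mul_mem_left _ _ hx)

/-- At an odd prime, an inertia element of order at most two which acts trivially on `P / P²` is
trivial. -/
lemma eq_one_of_smul_sub_mem {p : ℕ} (hp : Odd p) [P.IsPrime] [P.LiesOver (Ideal.span {(p : ℤ)})]
    {σ : Gal(N/ℚ)} (hσ : σ ∈ P.inertia Gal(N/ℚ)) (hσ2 : σ * σ = 1)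
    (h : ∀ x ∈ P, σ • x - x ∈ P ^ 2) : σ = 1 := by
  have hP : P ≠ ⊤ := Ideal.IsPrime.ne_top ‹_›
  have key : ∀ n : ℕ, ∀ x : 𝓞 N, σ • x - x ∈ P ^ n := by
    intro n
    induction n with
    | zero => intro x; simp
    | succ n ih =>
      intro x
      -- For y = σx - x one has σy = -y, since σ² = 1, while σy ≡ y modulo Pⁿ⁺¹. Hence 2y lies in
      -- Pⁿ⁺¹.
      have h1 := smul_sub_mem_pow_succ hσ h n _ (ih x)
      apply mem_pow_of_two_mul_mem hp
      rw [smul_sub, ← mul_smul, hσ2, one_smul] at h1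
      have : 2 * (σ • x - x) = -(x - σ • x - (σ • x - x)) := by ring
      rw [this]
      exact neg_mem h1
  have hfix : ∀ x : 𝓞 N, σ • x = x := fun x => by
    have : σ • x - x ∈ ⨅ n : ℕ, P ^ n := by
      rw [Ideal.mem_iInf]; exact fun n => key n x
    rw [Ideal.iInf_pow_eq_bot_of_isDomain P hP] at this
    exact sub_eq_zero.1 this
  ext x
  obtain ⟨a, b, hb, rfl⟩ := IsFractionRing.div_surjective (A := 𝓞 N) x
  have h1 : ∀ y : 𝓞 N, σ (algebraMap (𝓞 N) N y) = algebraMap (𝓞 N) N y := fun y =>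
    congrArg (algebraMap (𝓞 N) N) (hfix y)
  rw [map_div₀, h1, h1]
  rfl

/-- At an odd prime, a nontrivial involution in the inertia group acts as `-1` on `P / P²`. -/
lemma smul_add_mem_of_ne_one {p : ℕ} (hp : Odd p) [P.IsPrime]
    [P.LiesOver (Ideal.span {(p : ℤ)})]
    {σ : Gal(N/ℚ)} (hσ : σ ∈ P.inertia Gal(N/ℚ)) (hσ2 : σ * σ = 1) (h1 : σ ≠ 1) :
    ∀ x ∈ P, σ • x + x ∈ P ^ 2 := by
  by_cases hP : P = ⊥
  · intro x hx
    have := smul_mem_of_mem_inertia hσ 1 (x := x) (by rwa [pow_one])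
    rw [pow_one] at this
    subst hP
    simp_all
  -- P/P² is generated by the class of a, and σ acts on it by the scalar u with σa ≡ ua. From σ² = 1
  -- one gets u ≡ ±1 modulo P, and u ≡ 1 would make σ trivial.
  obtain ⟨a, ha, ha2⟩ : ∃ a ∈ P, a ∉ P ^ 2 := by
    have := Ideal.exists_mem_pow_notMem_pow_succ P hP (Ideal.IsPrime.ne_top ‹_›) 1
    simpa using this
  have gen : ∀ x ∈ P, ∃ d, ∃ e ∈ P ^ 2, a * d + e = x := fun x hx =>
    Ideal.exists_mul_add_mem_pow_succ (i := 1) hP a x (by simpa using ha) ha2 (by simpa using hx)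
  have hσP : σ • a ∈ P := by
    have := smul_mem_of_mem_inertia hσ 1 (x := a) (by rwa [pow_one])
    rwa [pow_one] at this
  obtain ⟨u, e, he, hu⟩ := gen _ hσP
  have act : ∀ x ∈ P, ∀ c : 𝓞 N, σ • a - c * a ∈ P ^ 2 → σ • x - c * x ∈ P ^ 2 := by
    intro x hx c hc
    obtain ⟨d, e', he', rfl⟩ := gen x hx
    have : σ • (a * d + e') - c * (a * d + e') =
        d * (σ • a - c * a) + σ • a * (σ • d - d) + (σ • e' - c * e') := by
      rw [smul_add, smul_mul']; ring
    rw [this]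
    refine Ideal.add_mem _ (Ideal.add_mem _ (Ideal.mul_mem_left _ _ hc) ?_)
      (Ideal.sub_mem _ (smul_mem_of_mem_inertia hσ 2 he') (Ideal.mul_mem_left _ _ he'))
    rw [sq]
    exact Ideal.mul_mem_mul hσP (hσ d)
  have hua : σ • a - u * a ∈ P ^ 2 := by
    have : σ • a - u * a = e := by rw [← hu]; ring
    rwa [this]
  have h2 : (u - 1) * ((u + 1) * a) ∈ P ^ 2 := by
    have h3 := act _ hσP u hua
    rw [← mul_smul, hσ2, one_smul] at h3
    have : (u - 1) * ((u + 1) * a) = -(a - u * σ • a) - u * (σ • a - u * a) := by ring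
    rw [this]
    exact Ideal.sub_mem _ (neg_mem h3) (Ideal.mul_mem_left _ _ hua)
  have hmul : ∀ c, c ∈ P → c * a ∈ P ^ 2 := fun c hc => by
    rw [sq]; exact Ideal.mul_mem_mul hc ha
  rcases Ideal.IsPrime.mul_mem_pow P h2 with h3 | h3
  · refine absurd (eq_one_of_smul_sub_mem hp hσ hσ2 fun x hx => ?_) h1
    have := act x hx 1 (by
      have : σ • a - 1 * a = (σ • a - u * a) + (u - 1) * a := by ring
      rw [this]
      exact Ideal.add_mem _ hua (hmul _ h3))
    rwa [one_mul] at this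
  · rcases Ideal.IsPrime.mul_mem_pow P h3 with h4 | h4
    · intro x hx
      have := act x hx (-1) (by
        have : σ • a - (-1) * a = (σ • a - u * a) + (u + 1) * a := by ring
        rw [this]
        exact Ideal.add_mem _ hua (hmul _ h4))
      rwa [neg_one_mul, sub_neg_eq_add] at this
    · exact absurd h4 ha2

/-- At an odd prime, the inertia group does not contain two distinct commuting involutions. -/
lemma eq_of_commuting_involutions {p : ℕ} (hp : Odd p) [P.IsPrime]
    [P.LiesOver (Ideal.span {(p : ℤ)})] {σ τ : Gal(N/ℚ)} (hσ : σ ∈ P.inertia Gal(N/ℚ))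
    (hτ : τ ∈ P.inertia Gal(N/ℚ)) (hσ2 : σ * σ = 1) (hτ2 : τ * τ = 1) (hστ : σ * τ = τ * σ)
    (hσ1 : σ ≠ 1) (hτ1 : τ ≠ 1) : σ = τ := by
  -- Both involutions act as -1 on P/P², so their product, again of square 1, acts trivially there.
  have h : σ * τ = 1 := by
    refine eq_one_of_smul_sub_mem hp (mul_mem hσ hτ) ?_ ?_
    · calc σ * τ * (σ * τ) = σ * (τ * σ) * τ := by group
        _ = σ * σ * (τ * τ) := by rw [← hστ]; group
        _ = 1 := by rw [hσ2, hτ2, one_mul]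
    · intro x hx
      have h1 := smul_mem_of_mem_inertia hσ 2 (smul_add_mem_of_ne_one hp hτ hτ2 hτ1 x hx)
      have h2 := smul_add_mem_of_ne_one hp hσ hσ2 hσ1 x hx
      rw [smul_add, ← mul_smul] at h1
      have : (σ * τ) • x - x = (σ * τ) • x + σ • x - (σ • x + x) := by ring
      rw [this]
      exact Ideal.sub_mem _ h1 h2
  calc σ = σ * (τ * τ) := by rw [hτ2, mul_one]
    _ = τ := by rw [← mul_assoc, h, one_mul]

set_option maxRecDepth 100000 in
lemma exists_commuting_involutions : ∀ j : Fin 8, j = 3 ∨ j = 4 ∨ j = 7 →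
    ∃ r ∈ innerPerms j, ∃ s ∈ innerPerms j, r * r = 1 ∧ s * s = 1 ∧ r * s = s * r ∧ r ≠ 1 ∧ s ≠ 1 ∧
      r ≠ s := by
  decide +kernel

/-- At an odd prime, three of the eight classes of inertia groups do not occur. -/
lemma not_hasClass_of_odd {p : ℕ} (hp : Odd p) [P.IsPrime]
    [P.LiesOver (Ideal.span {(p : ℤ)})] (ρ : Gal(N/ℚ) →* Perm (Fin 4)) (hρ : Function.Injective ρ)
    {j : Fin 8} {g : Perm (Fin 4)} (hj : HasClass ((P.inertia Gal(N/ℚ)).map ρ) j g) :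
    ¬ (j = 3 ∨ j = 4 ∨ j = 7) := by
  intro h
  obtain ⟨r, hr, s, hs, hr2, hs2, hrs, hr1, hs1, hne⟩ := exists_commuting_involutions j h
  obtain ⟨σ, hσ, hσr⟩ := hj.1 r hr
  obtain ⟨τ, hτ, hτs⟩ := hj.1 s hs
  rw [← MulAut.conj_apply] at hσr hτs
  have hinj := (MulAut.conj g).injective
  have : σ = τ := by
    refine eq_of_commuting_involutions hp hσ hτ ?_ ?_ ?_ ?_ ?_
    · apply hρ; rw [map_mul, hσr, ← map_mul, hr2, map_one, map_one]
    · apply hρ; rw [map_mul, hτs, ← map_mul, hs2, map_one, map_one]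
    · apply hρ; rw [map_mul, map_mul, hσr, hτs, ← map_mul, hrs, map_mul]
    · rintro rfl
      rw [map_one] at hσr
      exact hr1 (hinj (by rw [← hσr, map_one]))
    · rintro rfl
      rw [map_one] at hτs
      exact hs1 (hinj (by rw [← hτs, map_one]))
  exact hne (hinj (by rw [← hσr, ← hτs, this]))

set_option maxRecDepth 100000 in
set_option synthInstance.maxHeartbeats 400000 in
set_option synthInstance.maxSize 1000 in
lemma oddListed_of_mem_rows : ∀ j : Fin 8, ¬ (j = 3 ∨ j = 4 ∨ j = 7) →
    ∀ row ∈ rows j, OddListed row.2.1 row.1 := by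
  unfold OddListed
  decide +kernel

theorem oddListed_splittingType {L : Type u} {k : Type v} [Field L] [NumberField L] [Field k]
    [NumberField k] (hL : IsA4OrS4Quartic L) (hk : IsCubicResolvent k L) {p : ℕ} (hp : p.Prime)
    (hp3 : 3 ≤ p) : OddListed (splittingType p k) (splittingType p L) := by
  obtain ⟨ρ, hρ, e, he⟩ := exists_rootAction hL.1
  have := nonempty_embedding_galoisClosure L
  obtain ⟨P, _, _⟩ := exists_prime_liesOver (GaloisClosure L) hp
  obtain ⟨j, g, hj, row, hrow, h1, h2, -⟩ :=
    exists_splittingType_row.{v, v} hL.card ρ hρ e he hp P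
  have hodd : Odd p := hp.odd_of_ne_two (by omega)
  have := oddListed_of_mem_rows j (not_hasClass_of_odd hodd ρ hρ hj) row hrow
  rwa [h1, h2 k hk.1 hk.2]

end OddInertia

/-! ### Discriminants as squares of determinants of conjugates. -/

section Discriminants

open MulAction Equiv Matrix

variable {K N : Type*} [Field K] [NumberField K] [Field N] [NumberField N]

lemma exists_intCast_eq_of_fixed [IsGalois ℚ N] (x : 𝓞 N) (h : ∀ σ : Gal(N/ℚ), σ (x : N) = x) :
    ∃ n : ℤ, (n : 𝓞 N) = x := by
  obtain ⟨q, hq⟩ := (IsGalois.mem_range_algebraMap_iff_fixed (F := ℚ) (x : N)).2 h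
  have hint : IsIntegral ℤ (algebraMap ℚ N q) := hq ▸ x.isIntegral_coe
  rw [isIntegral_algebraMap_iff (algebraMap ℚ N).injective,
    IsIntegrallyClosed.isIntegral_iff] at hint
  obtain ⟨n, rfl⟩ := hint
  exact ⟨n, RingOfIntegers.ext (by simpa using hq)⟩

lemma exists_perm_of_embeddings {ι : Type*} (e : ι ≃ (K →ₐ[ℚ] N)) (σ : Gal(N/ℚ)) :
    ∃ τ : Perm ι, ∀ i, σ • e i = e (τ i) :=
  ⟨(e.trans (MulAction.toPerm σ)).trans e.symm, fun i => by simp⟩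

variable {ι : Type*} [Fintype ι] [DecidableEq ι]

/-- The matrix of the conjugates of a family of elements. -/
def conjugateMatrix {ι : Type*} (φ : ι → (K →ₐ[ℚ] N)) (b : ι → K) : Matrix ι ι N := .of fun i j => φ i (b j)

lemma discr_eq_det_conjugateMatrix_sq {φ : ι → (K →ₐ[ℚ] N)} (hφ : Function.Injective φ)
    (hcard : Fintype.card ι = Module.finrank ℚ K) (b : ι → K) :
    algebraMap ℚ N (Algebra.discr ℚ b) = (conjugateMatrix φ b).det ^ 2 := by
  let j := IsScalarTower.toAlgHom ℚ N (AlgebraicClosure N)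
  apply (algebraMap N (AlgebraicClosure N)).injective
  have hinj : Function.Injective fun i => j.comp (φ i) := fun i i' h => hφ <| by
    ext x
    exact (algebraMap N (AlgebraicClosure N)).injective (DFunLike.congr_fun h x)
  have hbij : Function.Bijective fun i => j.comp (φ i) := by
    rw [Fintype.bijective_iff_injective_and_card]
    exact ⟨hinj, by rw [AlgHom.card, hcard]⟩
  rw [← IsScalarTower.algebraMap_apply, Algebra.discr_eq_det_embeddingsMatrixReindex_pow_two ℚ _ b
    (Equiv.ofBijective _ hbij), map_pow, ← Matrix.det_transpose, RingHom.map_det]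
  rfl

/-- **Stickelberger's criterion** -/
theorem exists_discr_eq_sq_sub (K : Type*) [Field K] [NumberField K] :
    ∃ s r : ℤ, discr K = s ^ 2 - 4 * r := by
  classical
  obtain ⟨ψ⟩ := nonempty_embedding_galoisClosure K
  set N := GaloisClosure K
  let b := RingOfIntegers.basis K
  have hι : Fintype.card (Module.Free.ChooseBasisIndex ℤ (𝓞 K)) = Module.finrank ℚ K := by
    rw [← Module.finrank_eq_card_chooseBasisIndex, RingOfIntegers.rank]
  have hcard : Fintype.card (Module.Free.ChooseBasisIndex ℤ (𝓞 K)) =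
      Fintype.card (K →ₐ[ℚ] N) := by
    rw [hι, ← Nat.card_eq_fintype_card, card_embedding ψ]
  let e : Module.Free.ChooseBasisIndex ℤ (𝓞 K) ≃ (K →ₐ[ℚ] N) := Fintype.equivOfCardEq hcard
  let M : Matrix (Module.Free.ChooseBasisIndex ℤ (𝓞 K)) (Module.Free.ChooseBasisIndex ℤ (𝓞 K))
    (𝓞 N) := .of fun i j => RingOfIntegers.mapRingHom (e i : K →+* N) (b j)
  have hM : (algebraMap (𝓞 N) N).mapMatrix M = conjugateMatrix e (integralBasis K) := by
    ext i j
    simp [M, conjugateMatrix, b]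
  have hd : (discr K : 𝓞 N) = M.det ^ 2 := by
    apply RingOfIntegers.ext
    have h := discr_eq_det_conjugateMatrix_sq e.injective hι (integralBasis K)
    rw [← coe_discr, ← hM, ← RingHom.map_det] at h
    simpa using h
  -- Permanent and determinant differ by 2t, where t comes from the odd permutations. The permanent
  -- is a rational integer s because Galois only reorders the rows, and s² - det² = 4(t² + t·det).
  have h2 : (2 : 𝓞 N) ∣ M.permanent - M.det := by
    rw [Matrix.permanent, Matrix.det_apply, ← Finset.sum_sub_distrib]
    refine Finset.dvd_sum fun σ _ => ?_
    rcases Int.units_eq_one_or (Perm.sign σ) with h | h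
    · simp [h]
    · rw [h]
      exact ⟨∏ i, M (σ i) i, by simp; ring⟩
  obtain ⟨t, ht⟩ := h2
  obtain ⟨s, hs⟩ := exists_intCast_eq_of_fixed M.permanent fun σ => by
    obtain ⟨τ, hτ⟩ := exists_perm_of_embeddings e σ
    have h1 : σ (algebraMap (𝓞 N) N M.permanent) =
        ∑ x : Perm (Module.Free.ChooseBasisIndex ℤ (𝓞 K)), ∏ i, (σ • e (x i)) (b i : K) := by
      simp [Matrix.permanent, map_sum, map_prod, M]
    have h3 : (algebraMap (𝓞 N) N M.permanent) =
        ∑ x : Perm (Module.Free.ChooseBasisIndex ℤ (𝓞 K)), ∏ i, (e (x i)) (b i : K) := by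
      simp [Matrix.permanent, map_sum, map_prod, M]
    change σ (algebraMap (𝓞 N) N M.permanent) = algebraMap (𝓞 N) N M.permanent
    rw [h1, h3]
    simp_rw [hτ]
    exact Equiv.sum_comp (Equiv.mulLeft τ) fun x : Perm (Module.Free.ChooseBasisIndex ℤ (𝓞 K)) =>
      ∏ i, (e (x i)) (b i : K)
  have h4 : 4 * (t ^ 2 + t * M.det) = ((s ^ 2 - discr K : ℤ) : 𝓞 N) := by
    push_cast
    rw [hs, hd]
    linear_combination -(M.permanent + M.det) * ht - 2 * t * ht
  obtain ⟨r, hr⟩ := exists_intCast_eq_of_fixed (t ^ 2 + t * M.det) fun σ => by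
    have h5 := congrArg (algebraMap (𝓞 N) N) h4
    rw [map_mul, map_ofNat, map_intCast] at h5
    have h6 := congrArg σ h5
    rw [map_mul, map_ofNat, map_intCast, ← h5] at h6
    exact mul_left_cancel₀ (by norm_num) h6
  refine ⟨s, r, ?_⟩
  rw [← hr] at h4
  have : (4 : ℤ) * r = s ^ 2 - discr K := by exact_mod_cast h4
  linarith

/-- A Galois element acts on the matrix by permuting its rows. -/
lemma apply_det_conjugateMatrix (e : ι ≃ (K →ₐ[ℚ] N)) (b : ι → K) {σ : Gal(N/ℚ)} {τ : Perm ι}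
    (hτ : ∀ i, σ • e i = e (τ i)) :
    σ (conjugateMatrix e b).det = Perm.sign τ * (conjugateMatrix e b).det := by
  have h : (σ : N →+* N).mapMatrix (conjugateMatrix e b) =
      (conjugateMatrix e b).submatrix τ id := by
    ext i j
    exact DFunLike.congr_fun (hτ i) (b j)
  rw [← Matrix.det_permute, ← h, ← RingHom.map_det]
  rfl

set_option maxRecDepth 100000 in
-- The kernel of S₄ → S₃ consists of even permutations, and a transposition of points exchanges two
-- of the pairings.
lemma sign_toPerm_pairing : ∀ g : Perm (Fin 4),
    Perm.sign (MulAction.toPerm g : Perm Pairing) = Perm.sign g := by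
  decide +kernel

/-- The product of the discriminants of a quartic field and of its cubic resolvent is a square. -/
theorem isSquare_discr_mul_discr {L : Type u} {k : Type v} [Field L] [NumberField L] [Field k]
    [NumberField k] (hL : IsA4OrS4Quartic L) (hk : IsCubicResolvent k L) :
    IsSquare (discr L * discr k) := by
  obtain ⟨ρ, hρ, e, he⟩ := exists_rootAction hL.1
  have hcard := hL.card
  have hA : alternatingGroup (Fin 4) ≤ ρ.range := by
    apply alternatingGroup_le_of_card
    rwa [← Nat.card_congr (MonoidHom.ofInjective hρ).toEquiv]
  obtain ⟨hk3, ⟨ψ⟩⟩ := hk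
  obtain ⟨e', he'⟩ := exists_equiv_pairing hk3 ρ hA hcard ψ
  let b := (integralBasis L).reindex (Fintype.equivOfCardEq (by
    rw [← Module.finrank_eq_card_basis (integralBasis L), hL.1, Fintype.card_fin] :
    Fintype.card _ = Fintype.card (Fin 4)))
  let b' := (integralBasis k).reindex (Fintype.equivOfCardEq (by
    rw [← Module.finrank_eq_card_basis (integralBasis k), hk3, ← Nat.card_eq_fintype_card,
      card_pairing] : Fintype.card _ = Fintype.card Pairing))
  have hb : (discr L : ℚ) = Algebra.discr ℚ b := by
    rw [coe_discr, Module.Basis.coe_reindex, Algebra.discr_reindex]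
  have hb' : (discr k : ℚ) = Algebra.discr ℚ b' := by
    rw [coe_discr, Module.Basis.coe_reindex, Algebra.discr_reindex]
  have h1 := discr_eq_det_conjugateMatrix_sq e.symm.injective
    (by rw [hL.1, Fintype.card_fin]) b
  have h2 := discr_eq_det_conjugateMatrix_sq e'.symm.injective
    (by rw [hk3, ← Nat.card_eq_fintype_card, card_pairing]) b'
  rw [← hb] at h1
  rw [← hb'] at h2
  set δ := (conjugateMatrix e.symm b).det
  set δ' := (conjugateMatrix e'.symm b').det
  -- Square roots of the two discriminants are multiplied by the same sign under every automorphism,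
  -- so their product is rational.
  obtain ⟨q, hq⟩ := (IsGalois.mem_range_algebraMap_iff_fixed (F := ℚ) (δ * δ')).2 fun σ => by
    have s1 := apply_det_conjugateMatrix (σ := σ) e.symm b (τ := ρ σ) fun i => by
      rw [Equiv.eq_symm_apply, he, Equiv.apply_symm_apply]; rfl
    have s2 := apply_det_conjugateMatrix (σ := σ) e'.symm b' (τ := MulAction.toPerm (ρ σ))
      fun i => by
        rw [Equiv.eq_symm_apply, he', Equiv.apply_symm_apply]; rfl
    rw [sign_toPerm_pairing] at s2
    rw [map_mul, s1, s2, mul_mul_mul_comm, ← Int.cast_mul, Int.units_coe_mul_self, Int.cast_one,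
      one_mul]
  have h3 : ((discr L * discr k : ℤ) : ℚ) = q * q := by
    apply (algebraMap ℚ (GaloisClosure L)).injective
    rw [Int.cast_mul, map_mul, map_mul, h1, h2, hq]
    ring
  rw [← Rat.isSquare_intCast_iff]
  exact ⟨q, h3⟩

end Discriminants

/-! ### Reading primes from a splitting type. -/

section PrimesOver

lemma intCast_mem_iff_dvd {K : Type*} [Field K] {p : ℕ} {P : Ideal (𝓞 K)} [P.LiesOver (Ideal.span {(p : ℤ)})] {n : ℤ} :
    (n : 𝓞 K) ∈ P ↔ (p : ℤ) ∣ n := by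
  rw [← Ideal.mem_span_singleton, Ideal.LiesOver.over (P := P) (p := Ideal.span {(p : ℤ)})]
  simp [Ideal.mem_comap]

variable {K : Type*} [Field K] [NumberField K] {p : ℕ} {P : Ideal (𝓞 K)}

lemma natCast_mem_pow_ramificationIdx (hp : p.Prime) [P.IsPrime]
    [P.LiesOver (Ideal.span {(p : ℤ)})] : (p : 𝓞 K) ∈ P ^ P.ramificationIdx ℤ := by
  rw [← Ideal.ramificationIdx'_eq_ramificationIdx (Ideal.span {(p : ℤ)}) P
    (by simpa using hp.ne_zero)]
  apply Ideal.le_pow_ramificationIdx'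
  rw [Ideal.map_span, Set.image_singleton]
  exact Ideal.subset_span (by simp)

lemma ne_bot_of_liesOver_span (hp : p.Prime) [P.LiesOver (Ideal.span {(p : ℤ)})] : P ≠ ⊥ := by
  rintro rfl
  have : (p : ℤ) ∣ 0 ↔ _ := (intCast_mem_iff_dvd (P := (⊥ : Ideal (𝓞 K))) (p := p)).symm
  have h := (intCast_mem_iff_dvd (P := (⊥ : Ideal (𝓞 K))) (p := p) (n := p)).2 dvd_rfl
  simp [hp.ne_zero] at h

lemma exists_primes_of_splittingType_eq_pair (hp : p.Prime) {x y : ℕ × ℕ}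
    (h : splittingType p K = {x, y}) :
    ∃ P Q : Ideal (𝓞 K), P.IsPrime ∧ Q.IsPrime ∧ P.LiesOver (Ideal.span {(p : ℤ)}) ∧
      Q.LiesOver (Ideal.span {(p : ℤ)}) ∧ P ≠ Q ∧ (P.inertiaDeg ℤ, P.ramificationIdx ℤ) = x ∧
      (Q.inertiaDeg ℤ, Q.ramificationIdx ℤ) = y ∧
      ∀ R : Ideal (𝓞 K), R.IsPrime → R.LiesOver (Ideal.span {(p : ℤ)}) → R = P ∨ R = Q := by
  classical
  rw [splittingType] at h
  set S := IsDedekindDomain.primesOverFinset (Ideal.span {(p : ℤ)}) (𝓞 K) with hS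
  have hcard : S.card = 2 := by
    have := congrArg Multiset.card h
    simpa using this
  have hx : x ∈ S.val.map fun P => (P.inertiaDeg ℤ, P.ramificationIdx ℤ) := by rw [h]; simp
  obtain ⟨P, hP, hPx⟩ := Multiset.mem_map.1 hx
  obtain ⟨Q, hQ⟩ : ∃ Q, S.erase P = {Q} := by
    rw [← Finset.card_eq_one, Finset.card_erase_of_mem hP, hcard]
  have hQS : Q ∈ S.erase P := by rw [hQ]; simp
  have hSeq : S = {P, Q} := by
    rw [← Finset.insert_erase (Finset.mem_val.mp hP), hQ]
  have hPQ : P ≠ Q := fun h => (Finset.mem_erase.1 hQS).1 h.symm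
  rw [hSeq, Finset.insert_val_of_notMem (by simpa using hPQ), Multiset.map_cons, hPx] at h
  have hQy : (Q.inertiaDeg ℤ, Q.ramificationIdx ℤ) = y := by simpa using h
  obtain ⟨p1, p2⟩ := (mem_primesOverFinset_span hp).1 (Finset.mem_val.mp hP)
  obtain ⟨q1, q2⟩ := (mem_primesOverFinset_span hp).1 (Finset.mem_of_mem_erase hQS)
  refine ⟨P, Q, p1, q1, p2, q2, hPQ, hPx, hQy, fun R h1 h2 => ?_⟩
  have : R ∈ S := (mem_primesOverFinset_span hp).2 ⟨h1, h2⟩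
  rw [hSeq] at this
  simpa using this

lemma exists_prime_of_splittingType_eq_singleton (hp : p.Prime) {x : ℕ × ℕ}
    (h : splittingType p K = {x}) :
    ∃ P : Ideal (𝓞 K), P.IsPrime ∧ P.LiesOver (Ideal.span {(p : ℤ)}) ∧
      (P.inertiaDeg ℤ, P.ramificationIdx ℤ) = x ∧
      ∀ R : Ideal (𝓞 K), R.IsPrime → R.LiesOver (Ideal.span {(p : ℤ)}) → R = P := by
  rw [splittingType, Multiset.map_eq_singleton] at h
  obtain ⟨P, hS, hP⟩ := h
  have hmem : ∀ R, R ∈ IsDedekindDomain.primesOverFinset (Ideal.span {(p : ℤ)}) (𝓞 K) ↔ R = P := by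
    intro R
    rw [← Finset.mem_val, hS, Multiset.mem_singleton]
  obtain ⟨h1, h2⟩ := (mem_primesOverFinset_span hp).1 ((hmem P).2 rfl)
  exact ⟨P, h1, h2, hP, fun R a b => (hmem R).1 ((mem_primesOverFinset_span hp).2 ⟨a, b⟩)⟩

/-- Splits off the `P`-part of an ideal; it is applied to the different, whose norm is the absolute
value of the discriminant. -/
lemma exists_absNorm_eq (hp : p.Prime) [P.IsPrime] [P.LiesOver (Ideal.span {(p : ℤ)})]
    {I : Ideal (𝓞 K)} (hI : I ≠ ⊥) : ∃ (n : ℕ) (J : Ideal (𝓞 K)),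
      Ideal.absNorm I = (p ^ P.inertiaDeg ℤ) ^ n * Ideal.absNorm J ∧ J ∣ I ∧ ¬ P ∣ J := by
  have hP := ne_bot_of_liesOver_span (P := P) hp
  have hprime : Prime P := Ideal.prime_of_isPrime hP inferInstance
  obtain ⟨J, hJ, hJP⟩ := (FiniteMultiplicity.of_prime_left hprime hI).exists_eq_pow_mul_and_not_dvd
  refine ⟨multiplicity P I, J, ?_, ⟨_, by rw [mul_comm]; exact hJ⟩, hJP⟩
  conv_lhs => rw [hJ, map_mul, map_pow]
  congr 2
  have := Ideal.natAbs_pow_inertiaDeg (p : ℤ) P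
  simpa using this.symm

end PrimesOver

/-! ### Parity of the 2-adic valuation of a discriminant. -/

section EvenDiscriminant

lemma padicValNat_even_of_sq {p a : ℕ} (hp : p.Prime) (ha : IsSquare a) : Even (padicValNat p a) := by
  obtain ⟨b, rfl⟩ := ha
  have : Fact p.Prime := ⟨hp⟩
  rcases eq_or_ne b 0 with rfl | hb
  · simp
  · rw [padicValNat.mul hb hb]; exact ⟨_, rfl⟩

/-- If `2` has a single prime above it, of even residue degree, then the discriminant contains
`2` to an even power. -/
lemma even_padicValNat_discr {L : Type*} [Field L] [NumberField L] {f e : ℕ} (hf : Even f)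
    (h : splittingType 2 L = {(f, e)}) : Even (padicValNat 2 (discr L).natAbs) := by
  obtain ⟨P, hP, hP2, hx, huniq⟩ := exists_prime_of_splittingType_eq_singleton Nat.prime_two h
  have hf' : P.inertiaDeg ℤ = f := (Prod.ext_iff.1 hx).1
  rw [← absNorm_differentIdeal L (𝓞 L)]
  obtain ⟨n, J, hJ, -, hPJ⟩ := exists_absNorm_eq (P := P) Nat.prime_two
    (I := differentIdeal ℤ (𝓞 L)) differentIdeal_ne_bot
  -- `P` is the only prime above 2 and does not divide `J`, so all powers of 2 in the norm of the
  -- different are powers of 2^f.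
  have hodd : ¬ 2 ∣ Ideal.absNorm J := by
    intro h2
    obtain ⟨Q, hQ, hQ2, hQJ⟩ := Ideal.exists_isMaximal_dvd_of_dvd_absNorm' Nat.prime_two J h2
    rw [huniq Q hQ.isPrime ⟨hQ2.symm⟩] at hQJ
    exact hPJ hQJ
  have : Fact (Nat.Prime 2) := ⟨Nat.prime_two⟩
  rw [hJ, padicValNat.mul (by positivity) (by rintro h0; simp [h0] at hodd),
    padicValNat.eq_zero_of_not_dvd hodd, ← pow_mul, padicValNat.prime_pow, hf']
  exact hf.mul_right n

end EvenDiscriminant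

/-! ### Cubic fields in which 2 is partially ramified. -/

section CubicAtTwo

open MulAction Equiv Matrix

/-- The discriminant of `X³ + aX² + bX + c`. -/
def cubicDiscr (a b c : ℤ) : ℤ := a ^ 2 * b ^ 2 - 4 * b ^ 3 - 4 * a ^ 3 * c - 27 * c ^ 2 +
  18 * a * b * c

variable {k N : Type*} [Field k] [NumberField k] [Field N] [NumberField N]

/-- `m` is the determinant of 1, θ, θ² with respect to an integral basis. When θ does not generate
the field, `m` and the polynomial discriminant both vanish. -/
lemma exists_discr_mul_sq (hk : Module.finrank ℚ k = 3) (θ : 𝓞 k) {φ : Fin 3 → (k →ₐ[ℚ] N)}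
    (hφ : Function.Injective φ) {a b c : ℤ} (ha : -(a : N) = φ 0 θ + φ 1 θ + φ 2 θ)
    (hb : (b : N) = φ 0 θ * φ 1 θ + φ 0 θ * φ 2 θ + φ 1 θ * φ 2 θ)
    (hc : -(c : N) = φ 0 θ * φ 1 θ * φ 2 θ) : ∃ m : ℤ, discr k * m ^ 2 = cubicDiscr a b c := by
  let B := (RingOfIntegers.basis k).reindex (Fintype.equivOfCardEq (by
    rw [← Module.finrank_eq_card_chooseBasisIndex, RingOfIntegers.rank, hk, Fintype.card_fin] :
    Fintype.card _ = Fintype.card (Fin 3)))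
  let v : Fin 3 → 𝓞 k := ![1, θ, θ ^ 2]
  refine ⟨(B.toMatrix v).det, ?_⟩
  have h1 := Algebra.discr_of_matrix_vecMul B (B.toMatrix v)
  rw [Module.Basis.toMatrix_map_vecMul, discr_eq_discr] at h1
  rw [mul_comm, ← h1]
  have h2 : ((Algebra.discr ℤ v : ℤ) : ℚ) = Algebra.discr ℚ fun i => (v i : k) := by
    rw [Algebra.discr_def, Algebra.discr_def]
    change Int.castRingHom ℚ _ = _
    rw [RingHom.map_det]
    congr 1
    ext i j
    have := Algebra.trace_localization (R := ℤ) (S := 𝓞 k) (Rₘ := ℚ) (Sₘ := k)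
      (nonZeroDivisors ℤ) (v i * v j)
    simp only [RingHom.mapMatrix_apply, Matrix.map_apply, Algebra.traceMatrix_apply,
      Algebra.traceForm_apply]
    rw [map_mul] at this
    exact this.symm
  have h3 := discr_eq_det_conjugateMatrix_sq hφ (by rw [hk, Fintype.card_fin])
    fun i => (v i : k)
  rw [← h2, Matrix.det_fin_three] at h3
  have : ((Algebra.discr ℤ v : ℤ) : N) = cubicDiscr a b c := by
    have ha' : (a : N) = -(φ 0 θ + φ 1 θ + φ 2 θ) := by rw [← ha, neg_neg]
    have hc' : (c : N) = -(φ 0 θ * φ 1 θ * φ 2 θ) := by rw [← hc, neg_neg]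
    rw [map_intCast] at h3
    rw [h3, cubicDiscr]
    push_cast
    rw [ha', hb, hc']
    simp [conjugateMatrix, v]
    ring
  exact_mod_cast this

lemma exists_coeffs [IsGalois ℚ N] (θ : 𝓞 k) (e : Fin 3 ≃ (k →ₐ[ℚ] N)) :
    ∃ a b c : ℤ, -(a : N) = e 0 θ + e 1 θ + e 2 θ ∧
      (b : N) = e 0 θ * e 1 θ + e 0 θ * e 2 θ + e 1 θ * e 2 θ ∧
      -(c : N) = e 0 θ * e 1 θ * e 2 θ := by
  let x : Fin 3 → 𝓞 N := fun i => RingOfIntegers.mapRingHom (e i : k →+* N) θ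
  have hx : ∀ i, ((x i : 𝓞 N) : N) = e i θ := fun _ => rfl
  have hfix : ∀ F : (Fin 3 → N) → N, (∀ (τ : Perm (Fin 3)) y, F (y ∘ τ) = F y) →
      ∀ σ : Gal(N/ℚ), F (fun i => σ (e i θ)) = F fun i => e i θ := by
    intro F hF σ
    obtain ⟨τ, hτ⟩ := exists_perm_of_embeddings e σ
    have : (fun i => σ (e i θ)) = (fun i => e i θ) ∘ τ := by
      ext i
      exact DFunLike.congr_fun (hτ i) (θ : k)
    rw [this, hF]
  have s1 : ∀ y : Fin 3 → N, y 0 + y 1 + y 2 = ∑ i, y i := fun y => (Fin.sum_univ_three y).symm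
  have s3 : ∀ y : Fin 3 → N, y 0 * y 1 * y 2 = ∏ i, y i := fun y => (Fin.prod_univ_three y).symm
  -- Written through power sums, the second symmetric function is visibly invariant under
  -- permutations.
  have s2 : ∀ y : Fin 3 → N, y 0 * y 1 + y 0 * y 2 + y 1 * y 2 =
      ((∑ i, y i) ^ 2 - ∑ i, y i ^ 2) / 2 := fun y => by
    rw [Fin.sum_univ_three, Fin.sum_univ_three]; ring
  obtain ⟨a, ha⟩ := exists_intCast_eq_of_fixed (x 0 + x 1 + x 2) fun σ => by
    have := hfix (fun y => y 0 + y 1 + y 2) (fun τ y => by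
      simp only [s1]; exact Equiv.sum_comp τ y) σ
    simpa [hx] using this
  obtain ⟨b, hb⟩ := exists_intCast_eq_of_fixed (x 0 * x 1 + x 0 * x 2 + x 1 * x 2) fun σ => by
    have := hfix (fun y => y 0 * y 1 + y 0 * y 2 + y 1 * y 2) (fun τ y => by
      simp only [s2]
      rw [← Equiv.sum_comp τ y, ← Equiv.sum_comp τ fun i => y i ^ 2]; rfl) σ
    simpa [hx] using this
  obtain ⟨c, hc⟩ := exists_intCast_eq_of_fixed (x 0 * x 1 * x 2) fun σ => by
    have := hfix (fun y => y 0 * y 1 * y 2) (fun τ y => by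
      simp only [s3]; exact Equiv.prod_comp τ y) σ
    simpa [hx] using this
  refine ⟨-a, b, -c, ?_, ?_, ?_⟩
  · have := congrArg (algebraMap (𝓞 N) N) ha
    simpa [hx] using this
  · have := congrArg (algebraMap (𝓞 N) N) hb
    simpa [hx] using this
  · have := congrArg (algebraMap (𝓞 N) N) hc
    simpa [hx] using this

set_option maxRecDepth 100000 in
lemma cubicDiscr_mod_sixteen_aux : ∀ a b c : ZMod 16,
    ((2 * a + 1) ^ 2 * (2 * b) ^ 2 - 4 * (2 * b) ^ 3 - 4 * (2 * a + 1) ^ 3 * (4 * c + 2) -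
      27 * (4 * c + 2) ^ 2 + 18 * (2 * a + 1) * (2 * b) * (4 * c + 2) = 8) ∨
    ((2 * a + 1) ^ 2 * (2 * b) ^ 2 - 4 * (2 * b) ^ 3 - 4 * (2 * a + 1) ^ 3 * (4 * c + 2) -
      27 * (4 * c + 2) ^ 2 + 18 * (2 * a + 1) * (2 * b) * (4 * c + 2) = 12) := by
  decide +kernel

lemma cubicDiscr_mod_sixteen {a b c : ℤ} (ha : Odd a) (hb : Even b) (hc : c % 4 = 2) :
    cubicDiscr a b c % 16 = 8 ∨ cubicDiscr a b c % 16 = 12 := by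
  obtain ⟨a, rfl⟩ := ha
  obtain ⟨b, rfl⟩ := hb
  obtain ⟨c, rfl⟩ : ∃ c', c = 4 * c' + 2 := ⟨c / 4, by omega⟩
  have key : ∀ n : ℤ, n % 16 = 8 ∨ n % 16 = 12 ↔ (n : ZMod 16) = 8 ∨ (n : ZMod 16) = 12 := by
    intro n
    have h8 := ZMod.intCast_eq_intCast_iff' n 8 16
    have h12 := ZMod.intCast_eq_intCast_iff' n 12 16
    push_cast at h8 h12
    rw [h8, h12]
  rw [key, cubicDiscr]
  have := cubicDiscr_mod_sixteen_aux a b c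
  push_cast
  convert this using 3 <;> ring

/-- If `2` is of type `(1²1)` in a cubic field, its discriminant is `4` modulo `8` or `8`
modulo `16`. -/
theorem discr_mod_of_splittingType (hk : Module.finrank ℚ k = 3)
    (h : splittingType 2 k = {(1, 2), (1, 1)}) : discr k % 8 = 4 ∨ discr k % 16 = 8 := by
  obtain ⟨P, Q, hP, hQ, hP2, hQ2, hPQ, hPx, hQx, huniq⟩ :=
    exists_primes_of_splittingType_eq_pair Nat.prime_two h
  obtain ⟨hPf, hPe⟩ := Prod.ext_iff.1 hPx
  simp only at hPf hPe
  have hP0 := ne_bot_of_liesOver_span (P := P) Nat.prime_two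
  have hQ0 := ne_bot_of_liesOver_span (P := Q) Nat.prime_two
  have hPmax : P.IsMaximal := hP.isMaximal hP0
  have hQmax : Q.IsMaximal := hQ.isMaximal hQ0
  -- `2` divides the discriminant
  have hram : (2 : ℤ) ∣ discr k := by
    by_contra hnd
    have := (not_dvd_discr_iff_forall_liesOver k (𝓞 k) Int.prime_two).1 hnd P hPmax hP2
    have := Ideal.ramificationIdx_eq_one P ℤ
    omega
  -- an element which is a uniformizer at `P` and `1` at `Q`
  obtain ⟨ϖ, hϖ, hϖ2⟩ : ∃ ϖ ∈ P, ϖ ∉ P ^ 2 := by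
    have := Ideal.exists_mem_pow_notMem_pow_succ P hP0 hP.ne_top 1
    simpa using this
  have hcop : IsCoprime (P ^ 2) Q := by
    refine IsCoprime.pow_left ?_
    rw [Ideal.isCoprime_iff_sup_eq]
    exact Ideal.IsMaximal.coprime_of_ne hPmax hQmax hPQ
  obtain ⟨x, hx, y, hy, hxy⟩ := Ideal.isCoprime_iff_exists.1 hcop
  set θ : 𝓞 k := ϖ * y + x with hθ
  have hθP : θ ∈ P := Ideal.add_mem _ (Ideal.mul_mem_right _ _ hϖ) (Ideal.pow_le_self two_ne_zero hx)
  have hθP2 : θ ∉ P ^ 2 := by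
    intro h'
    apply hϖ2
    have : ϖ = θ - x + ϖ * x := by rw [hθ]; linear_combination -ϖ * hxy
    rw [this]
    exact Ideal.add_mem _ (Ideal.sub_mem _ h' hx) (Ideal.mul_mem_left _ _ hx)
  have hθQ : θ - 1 ∈ Q := by
    have : θ - 1 = (ϖ - 1) * y := by rw [hθ]; linear_combination hxy
    rw [this]
    exact Ideal.mul_mem_left _ _ hy
  have hθQ' : θ ∉ Q := fun h' => hQ.ne_top ((Ideal.eq_top_iff_one _).2 (by
    have := Ideal.sub_mem _ h' hθQ
    simpa using this))
  obtain ⟨ψ⟩ := nonempty_embedding_galoisClosure k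
  let e : Fin 3 ≃ (k →ₐ[ℚ] GaloisClosure k) := Fintype.equivOfCardEq (by
    rw [Fintype.card_fin, ← Nat.card_eq_fintype_card, card_embedding ψ, hk])
  obtain ⟨a, b, c, ha, hb, hc⟩ := exists_coeffs θ e
  obtain ⟨m, hm⟩ := exists_discr_mul_sq hk θ e.injective ha hb hc
  have hroot : θ ^ 3 + a * θ ^ 2 + b * θ + c = 0 := by
    apply RingOfIntegers.ext
    apply (e 0).toRingHom.injective
    change e 0 _ = e 0 _
    have ha' : (a : GaloisClosure k) = -(e 0 θ + e 1 θ + e 2 θ) := by rw [← ha, neg_neg]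
    have hc' : (c : GaloisClosure k) = -(e 0 θ * e 1 θ * e 2 θ) := by rw [← hc, neg_neg]
    push_cast
    simp only [map_add, map_mul, map_pow, map_intCast, map_zero]
    rw [ha', hb, hc']
    ring
  have hcnorm : Algebra.norm ℤ θ = -c := by
    have h1 := norm_eq_prod_three hk e e.injective (θ : k)
    rw [← hc, ← Algebra.coe_norm_int] at h1
    have h2 : ((Algebra.norm ℤ θ : ℤ) : GaloisClosure k) = ((-c : ℤ) : GaloisClosure k) := by
      simpa using h1
    exact_mod_cast h2
  -- Since θ is a uniformizer at `P` and 1 modulo `Q`, its characteristic polynomial has a odd, b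
  -- even and c ≡ 2 mod 4. This leaves 8 and 12 as the residues of the polynomial discriminant
  -- modulo 16.
  have hPint : ∀ n : ℤ, (n : 𝓞 k) ∈ P ↔ (2 : ℤ) ∣ n := fun n => intCast_mem_iff_dvd (p := 2)
  have hQint : ∀ n : ℤ, (n : 𝓞 k) ∈ Q ↔ (2 : ℤ) ∣ n := fun n => intCast_mem_iff_dvd (p := 2)
  have h2P : (2 : 𝓞 k) ∈ P ^ 2 := by
    have := natCast_mem_pow_ramificationIdx (P := P) Nat.prime_two
    rw [hPe] at this
    exact_mod_cast this
  have hθ2 : θ ^ 2 ∈ P ^ 2 := Ideal.pow_mem_pow hθP 2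
  have hc2 : (2 : ℤ) ∣ c := by
    rw [← hPint]
    have : (c : 𝓞 k) = -(θ * (θ ^ 2 + a * θ + b)) := by linear_combination hroot
    rw [this]
    exact neg_mem (Ideal.mul_mem_right _ _ hθP)
  have hb2 : (2 : ℤ) ∣ b := by
    have h1 : (b : 𝓞 k) * θ ∈ P ^ 2 := by
      obtain ⟨c', rfl⟩ := hc2
      have : (b : 𝓞 k) * θ = -((θ + a) * θ ^ 2) - c' * 2 := by
        push_cast at hroot
        linear_combination hroot
      rw [this]
      exact Ideal.sub_mem _ (neg_mem (Ideal.mul_mem_left _ _ hθ2)) (Ideal.mul_mem_left _ _ h2P)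
    rw [← hPint]
    exact (Ideal.IsPrime.mul_mem_pow P h1).resolve_right hθP2
  have ha2 : Odd a := by
    rw [← Int.not_even_iff_odd, even_iff_two_dvd, ← hQint]
    intro ha2
    apply hθQ'
    have h1 : θ ^ 3 ∈ Q := by
      have : θ ^ 3 = -(a * θ ^ 2 + b * θ + c) := by linear_combination hroot
      rw [this]
      exact neg_mem (Ideal.add_mem _ (Ideal.add_mem _ (Ideal.mul_mem_right _ _ ha2)
        (Ideal.mul_mem_right _ _ ((hQint b).2 hb2))) ((hQint c).2 hc2))
    exact hQ.mem_of_pow_mem 3 h1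
  -- The norm of θ is -c. A second factor 2 in it would put a second `P`, or else `Q`, into the
  -- factorization of (θ).
  have hc4 : ¬ (4 : ℤ) ∣ c := by
    intro h4
    have h1 : Ideal.absNorm (Ideal.span {θ}) = c.natAbs := by
      rw [Ideal.absNorm_span_singleton, hcnorm, Int.natAbs_neg]
    obtain ⟨J, hJ⟩ : P ∣ Ideal.span {θ} := by
      rw [Ideal.dvd_span_singleton]; exact hθP
    have hPn : Ideal.absNorm P = 2 := by
      have := Ideal.natAbs_pow_inertiaDeg ((2 : ℕ) : ℤ) P
      rw [hPf] at this
      simpa using this.symm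
    rw [hJ, map_mul, hPn] at h1
    have h2 : 2 ∣ Ideal.absNorm J := by omega
    obtain ⟨R, hR, hR2, hRJ⟩ := Ideal.exists_isMaximal_dvd_of_dvd_absNorm' Nat.prime_two J h2
    rcases huniq R hR.isPrime ⟨hR2.symm⟩ with rfl | rfl
    · apply hθP2
      rw [← Ideal.dvd_span_singleton, hJ, sq]
      exact mul_dvd_mul_left _ hRJ
    · apply hθQ'
      rw [← Ideal.dvd_span_singleton, hJ]
      exact hRJ.mul_left _
  have hmod := cubicDiscr_mod_sixteen ha2 (even_iff_two_dvd.2 hb2) (by omega : c % 4 = 2)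
  -- Stickelberger turns divisibility of the field discriminant by 2 into divisibility by 4. An even
  -- index `m` would then make the polynomial discriminant divisible by 16, and an odd one does not
  -- change the discriminant modulo 16.
  obtain ⟨s, r, hsr⟩ := exists_discr_eq_sq_sub k
  have hd4 : (4 : ℤ) ∣ discr k := by
    have hs : (2 : ℤ) ∣ s ^ 2 := by omega
    obtain ⟨s', rfl⟩ := Int.prime_two.dvd_of_dvd_pow hs
    rw [hsr]
    exact ⟨s' ^ 2 - r, by ring⟩
  obtain ⟨d', hd'⟩ := hd4
  have hm2 : Odd m := by
    rw [← Int.not_even_iff_odd]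
    rintro ⟨m', rfl⟩
    have : cubicDiscr a b c = 16 * (d' * m' ^ 2) := by rw [← hm, hd']; ring
    omega
  obtain ⟨m', rfl⟩ := hm2
  have : cubicDiscr a b c = 16 * (d' * (m' ^ 2 + m')) + discr k := by rw [← hm, hd']; ring
  omega

end CubicAtTwo

/-! ### The restrictions at 2. -/

section TwoListing

open MulAction Equiv

set_option maxRecDepth 100000 in
set_option synthInstance.maxHeartbeats 400000 in
set_option synthInstance.maxSize 1000 in
lemma isCubicType_of_mem_rows : ∀ j : Fin 8, ∀ row ∈ rows j, IsCubicType row.2.1 := by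
  unfold IsCubicType
  decide +kernel

set_option maxRecDepth 100000 in
-- These are the classes containing a Klein four-group, which can be inertia only at 2.
lemma rows_exceptional : ∀ j : Fin 8, j = 3 ∨ j = 4 ∨ j = 7 → ∀ row ∈ rows j,
    row.1 = {(1, 4)} ∨ (row.2.1 = {(1, 2), (1, 1)} ∧ row.1 = {(1, 2), (1, 2)}) ∨
    (row.2.1 = {(1, 2), (1, 1)} ∧ row.1 = {(2, 2)}) := by
  decide +kernel

theorem twoListed_splittingType {L : Type u} {k : Type v} [Field L] [NumberField L] [Field k]
    [NumberField k] (hL : IsA4OrS4Quartic L) (hk : IsCubicResolvent k L) :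
    TwoListed (discr k) (splittingType 2 k) (splittingType 2 L) := by
  obtain ⟨ρ, hρ, e, he⟩ := exists_rootAction hL.1
  have := nonempty_embedding_galoisClosure L
  obtain ⟨P, _, _⟩ := exists_prime_liesOver (GaloisClosure L) Nat.prime_two
  obtain ⟨j, g, hj, row, hrow, h1, h2, -⟩ :=
    exists_splittingType_row.{v, v} hL.card ρ hρ e he Nat.prime_two P
  have h2 := h2 k hk.1 hk.2
  have hct := isCubicType_of_mem_rows j row hrow
  rw [← h2] at hct
  by_cases hj3 : j = 3 ∨ j = 4 ∨ j = 7
  · have hex := rows_exceptional j hj3 row hrow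
    rw [← h1, ← h2] at hex
    rcases hex with h | h | ⟨h, h'⟩
    · exact Or.inr (Or.inl ⟨hct, h⟩)
    · exact Or.inr (Or.inr (Or.inl h))
    · refine Or.inr (Or.inr (Or.inr ⟨h, ?_, h'⟩))
      rcases discr_mod_of_splittingType hk.1 h with hd | hd
      · exact hd
      -- Here Disc(k) has 2-adic valuation 3, while Disc(L) has even valuation and the product is a
      -- square.
      · exfalso
        have he := even_padicValNat_discr even_two h'
        have hsq : IsSquare ((discr L).natAbs * (discr k).natAbs) := by
          obtain ⟨q, hq⟩ := isSquare_discr_mul_discr hL hk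
          exact ⟨q.natAbs, by rw [← Int.natAbs_mul, hq, Int.natAbs_mul]⟩
        have hev := padicValNat_even_of_sq Nat.prime_two hsq
        have : Fact (Nat.Prime 2) := ⟨Nat.prime_two⟩
        rw [padicValNat.mul (by simpa using discr_ne_zero L) (by simpa using discr_ne_zero k),
          Nat.even_add] at hev
        have h3 : padicValNat 2 (discr k).natAbs = 3 := by
          obtain ⟨u, hu⟩ : ∃ u, (discr k).natAbs = 2 ^ 3 * (2 * u + 1) :=
            ⟨(discr k).natAbs / 16, by omega⟩
          rw [hu, padicValNat.mul (by norm_num) (by omega), padicValNat.prime_pow,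
            padicValNat.eq_zero_of_not_dvd (by omega)]
        rw [h3] at hev
        exact absurd (hev.1 he) (by decide)
  · left
    rw [h1, h2]
    exact oddListed_of_mem_rows j hj3 row hrow

end TwoListing

/-! ### Euler products over the ideals of a Dedekind domain. -/

section EulerProduct

open Filter Topology

variable {R : Type*} [CommRing R] [IsDedekindDomain R]

/-- The nonzero ideals all of whose prime divisors lie in `S`. -/
def idealsOver (S : Finset (Ideal R)) : Set (Ideal R) := {I | I ≠ ⊥ ∧ ∀ Q, Prime Q → Q ∣ I → Q ∈ S}

lemma mem_idealsOver_empty {I : Ideal R} : I ∈ idealsOver (∅ : Finset (Ideal R)) ↔ I = 1 := by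
  constructor
  · rintro ⟨h0, h⟩
    by_contra h1
    obtain ⟨Q, hQ, hQI⟩ := WfDvdMonoid.exists_irreducible_factor (by rwa [Ideal.isUnit_iff, ← Ideal.one_eq_top]) h0
    simpa using h Q hQ.prime hQI
  · rintro rfl
    exact ⟨one_ne_zero, fun Q hQ h => absurd (isUnit_of_dvd_one h) hQ.not_isUnit⟩

/-- Unique factorization, one prime at a time: the exponent is the multiplicity of `P`. -/
lemma bijective_pow_mul [DecidableEq (Ideal R)] {S : Finset (Ideal R)} {P : Ideal R} (hP : Prime P)
    (hPS : P ∉ S) :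
    ∃ e : ℕ × idealsOver S ≃ idealsOver (insert P S), ∀ x, (e x : Ideal R) = P ^ x.1 * x.2 := by
  have hnd : ∀ J ∈ idealsOver S, ¬ P ∣ J := fun J hJ h => hPS (hJ.2 P hP h)
  let f : ℕ × idealsOver S → idealsOver (insert P S) := fun x => ⟨P ^ x.1 * x.2, by
    refine ⟨mul_ne_zero (pow_ne_zero _ hP.ne_zero) x.2.2.1, fun Q hQ h => ?_⟩
    rcases hQ.dvd_or_dvd h with h | h
    · have := (hQ.dvd_of_dvd_pow h)
      rw [Finset.mem_insert]
      left
      exact associated_iff_eq.1 (hQ.associated_of_dvd hP this)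
    · exact Finset.mem_insert_of_mem (x.2.2.2 Q hQ h)⟩
  have hmul : ∀ x, multiplicity P (f x : Ideal R) = x.1 := by
    rintro ⟨n, J⟩
    refine multiplicity_eq_of_dvd_of_not_dvd ⟨_, rfl⟩ ?_
    change ¬ P ^ (n + 1) ∣ P ^ n * J
    rw [pow_succ, mul_dvd_mul_iff_left (pow_ne_zero _ hP.ne_zero)]
    exact hnd _ J.2
  refine ⟨Equiv.ofBijective f ⟨?_, ?_⟩, fun _ => rfl⟩
  · rintro ⟨n, J⟩ ⟨m, J'⟩ h
    obtain rfl : n = m := by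
      have h1 := hmul (n, J)
      rw [h, hmul] at h1
      exact h1.symm
    have h2 : P ^ n * (J : Ideal R) = P ^ n * J' := congrArg Subtype.val h
    rw [mul_right_inj' (pow_ne_zero _ hP.ne_zero)] at h2
    exact Prod.ext rfl (Subtype.ext h2)
  · rintro ⟨I, hI0, hI⟩
    obtain ⟨J, hJ, hPJ⟩ :=
      (FiniteMultiplicity.of_prime_left hP hI0).exists_eq_pow_mul_and_not_dvd
    refine ⟨(multiplicity P I, ⟨J, ?_, ?_⟩), Subtype.ext hJ.symm⟩
    · rintro rfl
      apply hI0
      rw [hJ]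
      exact mul_zero _
    · intro Q hQ h
      rcases Finset.mem_insert.1 (hI Q hQ (by rw [hJ]; exact h.mul_left _)) with rfl | h'
      · exact absurd h hPJ
      · exact h'

/-- Induction on the set of primes, multiplying by one geometric series at each step. Absolute
convergence is carried along to justify the multiplication of series. -/
lemma hasSum_idealsOver {𝕜 : Type*} [NormedField 𝕜] [CompleteSpace 𝕜] {t : Ideal R → 𝕜}
    (h1 : t 1 = 1) (hmul : ∀ I J, t (I * J) = t I * t J) (hlt : ∀ P, Prime P → ‖t P‖ < 1)
    (S : Finset (Ideal R)) (hS : ∀ P ∈ S, Prime P) :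
    (Summable fun I : idealsOver S => ‖t I‖) ∧
      HasSum (fun I : idealsOver S => t I) (∏ P ∈ S, (1 - t P)⁻¹) := by
  classical
  induction S using Finset.induction_on with
  | empty =>
    have huniq : ∀ I : idealsOver (∅ : Finset (Ideal R)), (I : Ideal R) = 1 := fun I =>
      mem_idealsOver_empty.1 I.2
    let : Unique (idealsOver (∅ : Finset (Ideal R))) :=
      { default := ⟨1, mem_idealsOver_empty.2 rfl⟩
        uniq := fun I => Subtype.ext (huniq I) }
    refine ⟨(hasSum_unique _).summable, ?_⟩
    have := hasSum_unique fun I : idealsOver (∅ : Finset (Ideal R)) => t I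
    rw [huniq, h1] at this
    simpa using this
  | insert P S hPS ih =>
    obtain ⟨s1, s2⟩ := ih fun Q hQ => hS Q (Finset.mem_insert_of_mem hQ)
    have hP := hS P (Finset.mem_insert_self _ _)
    obtain ⟨e, he⟩ := bijective_pow_mul hP hPS
    have hpow : ∀ n, t (P ^ n) = t P ^ n := fun n => by
      induction n with
      | zero => rw [pow_zero, pow_zero, h1]
      | succ n ih => rw [pow_succ, pow_succ, hmul, ih]
    have g2 := hasSum_geometric_of_norm_lt_one (hlt P hP)
    have g1 : Summable fun n : ℕ => ‖t P ^ n‖ := by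
      simp_rw [norm_pow]
      exact summable_geometric_of_lt_one (norm_nonneg _) (hlt P hP)
    have hs := summable_mul_of_summable_norm g1 s1
    have h2 := g2.mul s2 hs
    have hs' := Summable.mul_norm g1 s1
    rw [Finset.prod_insert hPS, ← e.summable_iff, ← e.hasSum_iff]
    refine ⟨hs'.congr fun x => ?_, h2.congr_fun fun x => ?_⟩
    · rw [Function.comp_apply, he, hmul, hpow]
    · rw [Function.comp_apply, he, hmul, hpow]

variable {K : Type*} [Field K] [NumberField K]

/-- The primes of `K` above the rational primes below `n`. -/
def primesUpTo (K : Type*) [Field K] [NumberField K] (n : ℕ) : Finset (Ideal (𝓞 K)) :=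
  open Classical in
  n.primesBelow.biUnion fun p => IsDedekindDomain.primesOverFinset (Ideal.span {(p : ℤ)}) (𝓞 K)

lemma prime_of_mem_primesUpTo {n : ℕ} {P : Ideal (𝓞 K)} (h : P ∈ primesUpTo K n) : Prime P := by
  classical
  obtain ⟨p, hp, hP⟩ := Finset.mem_biUnion.1 h
  have hp := Nat.prime_of_mem_primesBelow hp
  obtain ⟨h1, h2⟩ := (mem_primesOverFinset_span hp).1 hP
  exact Ideal.prime_of_isPrime (ne_bot_of_liesOver_span hp) h1

lemma exists_liesOver_of_prime {P : Ideal (𝓞 K)} (hP : Prime P) :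
    ∃ p : ℕ, p.Prime ∧ P.IsPrime ∧ P.LiesOver (Ideal.span {(p : ℤ)}) := by
  have hP' := Ideal.isPrime_of_prime hP
  have hmax : P.IsMaximal := hP'.isMaximal hP.ne_zero
  obtain ⟨p, n, -, hpP, hp, -⟩ := Ideal.exists_prime_and_absNorm_eq_pow P
  refine ⟨p, hp, hP', ⟨?_⟩⟩
  have : Fact p.Prime := ⟨hp⟩
  have hm := Int.ideal_span_isMaximal_of_prime p
  refine hm.eq_of_le (Ideal.IsPrime.ne_top inferInstance) ?_
  rw [Ideal.span_singleton_le_iff_mem, Ideal.mem_comap]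
  simpa using hpP

lemma eventually_mem_idealsOver {I : Ideal (𝓞 K)} (hI : I ≠ ⊥) :
    ∀ᶠ n in atTop, I ∈ idealsOver (primesUpTo K n) := by
  classical
  have hpos : Ideal.absNorm I ≠ 0 := Ideal.absNorm_eq_zero_iff.not.2 hI
  filter_upwards [eventually_gt_atTop (Ideal.absNorm I)] with n hn
  refine ⟨hI, fun Q hQ hQI => ?_⟩
  obtain ⟨p, hp, h1, h2⟩ := exists_liesOver_of_prime hQ
  refine Finset.mem_biUnion.2 ⟨p, ?_, (mem_primesOverFinset_span hp).2 ⟨h1, h2⟩⟩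
  refine Nat.mem_primesBelow.2 ⟨lt_of_le_of_lt (Nat.le_of_dvd (Nat.pos_of_ne_zero hpos) ?_) hn, hp⟩
  have h3 := Ideal.natAbs_pow_inertiaDeg (p : ℤ) Q
  have h4 : p ∣ Ideal.absNorm Q := by
    rw [← h3]
    exact dvd_pow_self _ (Q.inertiaDeg_pos ℤ).ne'
  exact h4.trans (map_dvd Ideal.absNorm hQI)

/-- Dominated convergence: each nonzero ideal is eventually included, and the zero ideal, which
never is, contributes 0. -/
lemma tendsto_prod_primesUpTo {𝕜 : Type*} [NormedField 𝕜] [CompleteSpace 𝕜]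
    {t : Ideal (𝓞 K) → 𝕜} (h0 : t ⊥ = 0)
    (h1 : t 1 = 1) (hmul : ∀ I J, t (I * J) = t I * t J) (hlt : ∀ P, Prime P → ‖t P‖ < 1)
    (hsum : Summable fun I => ‖t I‖) :
    Tendsto (fun n => ∏ P ∈ primesUpTo K n, (1 - t P)⁻¹) atTop (𝓝 (∑' I, t I)) := by
  have hind : ∀ n, ∑' I, (idealsOver (primesUpTo K n)).indicator t I =
      ∏ P ∈ primesUpTo K n, (1 - t P)⁻¹ := fun n => by
    rw [← tsum_subtype]
    exact (hasSum_idealsOver h1 hmul hlt _ fun _ => prime_of_mem_primesUpTo).2.tsum_eq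
  simp_rw [← hind]
  refine tendsto_tsum_of_dominated_convergence hsum (fun I => ?_) (Eventually.of_forall
    fun n I => ?_)
  · by_cases hI : I = ⊥
    · subst hI
      refine tendsto_const_nhds.congr fun n => ?_
      by_cases h : (⊥ : Ideal (𝓞 K)) ∈ idealsOver (primesUpTo K n)
      · rw [Set.indicator_of_mem h]
      · rw [Set.indicator_of_notMem h, h0]
    · refine tendsto_const_nhds.congr' ?_
      filter_upwards [eventually_mem_idealsOver hI] with n hn
      rw [Set.indicator_of_mem hn]
  · by_cases h : I ∈ idealsOver (primesUpTo K n)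
    · rw [Set.indicator_of_mem h]
    · rw [Set.indicator_of_notMem h, norm_zero]; exact norm_nonneg _

/-- A limit of nonzero products may vanish, so a uniform lower bound is needed. As |1 - t| ≤ 1 + |t|
≤ (1 - |t|)⁻¹, every partial product has absolute value at least the inverse of the sum of the
|t(I)|. -/
lemma tsum_ne_zero {t : Ideal (𝓞 K) → ℂ} (h0 : t ⊥ = 0)
    (h1 : t 1 = 1) (hmul : ∀ I J, t (I * J) = t I * t J) (hlt : ∀ P, Prime P → ‖t P‖ < 1)
    (hsum : Summable fun I => ‖t I‖) : ∑' I, t I ≠ 0 := by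
  have hlim := (tendsto_prod_primesUpTo h0 h1 hmul hlt hsum).norm
  have hle : ∀ n, (∑' I, ‖t I‖)⁻¹ ≤ ‖∏ P ∈ primesUpTo K n, (1 - t P)⁻¹‖ := by
    intro n
    have hprod := (hasSum_idealsOver (t := fun I : Ideal (𝓞 K) => ‖t I‖) (by rw [h1, norm_one])
      (fun I J => by simp [hmul]) (fun P hP => by simpa using hlt P hP) (primesUpTo K n)
      fun _ => prime_of_mem_primesUpTo).2
    have hb : ∏ P ∈ primesUpTo K n, (1 - ‖t P‖)⁻¹ ≤ ∑' I, ‖t I‖ := by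
      rw [← hprod.tsum_eq]
      exact hsum.tsum_subtype_le _ _ fun _ => norm_nonneg _
    rw [Finset.prod_inv_distrib, norm_inv, norm_prod]
    refine inv_anti₀ (Finset.prod_pos fun P hP => ?_) (le_trans ?_ hb)
    · rw [norm_pos_iff]
      intro h
      have := hlt P (prime_of_mem_primesUpTo hP)
      rw [← sub_eq_zero.1 h, norm_one] at this
      exact lt_irrefl _ this
    · refine Finset.prod_le_prod (fun _ _ => norm_nonneg _) fun P hP => ?_
      have hP := hlt P (prime_of_mem_primesUpTo hP)
      have hpos : 0 < 1 - ‖t P‖ := by linarith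
      refine (norm_sub_le _ _).trans ?_
      rw [norm_one, ← one_div, le_div_iff₀ hpos]
      nlinarith [norm_nonneg (t P)]
  intro h
  rw [h, norm_zero] at hlim
  have h2 : (∑' I, ‖t I‖)⁻¹ ≤ 0 := ge_of_tendsto' hlim hle
  have h3 : 1 ≤ ∑' I, ‖t I‖ := by
    have := hsum.le_tsum 1 fun _ _ => norm_nonneg _
    rwa [h1, norm_one] at this
  have h4 : 0 < (∑' I, ‖t I‖)⁻¹ := by positivity
  exact absurd h2 (not_le.2 h4)

/-- The product of the local Euler factors at a prime. -/
lemma prod_primesUpTo {𝕜 : Type*} [NormedField 𝕜] {t : Ideal (𝓞 K) → 𝕜} {x : ℕ → 𝕜}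
    (h : ∀ p : ℕ, p.Prime → ∀ P : Ideal (𝓞 K), P.IsPrime → P.LiesOver (Ideal.span {(p : ℤ)}) →
      t P = x p ^ P.inertiaDeg ℤ) (n : ℕ) :
    ∏ P ∈ primesUpTo K n, (1 - t P)⁻¹ =
      ∏ p ∈ n.primesBelow, ((splittingType p K).map fun y => (1 - x p ^ y.1)⁻¹).prod := by
  classical
  rw [primesUpTo, Finset.prod_biUnion]
  · refine Finset.prod_congr rfl fun p hp => ?_
    have hp := Nat.prime_of_mem_primesBelow hp
    rw [splittingType, Multiset.map_map]
    refine Finset.prod_congr rfl fun P hP => ?_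
    obtain ⟨h1, h2⟩ := (mem_primesOverFinset_span hp).1 hP
    rw [h p hp P h1 h2]
    rfl
  · intro p hp q hq hpq
    have hp := Nat.prime_of_mem_primesBelow (Finset.mem_coe.1 hp)
    have hq := Nat.prime_of_mem_primesBelow (Finset.mem_coe.1 hq)
    rw [Function.onFun, Finset.disjoint_left]
    intro P hP hP'
    obtain ⟨h1, h2⟩ := (mem_primesOverFinset_span hp).1 hP
    obtain ⟨-, h3⟩ := (mem_primesOverFinset_span hq).1 hP'
    apply hpq
    have := (intCast_mem_iff_dvd (P := P) (p := p) (n := q)).1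
      ((intCast_mem_iff_dvd (P := P) (p := q) (n := q)).2 dvd_rfl)
    exact (Nat.prime_dvd_prime_iff_eq hp hq).1 (by exact_mod_cast this)

end EulerProduct

/-! ### The Dedekind zeta function as a sum over ideals and as an Euler product. -/

section DedekindZeta

open Filter Topology

variable (K : Type*) [Field K] [NumberField K]

/-- The coefficients are nonnegative, and their partial sums are O(n) by the asymptotic count of
ideals of bounded norm. -/
lemma lseriesSummable_card_ideal {s : ℂ} (hs : 1 < s.re) :
    LSeriesSummable (fun n ↦ (Nat.card {I : Ideal (𝓞 K) // Ideal.absNorm I = n} : ℂ)) s := by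
  have key : LSeriesSummable
      (fun n ↦ ((Nat.card {I : Ideal (𝓞 K) // Ideal.absNorm I = n} : ℝ) : ℂ)) s := by
    refine LSeriesSummable_of_sum_norm_bigO_and_nonneg (r := 1) ?_ (fun n => by positivity)
      zero_le_one hs
    have h := ((Ideal.tendsto_norm_le_div_atTop₀ K).comp tendsto_natCast_atTop_atTop).isBigO_one ℝ
    have h2 : (fun n : ℕ => (∑ k ∈ Finset.Icc 1 n,
        (Nat.card {I : Ideal (𝓞 K) // Ideal.absNorm I = k} : ℝ)) / n) =O[atTop]
        fun _ => (1 : ℝ) := by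
      refine h.congr_left fun n => ?_
      simp only [Function.comp_apply, Nat.cast_le, ← Nat.cast_sum]
      congr
      -- The added 1 is the zero ideal, the only ideal of norm 0.
      rw [← add_left_inj 1, ← Ideal.card_norm_le_eq_card_norm_le_add_one,
        show Finset.Icc 1 n = Finset.Ioc 0 n from Finset.Icc_succ_left_eq_Ioc _ _,
        show 1 = Nat.card {I : Ideal (𝓞 K) // Ideal.absNorm I = 0} by
          simp [Ideal.absNorm_eq_zero_iff],
        Finset.sum_Ioc_add_eq_sum_Icc (n.zero_le),
        ← Finset.card_preimage_eq_sum_card_image_eq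
          (fun k _ ↦ Ideal.finite_setOfPred_absNorm_eq k)]
      simp [Set.coe_eq_subtype]
    have h3 := h2.mul (Asymptotics.isBigO_refl (fun n : ℕ => (n : ℝ)) atTop)
    simp only [Real.rpow_one, one_mul] at h3 ⊢
    refine h3.congr' ?_ EventuallyEq.rfl
    filter_upwards [eventually_ne_atTop 0] with n hn
    rw [div_mul_cancel₀]
    exact_mod_cast hn
  exact_mod_cast key

/-- The norm of an ideal to the power `-s`. -/
def idealTerm (s : ℂ) (I : Ideal (𝓞 K)) : ℂ := (Ideal.absNorm I : ℂ) ^ (-s)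

variable {K}

lemma idealTerm_bot {s : ℂ} (hs : 1 < s.re) : idealTerm K s ⊥ = 0 := by
  have : -s ≠ 0 := by
    intro h
    rw [neg_eq_zero] at h
    rw [h] at hs
    norm_num at hs
  simp [idealTerm, Complex.zero_cpow this]

lemma idealTerm_one (s : ℂ) : idealTerm K s 1 = 1 := by
  simp [idealTerm]

lemma idealTerm_mul (s : ℂ) (I J : Ideal (𝓞 K)) :
    idealTerm K s (I * J) = idealTerm K s I * idealTerm K s J := by
  rw [idealTerm, map_mul, Nat.cast_mul, Complex.natCast_mul_natCast_cpow]
  rfl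

lemma idealTerm_prime (s : ℂ) {p : ℕ} {P : Ideal (𝓞 K)} [P.IsPrime]
    [P.LiesOver (Ideal.span {(p : ℤ)})] :
    idealTerm K s P = ((p : ℂ) ^ (-s)) ^ P.inertiaDeg ℤ := by
  have h3 := Ideal.natAbs_pow_inertiaDeg (p : ℤ) P
  rw [Int.natAbs_natCast] at h3
  rw [idealTerm, ← h3, Nat.cast_pow, ← Complex.natCast_cpow_natCast_mul, ← Complex.cpow_nat_mul]

lemma norm_idealTerm_lt_one {s : ℂ} (hs : 1 < s.re) (P : Ideal (𝓞 K)) (hP : Prime P) :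
    ‖idealTerm K s P‖ < 1 := by
  have h2 : 1 < Ideal.absNorm P := by
    have h0 : Ideal.absNorm P ≠ 0 := Ideal.absNorm_eq_zero_iff.not.2 hP.ne_zero
    have h1 : Ideal.absNorm P ≠ 1 := by
      rw [Ne, Ideal.absNorm_eq_one_iff]
      exact (Ideal.isPrime_of_prime hP).ne_top
    omega
  rw [idealTerm, Complex.norm_natCast_cpow_of_pos (by omega)]
  exact Real.rpow_lt_one_of_one_lt_of_neg (by exact_mod_cast h2) (by simp; linarith)

/-- The sum over ideals is grouped by norm; each fibre is finite. -/
lemma hasSum_idealTerm {s : ℂ} (hs : 1 < s.re) :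
    (Summable fun I => ‖idealTerm K s I‖) ∧ ∑' I, idealTerm K s I = dedekindZeta K s := by
  have hsum := lseriesSummable_card_ideal K hs
  let e := Equiv.sigmaFiberEquiv (Ideal.absNorm : Ideal (𝓞 K) → ℕ)
  have hfin : ∀ n, Finite {I : Ideal (𝓞 K) // Ideal.absNorm I = n} := fun n =>
    Ideal.finite_setOfPred_absNorm_eq n
  have hterm : ∀ n, ∀ I : {I : Ideal (𝓞 K) // Ideal.absNorm I = n},
      idealTerm K s (e ⟨n, I⟩) = (n : ℂ) ^ (-s) := by
    rintro n ⟨I, rfl⟩; rfl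
  have hs0 : s ≠ 0 := by rintro rfl; norm_num at hs
  have hfib : ∀ n, LSeries.term
      (fun n ↦ (Nat.card {I : Ideal (𝓞 K) // Ideal.absNorm I = n} : ℂ)) s n =
      ∑' I : {I : Ideal (𝓞 K) // Ideal.absNorm I = n}, idealTerm K s (e ⟨n, I⟩) := by
    intro n
    have := hfin n
    let := Fintype.ofFinite {I : Ideal (𝓞 K) // Ideal.absNorm I = n}
    simp_rw [hterm, tsum_const, nsmul_eq_mul]
    rcases eq_or_ne n 0 with rfl | hn
    -- At index 0 both sides vanish: the term of an L-series is 0 there by convention, and 0 to the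
    -- power -s is 0 as s ≠ 0.
    · rw [LSeries.term_zero, Nat.cast_zero, Complex.zero_cpow (neg_ne_zero.2 hs0), mul_zero]
    · rw [LSeries.term_of_ne_zero hn, Complex.cpow_neg, div_eq_mul_inv]
  have hnorm : Summable fun x => ‖idealTerm K s (e x)‖ := by
    rw [summable_sigma_of_nonneg fun _ => norm_nonneg _]
    refine ⟨fun n => ?_, ?_⟩
    · have := hfin n
      exact Summable.of_finite
    · refine hsum.norm.congr fun n => ?_
      have := hfin n
      rw [hfib]
      simp_rw [hterm, tsum_const, nsmul_eq_mul, norm_mul, Complex.norm_natCast]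
  refine ⟨e.summable_iff.1 hnorm, ?_⟩
  rw [← e.tsum_eq, hnorm.of_norm.tsum_sigma, dedekindZeta, LSeries]
  exact tsum_congr fun n => (hfib n).symm

theorem dedekindZeta_ne_zero {s : ℂ} (hs : 1 < s.re) : dedekindZeta K s ≠ 0 := by
  obtain ⟨h1, h2⟩ := hasSum_idealTerm (K := K) hs
  rw [← h2]
  exact tsum_ne_zero (idealTerm_bot hs) (idealTerm_one s) (idealTerm_mul s)
    (norm_idealTerm_lt_one hs) h1

theorem tendsto_dedekindZeta {s : ℂ} (hs : 1 < s.re) :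
    Tendsto (fun n : ℕ => ∏ p ∈ n.primesBelow,
      ((splittingType p K).map fun y => (1 - ((p : ℂ) ^ (-s)) ^ y.1)⁻¹).prod) atTop
      (𝓝 (dedekindZeta K s)) := by
  obtain ⟨h1, h2⟩ := hasSum_idealTerm (K := K) hs
  rw [← h2]
  refine (tendsto_prod_primesUpTo (idealTerm_bot hs) (idealTerm_one s) (idealTerm_mul s)
    (norm_idealTerm_lt_one hs) h1).congr fun n => ?_
  exact prod_primesUpTo (x := fun p => (p : ℂ) ^ (-s)) (fun p hp P _ _ => idealTerm_prime s) n

end DedekindZeta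

/-! ### The zeta relation and its continuation. -/

section ArtinRelation

open Filter Topology

/-- Local form of an identity of permutation characters of S₄: points plus pairings equal the
trivial character plus two-element subsets. Only residue degrees matter, as Euler factors do not see
ramification indices. -/
lemma rows_inertiaDeg : ∀ j : Fin 8, ∀ row ∈ rows j,
    row.1.map Prod.fst + row.2.1.map Prod.fst = 1 ::ₘ row.2.2.map Prod.fst := by
  decide +kernel

theorem dedekindZeta_mul_eq {L : Type u} {k : Type v} {K₆ : Type w} [Field L] [NumberField L]
    [Field k] [NumberField k] [Field K₆] [NumberField K₆] [Algebra k K₆]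
    (hL : IsA4OrS4Quartic L) (h : IsAssociatedPair L k K₆) {s : ℂ} (hs : 1 < s.re) :
    dedekindZeta L s * dedekindZeta k s = riemannZeta s * dedekindZeta K₆ s := by
  refine tendsto_nhds_unique ((tendsto_dedekindZeta hs).mul (tendsto_dedekindZeta hs))
    (((riemannZeta_eulerProduct hs).mul (tendsto_dedekindZeta hs)).congr fun n => ?_)
  rw [← Finset.prod_mul_distrib, ← Finset.prod_mul_distrib]
  refine Finset.prod_congr rfl fun p hp => ?_
  obtain ⟨j, hj⟩ := exists_row_of_isAssociatedPair hL h (Nat.prime_of_mem_primesBelow hp)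
  have hrow := rows_inertiaDeg j _ hj
  have hmap : ∀ m : SplittingType, (m.map fun y => (1 - ((p : ℂ) ^ (-s)) ^ y.1)⁻¹) =
      (m.map Prod.fst).map fun f => (1 - ((p : ℂ) ^ (-s)) ^ f)⁻¹ := fun m => by
    rw [Multiset.map_map]; rfl
  simp only at hrow
  rw [hmap, hmap, hmap, ← Multiset.prod_add, ← Multiset.map_add, hrow, Multiset.map_cons,
    Multiset.prod_cons, pow_one]

/-- Near 1 the function (s - 1)ζ(s) extends continuously by the residue 1, hence analytically, and ζ
is its quotient by s - 1. -/
lemma meromorphic_riemannZeta : Meromorphic riemannZeta := by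
  intro z
  have han : ∀ z : ℂ, z ≠ 1 → AnalyticAt ℂ riemannZeta z := fun z hz => by
    rw [Complex.analyticAt_iff_eventually_differentiableAt]
    filter_upwards [isOpen_ne.mem_nhds hz] with w hw using differentiableAt_riemannZeta hw
  rcases ne_or_eq z 1 with hz | rfl
  · exact (han z hz).meromorphicAt
  · let g : ℂ → ℂ := Function.update (fun s => (s - 1) * riemannZeta s) 1 1
    have hne : ∀ w : ℂ, w ≠ 1 → g =ᶠ[𝓝 w] fun s => (s - 1) * riemannZeta s := fun w hw => by
      filter_upwards [isOpen_ne.mem_nhds hw] with y hy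
      exact Function.update_of_ne hy _ _
    have hg : AnalyticAt ℂ g 1 := by
      refine Complex.analyticAt_of_differentiable_on_punctured_nhds_of_continuousAt ?_ ?_
      · filter_upwards [self_mem_nhdsWithin] with w hw
        refine DifferentiableAt.congr_of_eventuallyEq ?_ (hne w hw)
        exact (differentiableAt_id.sub_const 1).mul (differentiableAt_riemannZeta hw)
      · exact continuousAt_update_same.2 riemannZeta_residue_one
    refine (hg.meromorphicAt.div ((MeromorphicAt.id 1).sub (MeromorphicAt.const 1 1))).congr ?_
    filter_upwards [self_mem_nhdsWithin] with w hw
    have hw' : w - 1 ≠ 0 := sub_ne_zero.2 hw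
    simp only [Pi.div_apply, Pi.sub_apply, id, g, Function.update_of_ne hw]
    field_simp

/-- Two meromorphic functions which agree on a half plane agree. -/
lemma eventuallyEq_codiscrete_of_eq_on {F G : ℂ → ℂ} (hF : Meromorphic F) (hG : Meromorphic G)
    {c : ℝ} (h : ∀ s : ℂ, c < s.re → F s = G s) : F =ᶠ[codiscrete ℂ] G := by
  have hH : MeromorphicOn (F - G) Set.univ := fun z _ => (hF z).sub (hG z)
  have hopen : IsOpen {s : ℂ | c < s.re} := isOpen_lt continuous_const Complex.continuous_re
  -- The difference vanishes near a point of the half plane, so its order there is infinite; on the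
  -- connected plane the order is then infinite everywhere.
  have htop : meromorphicOrderAt (F - G) ((c + 1 : ℝ) : ℂ) = ⊤ := by
    rw [meromorphicOrderAt_eq_top_iff]
    refine eventually_nhdsWithin_of_eventually_nhds ?_
    filter_upwards [hopen.mem_nhds (by simp : ((c + 1 : ℝ) : ℂ) ∈ {s : ℂ | c < s.re})] with z hz
    rw [Pi.sub_apply, h z hz, sub_self]
  have hall : ∀ z, meromorphicOrderAt (F - G) z = ⊤ := fun z => by
    by_contra hz
    exact hH.meromorphicOrderAt_ne_top_of_isPreconnected isPreconnected_univ (Set.mem_univ z)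
      (Set.mem_univ _) hz htop
  rw [EventuallyEq, Filter.Eventually, mem_codiscrete]
  intro z
  rw [disjoint_principal_right, compl_compl]
  filter_upwards [meromorphicOrderAt_eq_top_iff.1 (hall z)] with w hw
  exact sub_eq_zero.1 hw

end ArtinRelation

/-! ### Integral generators and Dedekind's criterion. -/

section Generators
open Polynomial

/-- `θ` is an algebraic integer generating `K` over `ℚ`, with minimal polynomial `f`. -/
structure IsIntegralGenerator {K : Type*} [Field K] [NumberField K] (θ : 𝓞 K) (f : ℤ[X]) :
    Prop where
  monic : f.Monic
  irreducible : Irreducible (f.map (Int.castRingHom ℚ))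
  root : aeval θ f = 0
  finrank : Module.finrank ℚ K = f.natDegree

namespace IsIntegralGenerator

variable {K : Type*} [Field K] [NumberField K] {θ : 𝓞 K} {f : ℤ[X]}

/-- Over ℚ this is the property of the minimal polynomial; `f` being monic, the divisibility
descends to ℤ[X]. -/
theorem dvd_of_aeval_eq_zero (h : IsIntegralGenerator θ f) {g : ℤ[X]} (hg : aeval θ g = 0) :
    f ∣ g := by
  have key : ∀ q : ℤ[X], aeval (θ : K) (q.map (Int.castRingHom ℚ)) = ((aeval θ q : 𝓞 K) : K) := by
    intro q
    rw [show Int.castRingHom ℚ = algebraMap ℤ ℚ from rfl, aeval_map_algebraMap]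
    exact aeval_algebraMap_apply K θ q
  have h1 : f.map (Int.castRingHom ℚ) = minpoly ℚ (θ : K) :=
    minpoly.eq_of_irreducible_of_monic h.irreducible (by rw [key, h.root]; rfl) (h.monic.map _)
  have h2 : minpoly ℚ (θ : K) ∣ g.map (Int.castRingHom ℚ) :=
    minpoly.dvd _ _ (by rw [key, hg]; rfl)
  rw [← h1] at h2
  exact (Polynomial.map_dvd_map _ (RingHom.injective_int _) h.monic).mp h2

/-- The map ℤ[X] → 𝔽_p[X]/(q) kills all polynomials vanishing at θ, because q divides f modulo p.
Lying over, for the integral map ℤ[X] → 𝓞 K, gives a prime above its kernel, and 𝔽_p[X]/(q) embeds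
in the residue field. Since ℤ[θ] may be smaller than 𝓞 K, only a lower bound for the residue degree
results. -/
theorem exists_prime (h : IsIntegralGenerator θ f) {p : ℕ} (hp : p.Prime) {q : (ZMod p)[X]}
    (hq : Irreducible q) (hqf : q ∣ f.map (Int.castRingHom (ZMod p))) :
    ∃ P : Ideal (𝓞 K), P.IsPrime ∧ P.LiesOver (Ideal.span {(p : ℤ)}) ∧
      (∀ g : ℤ[X], aeval θ g ∈ P ↔ q ∣ g.map (Int.castRingHom (ZMod p))) ∧
      q.natDegree ≤ P.inertiaDeg ℤ := by
  have : Fact p.Prime := ⟨hp⟩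
  have : Fact (Irreducible q) := ⟨hq⟩
  let φ : ℤ[X] →+* AdjoinRoot q := (AdjoinRoot.mk q).comp (mapRingHom (Int.castRingHom (ZMod p)))
  have hφ : ∀ g : ℤ[X], g ∈ RingHom.ker φ ↔ q ∣ g.map (Int.castRingHom (ZMod p)) := by
    intro g
    rw [RingHom.mem_ker]
    exact AdjoinRoot.mk_eq_zero
  let : Algebra ℤ[X] (𝓞 K) := (aeval θ).toRingHom.toAlgebra
  have halg : ∀ g : ℤ[X], algebraMap ℤ[X] (𝓞 K) g = aeval θ g := fun _ => rfl
  have : IsScalarTower ℤ ℤ[X] (𝓞 K) := IsScalarTower.of_algebraMap_eq' (Subsingleton.elim _ _)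
  have : Algebra.IsIntegral ℤ[X] (𝓞 K) := Algebra.IsIntegral.tower_top ℤ
  have hkp : (RingHom.ker φ).IsPrime := RingHom.ker_isPrime φ
  obtain ⟨P, -, hP, hPc⟩ := Ideal.exists_ideal_over_prime_of_isIntegral (RingHom.ker φ)
    (⊥ : Ideal (𝓞 K)) (by
      intro g hg
      rw [Ideal.mem_comap, Ideal.mem_bot, halg] at hg
      exact (hφ g).2 (hqf.trans (Polynomial.map_dvd _ (h.dvd_of_aeval_eq_zero hg))))
  have hmem : ∀ g : ℤ[X], aeval θ g ∈ P ↔ q ∣ g.map (Int.castRingHom (ZMod p)) := by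
    intro g
    rw [← hφ, ← hPc, Ideal.mem_comap, halg]
  have hpP : (p : 𝓞 K) ∈ P := by
    have := (hmem (C (p : ℤ))).2 (by simp)
    simpa using this
  have hlies : P.LiesOver (Ideal.span {(p : ℤ)}) := by
    constructor
    have hmax : (Ideal.span {(p : ℤ)}).IsMaximal :=
      PrincipalIdealRing.isMaximal_of_irreducible (Nat.prime_iff_prime_int.mp hp).irreducible
    refine hmax.eq_of_le (Ideal.IsPrime.ne_top (hP.comap _)) ?_
    rw [Ideal.span_singleton_le_iff_mem, Ideal.mem_comap]
    simpa using hpP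
  refine ⟨P, hP, hlies, hmem, ?_⟩
  have := hP
  have := hlies
  have : CharP (𝓞 K ⧸ P) p := (CharP.charP_iff_prime_eq_zero hp).2 (by
    have := Ideal.Quotient.eq_zero_iff_mem.2 hpP
    simpa using this)
  have hcomp : (ZMod.castHom (dvd_refl p) (𝓞 K ⧸ P)).comp (Int.castRingHom (ZMod p)) =
      (Ideal.Quotient.mk P).comp (algebraMap ℤ (𝓞 K)) := Subsingleton.elim _ _
  have hroot : q.eval₂ (ZMod.castHom (dvd_refl p) (𝓞 K ⧸ P)) (Ideal.Quotient.mk P θ) = 0 := by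
    obtain ⟨g, rfl⟩ := Polynomial.map_surjective (Int.castRingHom (ZMod p))
      (ZMod.ringHom_surjective _) q
    rw [eval₂_map, hcomp, ← hom_eval₂]
    exact Ideal.Quotient.eq_zero_iff_mem.2 ((hmem g).2 dvd_rfl)
  let ψ : AdjoinRoot q →+* 𝓞 K ⧸ P := AdjoinRoot.lift _ _ hroot
  have hcard : Nat.card (𝓞 K ⧸ P) = p ^ P.inertiaDeg ℤ := by
    have := Ideal.natAbs_pow_inertiaDeg (p : ℤ) P
    rw [Int.natAbs_natCast] at this
    exact this.symm
  have : Finite (𝓞 K ⧸ P) := Nat.finite_of_card_ne_zero (by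
    rw [hcard]; exact pow_ne_zero _ hp.ne_zero)
  have hcard' : Nat.card (AdjoinRoot q) = p ^ q.natDegree := by
    have : Module.Finite (ZMod p) (AdjoinRoot q) := (AdjoinRoot.powerBasis hq.ne_zero).finite
    rw [Module.natCard_eq_pow_finrank (K := ZMod p), Nat.card_zmod,
      (AdjoinRoot.powerBasis hq.ne_zero).finrank, AdjoinRoot.powerBasis_dim]
  have := Nat.card_le_card_of_injective ψ ψ.injective
  rw [hcard, hcard'] at this
  exact (Nat.pow_le_pow_iff_right hp.one_lt).1 this

/-- Dedekind's criterion: `f = ∏ hᵢ ^ mᵢ + p r` with `hᵢ` irreducible modulo `p`, not dividing `r`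
modulo `p` if `mᵢ > 1`. -/
theorem splittingType_eq (h : IsIntegralGenerator θ f) {p : ℕ} (hp : p.Prime) {n : ℕ}
    (q : Fin n → ℤ[X]) (m : Fin n → ℕ) (r : ℤ[X]) (hqm : ∀ i, (q i).Monic)
    (hf : f = ∏ i, q i ^ m i + C (p : ℤ) * r)
    (hirr : ∀ i, Irreducible ((q i).map (Int.castRingHom (ZMod p))))
    (hinj : Function.Injective fun i => (q i).map (Int.castRingHom (ZMod p)))
    (hm : ∀ i, m i ≠ 0)
    (hr : ∀ i, m i = 1 ∨
      ¬ (q i).map (Int.castRingHom (ZMod p)) ∣ r.map (Int.castRingHom (ZMod p))) :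
    splittingType p K = Finset.univ.val.map fun i => ((q i).natDegree, m i) := by
  have : Fact p.Prime := ⟨hp⟩
  have hnot : ∀ i j, i ≠ j → ¬ (q i).map (Int.castRingHom (ZMod p)) ∣
      (q j).map (Int.castRingHom (ZMod p)) := by
    intro i j hij hd
    exact hij (hinj (eq_of_monic_of_associated ((hqm i).map _) ((hqm j).map _)
      ((hirr i).associated_of_dvd (hirr j) hd)))
  have hmap : f.map (Int.castRingHom (ZMod p)) =
      ∏ i, (q i).map (Int.castRingHom (ZMod p)) ^ m i := by
    rw [hf, Polynomial.map_add, Polynomial.map_mul, Polynomial.map_C, Polynomial.map_prod]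
    simp [Polynomial.map_pow]
  have hdvd : ∀ i, (q i).map (Int.castRingHom (ZMod p)) ∣ f.map (Int.castRingHom (ZMod p)) := by
    intro i
    rw [hmap]
    exact dvd_trans (dvd_pow_self _ (hm i)) (Finset.dvd_prod_of_mem _ (Finset.mem_univ i))
  choose P hP hPp hmem hdeg using fun i => h.exists_prime hp (hirr i) (hdvd i)
  refine splittingType_eq_of_primes hp P ?_ hP hPp _ m ?_ ?_ ?_
  · intro i j hij
    by_contra hne
    refine hnot i j hne ?_
    rw [← hmem i, hij, hmem j]
  · intro i
    refine le_trans (le_of_eq ?_) (hdeg i)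
    rw [(hqm i).natDegree_map]
  · intro i
    have := hP i
    have := hPp i
    have hpP : (p : 𝓞 K) ∈ P i := by
      have := (hmem i (C (p : ℤ))).2 (by simp)
      simpa using this
    have hle : Ideal.map (algebraMap ℤ (𝓞 K)) (Ideal.span {(p : ℤ)}) ≤ P i ^ m i := by
      rw [Ideal.map_span, Set.image_singleton, Ideal.span_singleton_le_iff_mem]
      simp only [map_natCast]
      rcases hr i with h1 | h1
      · rwa [h1, pow_one]
      -- The relation f(θ) = 0 says that p·r(θ) is, up to sign, the product of the q_j(θ)^{m_j},
      -- which lies in P_i^{m_i}; as r(θ) is not in P_i, p itself lies in that power.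
      · have hrP : aeval θ r ∉ P i := fun hh => h1 ((hmem i r).1 hh)
        have hroot := h.root
        rw [hf, map_add, map_prod, map_mul, aeval_C] at hroot
        have hin : (p : 𝓞 K) * aeval θ r ∈ P i ^ m i := by
          have e1 : (p : 𝓞 K) * aeval θ r = -∏ j, aeval θ (q j ^ m j) := by
            have : (algebraMap ℤ (𝓞 K)) (p : ℤ) = (p : 𝓞 K) := by simp
            rw [this] at hroot
            linear_combination hroot
          rw [e1]
          refine neg_mem (Ideal.mem_of_dvd _ (Finset.dvd_prod_of_mem _ (Finset.mem_univ i)) ?_)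
          rw [map_pow]
          exact Ideal.pow_mem_pow ((hmem i (q i)).2 dvd_rfl) _
        exact (Ideal.IsPrime.mul_mem_pow (P i) (by rwa [mul_comm] at hin)).resolve_left hrP
    rw [← Ideal.ramificationIdx'_eq_ramificationIdx (Ideal.span {(p : ℤ)}) (P i)
      (by simpa using hp.ne_zero)]
    have hne : Ideal.map (algebraMap ℤ (𝓞 K)) (Ideal.span {(p : ℤ)}) ≠ ⊥ := by
      rw [Ideal.map_span, Set.image_singleton]
      simpa using hp.ne_zero
    rw [Ideal.IsDedekindDomain.ramificationIdx'_eq_multiplicity hne (hP i)]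
    refine FiniteMultiplicity.le_multiplicity_of_pow_dvd (FiniteMultiplicity.of_not_isUnit
      (fun hu => (hP i).ne_top (Ideal.isUnit_iff.1 hu)) hne) (Ideal.dvd_iff_le.2 hle)
  · rw [h.finrank, ← h.monic.natDegree_map (Int.castRingHom (ZMod p)), hmap,
      natDegree_prod_of_monic _ _ fun i _ => ((hqm i).map _).pow _]
    refine Finset.sum_le_sum fun i _ => ?_
    rw [((hqm i).map _).natDegree_pow, (hqm i).natDegree_map, mul_comm]

end IsIntegralGenerator
end Generators

/-! ### Quartic fields and cubic resolvents from polynomials. -/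

section Quartics
open Polynomial

/-- The monic cubic integer polynomial with the given coefficients. -/
def cubicPoly (a b c : ℤ) : ℤ[X] := X ^ 3 + C a * X ^ 2 + C b * X + C c

/-- The monic quartic integer polynomial with the given coefficients. -/
def quarticPoly (a b c d : ℤ) : ℤ[X] := X ^ 4 + C a * X ^ 3 + C b * X ^ 2 + C c * X + C d

lemma natDegree_cubicPoly (a b c : ℤ) : (cubicPoly a b c).natDegree = 3 := by
  unfold cubicPoly; compute_degree!

lemma natDegree_quarticPoly (a b c d : ℤ) : (quarticPoly a b c d).natDegree = 4 := by
  unfold quarticPoly; compute_degree!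

lemma monic_cubicPoly (a b c : ℤ) : (cubicPoly a b c).Monic := by
  unfold cubicPoly; monicity!

lemma monic_quarticPoly (a b c d : ℤ) : (quarticPoly a b c d).Monic := by
  unfold quarticPoly; monicity!

lemma aeval_cubicPoly {R : Type*} [CommRing R] (a b c : ℤ) (x : R) :
    aeval x (cubicPoly a b c) = x ^ 3 + a * x ^ 2 + b * x + c := by
  simp [cubicPoly]

lemma aeval_quarticPoly {R : Type*} [CommRing R] (a b c d : ℤ) (x : R) :
    aeval x (quarticPoly a b c d) = x ^ 4 + a * x ^ 3 + b * x ^ 2 + c * x + d := by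
  simp [quarticPoly]

lemma eval_cubicPoly (a b c x : ℤ) :
    (cubicPoly a b c).eval x = x ^ 3 + a * x ^ 2 + b * x + c := by
  simp [cubicPoly]

lemma eval_quarticPoly (a b c d x : ℤ) :
    (quarticPoly a b c d).eval x = x ^ 4 + a * x ^ 3 + b * x ^ 2 + c * x + d := by
  simp [quarticPoly]

/-- No roots and no quadratic factors modulo `q`. -/
def NoFactorsMod (q : ℕ) (a b c d : ℤ) : Prop :=
  (∀ x : ZMod q, x ^ 4 + a * x ^ 3 + b * x ^ 2 + c * x + d ≠ 0) ∧
    -- A factor X² + sX + t has the cofactor X² + (a - s)X + (b - t - s(a - s)), by comparison of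
    -- the cubic and quadratic coefficients; the two equations are those for the remaining
    -- coefficients.
    ∀ s t : ZMod q, ¬ (s * (b - t - s * (a - s)) + t * (a - s) = c ∧
      t * (b - t - s * (a - s)) = d)

/-- No roots modulo `q`. -/
def NoRootsMod (q : ℕ) (a b c : ℤ) : Prop :=
  ∀ x : ZMod q, x ^ 3 + a * x ^ 2 + b * x + c ≠ 0

instance (q : ℕ) [NeZero q] (a b c d : ℤ) : Decidable (NoFactorsMod q a b c d) := by
  unfold NoFactorsMod; have := ZMod.fintype q; infer_instance

instance (q : ℕ) [NeZero q] (a b c : ℤ) : Decidable (NoRootsMod q a b c) := by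
  unfold NoRootsMod; have := ZMod.fintype q; infer_instance

lemma irreducible_map_cubicPoly {q : ℕ} [Fact q.Prime] {a b c : ℤ} (h : NoRootsMod q a b c) :
    Irreducible ((cubicPoly a b c).map (Int.castRingHom (ZMod q))) := by
  have hd : ((cubicPoly a b c).map (Int.castRingHom (ZMod q))).natDegree = 3 := by
    rw [(monic_cubicPoly a b c).natDegree_map, natDegree_cubicPoly]
  refine (irreducible_iff_roots_eq_zero_of_degree_le_three (by omega) (by omega)).2 ?_
  refine Multiset.eq_zero_of_forall_notMem fun x hx => h x ?_
  have := isRoot_of_mem_roots hx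
  simpa [cubicPoly, IsRoot] using this

lemma irreducible_map_quarticPoly {q : ℕ} [Fact q.Prime] {a b c d : ℤ}
    (h : NoFactorsMod q a b c d) :
    Irreducible ((quarticPoly a b c d).map (Int.castRingHom (ZMod q))) := by
  have hm := (monic_quarticPoly a b c d).map (Int.castRingHom (ZMod q))
  have hd : ((quarticPoly a b c d).map (Int.castRingHom (ZMod q))).natDegree = 4 := by
    rw [(monic_quarticPoly a b c d).natDegree_map, natDegree_quarticPoly]
  have hq : (quarticPoly a b c d).map (Int.castRingHom (ZMod q)) =
      X ^ 4 + C (a : ZMod q) * X ^ 3 + C (b : ZMod q) * X ^ 2 + C (c : ZMod q) * X +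
      C (d : ZMod q) := by simp [quarticPoly]
  refine (hm.irreducible_iff_natDegree').2 ⟨fun h1 => by simp [h1] at hd, ?_⟩
  intro G F hG hF hFG hmem
  rw [mul_comm] at hFG
  rw [hd, Finset.mem_Ioc] at hmem
  have hdeg : F.natDegree + G.natDegree = 4 := by rw [← hF.natDegree_mul hG, hFG, hd]
  obtain h1 | h2 : F.natDegree = 1 ∨ F.natDegree = 2 := by omega
  · have hFX : F = X + C (F.coeff 0) := hF.eq_X_add_C h1
    refine h.1 (-F.coeff 0) ?_
    have := congrArg (eval (-F.coeff 0)) hFG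
    rw [eval_mul] at this
    nth_rewrite 2 [hFX] at this
    rw [hq] at this
    simp only [eval_add, eval_mul, eval_pow, eval_X, eval_C] at this
    rw [← this]
    ring
  · have hG2 : G.natDegree = 2 := by omega
    have expand : ∀ H : (ZMod q)[X], H.Monic → H.natDegree = 2 →
        H = X ^ 2 + C (H.coeff 1) * X + C (H.coeff 0) := by
      intro H hH h2
      have e := H.as_sum_range
      rw [h2] at e
      have hl : H.coeff 2 = 1 := by rw [← h2]; exact hH
      simp only [Finset.sum_range_succ, Finset.sum_range_zero, hl, zero_add,
        ← C_mul_X_pow_eq_monomial, pow_zero, mul_one, pow_one, map_one, one_mul] at e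
      rw [add_comm (C (H.coeff 0)), add_comm, ← add_assoc] at e
      exact e
    have eF := expand F hF h2
    have eG := expand G hG hG2
    set s := F.coeff 1
    set t := F.coeff 0
    set s' := G.coeff 1
    set t' := G.coeff 0
    have key : X ^ 4 + C (s + s') * X ^ 3 + C (t + t' + s * s') * X ^ 2 + C (s * t' + t * s') * X +
        C (t * t') = X ^ 4 + C (a : ZMod q) * X ^ 3 + C (b : ZMod q) * X ^ 2 + C (c : ZMod q) * X +
          C (d : ZMod q) := by
      rw [← hq, ← hFG, eF, eG]
      simp only [C_add, C_mul]
      ring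
    have coeffs : ∀ α β γ δ α' β' γ' δ' : ZMod q,
        X ^ 4 + C α * X ^ 3 + C β * X ^ 2 + C γ * X + C δ =
          X ^ 4 + C α' * X ^ 3 + C β' * X ^ 2 + C γ' * X + C δ' →
        α = α' ∧ β = β' ∧ γ = γ' ∧ δ = δ' := by
      intro α β γ δ α' β' γ' δ' e
      have c0 := congrArg (fun P => coeff P 0) e
      have c1 := congrArg (fun P => coeff P 1) e
      have c2 := congrArg (fun P => coeff P 2) e
      have c3 := congrArg (fun P => coeff P 3) e
      simp [coeff_X, coeff_C, coeff_X_pow] at c0 c1 c2 c3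
      exact ⟨c3, c2, c1, c0⟩
    obtain ⟨c3, c2, c1, c0⟩ := coeffs _ _ _ _ _ _ _ _ key
    have hs : s' = a - s := by linear_combination c3
    have ht : t' = b - t - s * (a - s) := by rw [← hs]; linear_combination c2
    rw [ht, hs] at c1
    rw [ht] at c0
    exact h.2 s t ⟨c1, c0⟩

/-- Irreducibility modulo q gives it over ℤ, and Gauss's lemma over ℚ. -/
lemma irreducible_map_rat {f : ℤ[X]} (hf : f.Monic) {q : ℕ} [Fact q.Prime]
    (h : Irreducible (f.map (Int.castRingHom (ZMod q)))) :
    Irreducible (f.map (Int.castRingHom ℚ)) :=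
  (hf.irreducible_iff_irreducible_map_fraction_map (K := ℚ)).1
    (hf.irreducible_of_irreducible_map _ _ h)

lemma IsIntegralGenerator.of_noRootsMod {K : Type*} [Field K] [NumberField K] {θ : 𝓞 K}
    (q : ℕ) [Fact q.Prime] {a b c : ℤ} (h : NoRootsMod q a b c)
    (hK : Module.finrank ℚ K = 3) (hθ : θ ^ 3 + a * θ ^ 2 + b * θ + c = 0) :
    IsIntegralGenerator θ (cubicPoly a b c) where
  monic := monic_cubicPoly a b c
  irreducible := irreducible_map_rat (monic_cubicPoly a b c) (irreducible_map_cubicPoly h)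
  root := by rw [aeval_cubicPoly, hθ]
  finrank := by rw [hK, natDegree_cubicPoly]

lemma IsIntegralGenerator.of_noFactorsMod {K : Type*} [Field K] [NumberField K] {θ : 𝓞 K}
    (q : ℕ) [Fact q.Prime] {a b c d : ℤ} (h : NoFactorsMod q a b c d)
    (hK : Module.finrank ℚ K = 4) (hθ : θ ^ 4 + a * θ ^ 3 + b * θ ^ 2 + c * θ + d = 0) :
    IsIntegralGenerator θ (quarticPoly a b c d) where
  monic := monic_quarticPoly a b c d
  irreducible := irreducible_map_rat (monic_quarticPoly a b c d) (irreducible_map_quarticPoly h)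
  root := by rw [aeval_quarticPoly, hθ]
  finrank := by rw [hK, natDegree_quarticPoly]

/-- The field `ℚ[X]/(f)`. -/
lemma exists_numberField_generator {f : ℤ[X]} (hf : f.Monic)
    (h : Irreducible (f.map (Int.castRingHom ℚ))) :
    ∃ (K : Type) (_ : Field K) (_ : NumberField K) (θ : 𝓞 K), IsIntegralGenerator θ f ∧
      ∀ (N : Type) [Field N] [NumberField N] (y : N), aeval y f = 0 → Nonempty (K →ₐ[ℚ] N) := by
  have := Fact.mk h
  let K := AdjoinRoot (f.map (Int.castRingHom ℚ))
  have hfin : Module.Finite ℚ K := (AdjoinRoot.powerBasis h.ne_zero).finite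
  have hchar : CharZero K := charZero_of_injective_algebraMap (algebraMap ℚ K).injective
  have : NumberField K := { to_charZero := hchar, to_finiteDimensional := hfin }
  have hroot : aeval (AdjoinRoot.root (f.map (Int.castRingHom ℚ)) : K) f = 0 := by
    have := AdjoinRoot.eval₂_root (f.map (Int.castRingHom ℚ))
    rw [eval₂_map] at this
    rw [aeval_def, ← this]
    congr 1
  let θ : 𝓞 K := ⟨AdjoinRoot.root (f.map (Int.castRingHom ℚ)), f, hf, hroot⟩
  refine ⟨K, inferInstance, this, θ, ⟨hf, h, ?_, ?_⟩, ?_⟩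
  · apply RingOfIntegers.coe_injective
    rw [map_zero, ← hroot]
    exact (aeval_algebraMap_apply K θ f).symm
  · rw [(AdjoinRoot.powerBasis h.ne_zero).finrank, AdjoinRoot.powerBasis_dim, hf.natDegree_map]
  · intro N _ _ y hy
    refine ⟨AdjoinRoot.liftAlgHom _ (Algebra.ofId ℚ N) y ?_⟩
    rw [eval₂_map, ← hy, aeval_def]
    congr 1
    exact Subsingleton.elim _ _

lemma exists_vieta_four {N : Type*} [Field N] [NumberField N] [IsGalois ℚ N] {a b c d : ℤ}
    (hirr : Irreducible ((quarticPoly a b c d).map (Int.castRingHom ℚ))) {x : N}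
    (hx : x ^ 4 + a * x ^ 3 + b * x ^ 2 + c * x + d = 0) :
    ∃ x₀ x₁ x₂ x₃ : N, (a : N) = -(x₀ + x₁ + x₂ + x₃) ∧
      (b : N) = x₀ * x₁ + x₀ * x₂ + x₀ * x₃ + x₁ * x₂ + x₁ * x₃ + x₂ * x₃ ∧
      (c : N) = -(x₀ * x₁ * x₂ + x₀ * x₁ * x₃ + x₀ * x₂ * x₃ + x₁ * x₂ * x₃) ∧
      (d : N) = x₀ * x₁ * x₂ * x₃ := by
  have hmon := (monic_quarticPoly a b c d).map (Int.castRingHom ℚ)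
  have hcomp : (algebraMap ℚ N).comp (Int.castRingHom ℚ) = Int.castRingHom N :=
    Subsingleton.elim _ _
  have hmin : (quarticPoly a b c d).map (Int.castRingHom ℚ) = minpoly ℚ x := by
    refine minpoly.eq_of_irreducible_of_monic hirr ?_ hmon
    rw [show Int.castRingHom ℚ = algebraMap ℤ ℚ from rfl, aeval_map_algebraMap, aeval_quarticPoly,
      hx]
  have hs := Normal.splits (inferInstance : Normal ℚ N) x
  rw [← hmin, Polynomial.map_map, hcomp] at hs
  have hmonN := (monic_quarticPoly a b c d).map (Int.castRingHom N)
  have hcard := hs.natDegree_eq_card_roots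
  have hprod := hs.eq_prod_roots_of_monic hmonN
  rw [(monic_quarticPoly a b c d).natDegree_map, natDegree_quarticPoly] at hcard
  have step : ∀ (n : ℕ) (s : Multiset N), s.card = n + 1 →
      ∃ y t, s = y ::ₘ t ∧ t.card = n := by
    intro n s hs
    obtain ⟨y, hy⟩ := Multiset.card_pos_iff_exists_mem.1 (by omega : 0 < s.card)
    obtain ⟨t, rfl⟩ := Multiset.exists_cons_of_mem hy
    exact ⟨y, t, rfl, by simpa using hs⟩
  obtain ⟨x₀, s, hs0, hc⟩ := step 3 _ hcard.symm
  obtain ⟨x₁, s₁, rfl, hc₁⟩ := step 2 _ hc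
  obtain ⟨x₂, s₂, rfl, hc₂⟩ := step 1 _ hc₁
  obtain ⟨x₃, s₃, rfl, hc₃⟩ := step 0 _ hc₂
  rw [Multiset.card_eq_zero] at hc₃
  subst hc₃
  rw [hs0] at hprod
  have key : ∀ t : N, t ^ 4 + a * t ^ 3 + b * t ^ 2 + c * t + d =
      (t - x₀) * (t - x₁) * (t - x₂) * (t - x₃) := by
    intro t
    have := congrArg (eval t) hprod
    simpa [quarticPoly, mul_assoc] using this
  -- The coefficients are recovered by interpolation at 0, 1, -1 and 2.
  have k0 := key 0
  have k1 := key 1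
  have k2 := key (-1)
  have k3 := key 2
  refine ⟨x₀, x₁, x₂, x₃, ?_, ?_, ?_, ?_⟩
  · linear_combination (1/6 : N) * k3 - (1/2 : N) * k1 - (1/6 : N) * k2 + (1/2 : N) * k0
  · linear_combination (1/2 : N) * k1 + (1/2 : N) * k2 - k0
  · linear_combination k1 - (1/3 : N) * k2 - (1/6 : N) * k3 - (1/2 : N) * k0
  · linear_combination k0

/-- The quartic field defined by `X ^ 4 + a X ^ 3 + b X ^ 2 + c X + d` and its cubic resolvent,
defined by a polynomial with a root in the field defined by the resolvent cubic. -/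
theorem exists_quartic_and_resolvent (q q' : ℕ) [Fact q.Prime] [Fact q'.Prime] {a b c d : ℤ}
    (h : NoFactorsMod q a b c d) {A B C : ℤ} (h' : NoRootsMod q' A B C)
    (hres : ∀ (F : Type) [Field F] [CharZero F] (t : F),
      t ^ 3 - b * t ^ 2 + (a * c - 4 * d) * t - (a ^ 2 * d - 4 * b * d + c ^ 2) = 0 →
        ∃ y : F, y ^ 3 + A * y ^ 2 + B * y + C = 0) :
    ∃ (L k : Type) (_ : Field L) (_ : NumberField L) (_ : Field k) (_ : NumberField k),
      IsA4OrS4Quartic L ∧ IsCubicResolvent k L ∧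
        (∃ θ : 𝓞 L, IsIntegralGenerator θ (quarticPoly a b c d)) ∧
        ∃ η : 𝓞 k, IsIntegralGenerator η (cubicPoly A B C) := by
  have hirr := irreducible_map_rat (monic_quarticPoly a b c d) (irreducible_map_quarticPoly h)
  obtain ⟨L, _, _, θ, hθ, -⟩ := exists_numberField_generator (monic_quarticPoly a b c d) hirr
  obtain ⟨k, _, _, η, hη, hk⟩ := exists_numberField_generator (monic_cubicPoly A B C)
    (irreducible_map_rat (monic_cubicPoly A B C) (irreducible_map_cubicPoly h'))
  have hL4 : Module.finrank ℚ L = 4 := by rw [hθ.finrank, natDegree_quarticPoly]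
  have hk3 : Module.finrank ℚ k = 3 := by rw [hη.finrank, natDegree_cubicPoly]
  obtain ⟨σ⟩ := nonempty_embedding_galoisClosure L
  have hroot := hθ.root
  rw [aeval_quarticPoly] at hroot
  have hx := congrArg (fun z : 𝓞 L => σ (z : L)) hroot
  simp only [map_add, map_mul, map_pow, map_intCast, map_zero] at hx
  obtain ⟨x₀, x₁, x₂, x₃, ha, hb, hc, hd⟩ := exists_vieta_four hirr hx
  -- The cubic in `hres` is the resolvent with root x₀x₁ + x₂x₃. Passing to `y` permits a polynomial
  -- for `k` better adapted to the prime.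
  obtain ⟨y, hy⟩ := hres (GaloisClosure L) (x₀ * x₁ + x₂ * x₃) (by rw [ha, hb, hc, hd]; ring)
  have hres : IsCubicResolvent k L := ⟨hk3, hk (GaloisClosure L) y (by rw [aeval_cubicPoly, hy])⟩
  exact ⟨L, k, _, _, _, _, isA4OrS4Quartic_of_cubic hL4 hres, hres, ⟨θ, hθ⟩, η, hη⟩

end Quartics

/-! ### Certificates for splitting types and discriminants. -/

section Evidence
open Polynomial

/-- The integer polynomial of degree at most three with the given coefficients. -/
def smallPoly (a b c d : ℤ) : ℤ[X] := C a * X ^ 3 + C b * X ^ 2 + C c * X + C d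

/-- The monic quadratic integer polynomial with the given coefficients. -/
def quadPoly (a b : ℤ) : ℤ[X] := X ^ 2 + C a * X + C b

lemma natDegree_quadPoly (a b : ℤ) : (quadPoly a b).natDegree = 2 := by
  unfold quadPoly; compute_degree!

lemma monic_quadPoly (a b : ℤ) : (quadPoly a b).Monic := by
  unfold quadPoly; monicity!

lemma irreducible_map_quadPoly {p : ℕ} [Fact p.Prime] {a b : ℤ}
    (h : ∀ x : ZMod p, x ^ 2 + a * x + b ≠ 0) :
    Irreducible ((quadPoly a b).map (Int.castRingHom (ZMod p))) := by
  have hd : ((quadPoly a b).map (Int.castRingHom (ZMod p))).natDegree = 2 := by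
    rw [(monic_quadPoly a b).natDegree_map, natDegree_quadPoly]
  refine (irreducible_iff_roots_eq_zero_of_degree_le_three (by rw [hd]) (by rw [hd]; decide)).2 ?_
  refine Multiset.eq_zero_of_forall_notMem fun x hx => h x ?_
  have := isRoot_of_mem_roots hx
  simpa [quadPoly, IsRoot] using this

lemma map_X_sub_C_dvd_iff {p : ℕ} [Fact p.Prime] {s : ℤ} {r : ℤ[X]} :
    (X - C s : ℤ[X]).map (Int.castRingHom (ZMod p)) ∣ r.map (Int.castRingHom (ZMod p)) ↔
      (p : ℤ) ∣ r.eval s := by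
  rw [Polynomial.map_sub, map_X, map_C, dvd_iff_isRoot, IsRoot, eval_map, eval₂_at_apply,
    eq_intCast, ZMod.intCast_zmod_eq_zero_iff_dvd]

lemma irreducible_map_X_sub_C {p : ℕ} [Fact p.Prime] (s : ℤ) :
    Irreducible ((X - C s : ℤ[X]).map (Int.castRingHom (ZMod p))) := by
  rw [Polynomial.map_sub, map_X, map_C]
  exact irreducible_X_sub_C _

lemma eval_smallPoly (a b c d x : ℤ) :
    (smallPoly a b c d).eval x = a * x ^ 3 + b * x ^ 2 + c * x + d := by
  simp [smallPoly]

namespace IsIntegralGenerator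

variable {K : Type*} [Field K] [NumberField K] {θ : 𝓞 K} {f : ℤ[X]}

lemma splittingType_of_irreducible (h : IsIntegralGenerator θ f) {p : ℕ} (hp : p.Prime)
    (hirr : Irreducible (f.map (Int.castRingHom (ZMod p)))) :
    splittingType p K = {(f.natDegree, 1)} := by
  have := h.splittingType_eq hp (n := 1) (fun _ => f) (fun _ => 1) 0 (fun _ => h.monic) (by simp)
    (fun _ => hirr) (Function.injective_of_subsingleton _) (by simp) (by simp)
  exact this

/-- Dedekind's criterion for a product of linear factors modulo `p`. -/
lemma splittingType_of_linear (h : IsIntegralGenerator θ f) {p : ℕ} (hp : p.Prime) {n : ℕ}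
    (s : Fin n → ℤ) (m : Fin n → ℕ) (r₃ r₂ r₁ r₀ : ℤ)
    (hf : f = ∏ i, (X - C (s i)) ^ m i + C (p : ℤ) * smallPoly r₃ r₂ r₁ r₀)
    (hs : ∀ i j, i ≠ j → ¬ (p : ℤ) ∣ s i - s j) (hm : ∀ i, m i ≠ 0)
    (hr : ∀ i, m i = 1 ∨ ¬ (p : ℤ) ∣ r₃ * s i ^ 3 + r₂ * s i ^ 2 + r₁ * s i + r₀) :
    splittingType p K = Finset.univ.val.map fun i => (1, m i) := by
  have := Fact.mk hp
  have key := h.splittingType_eq hp (fun i => X - C (s i)) m _ (fun i => monic_X_sub_C _) hf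
    (fun i => irreducible_map_X_sub_C _) ?_ hm ?_
  · simpa only [natDegree_X_sub_C] using key
  · intro i j hij
    by_contra hne
    refine hs i j hne ?_
    have := map_X_sub_C_dvd_iff.1 (dvd_of_eq hij)
    simpa using this
  · intro i
    rw [map_X_sub_C_dvd_iff, eval_smallPoly]
    exact hr i

/-- Dedekind's criterion for a product of linear factors and a simple nonlinear one modulo `p`. -/
lemma splittingType_of_linear_mul (h : IsIntegralGenerator θ f) {p : ℕ} (hp : p.Prime) {n : ℕ}
    {g : ℤ[X]} (hg : g.Monic) (hgirr : Irreducible (g.map (Int.castRingHom (ZMod p))))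
    (hgd : g.natDegree ≠ 1)
    (s : Fin n → ℤ) (m : Fin n → ℕ) (r₃ r₂ r₁ r₀ : ℤ)
    (hf : f = g * ∏ i, (X - C (s i)) ^ m i + C (p : ℤ) * smallPoly r₃ r₂ r₁ r₀)
    (hs : ∀ i j, i ≠ j → ¬ (p : ℤ) ∣ s i - s j) (hm : ∀ i, m i ≠ 0)
    (hr : ∀ i, m i = 1 ∨ ¬ (p : ℤ) ∣ r₃ * s i ^ 3 + r₂ * s i ^ 2 + r₁ * s i + r₀) :
    splittingType p K = (g.natDegree, 1) ::ₘ Finset.univ.val.map fun i => (1, m i) := by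
  have := Fact.mk hp
  have key := h.splittingType_eq hp (n := n + 1) (Fin.cons g fun i => X - C (s i)) (Fin.cons 1 m) _
    ?_ (by simpa [Fin.prod_univ_succ] using hf) ?_ ?_ ?_ ?_
  · rw [key, Fin.univ_succ, Finset.cons_val, Multiset.map_cons, Finset.map_val, Multiset.map_map]
    simp only [Function.comp_def, Fin.cons_zero, Function.Embedding.coeFn_mk, Fin.cons_succ,
      natDegree_X_sub_C]
  · refine Fin.cases hg fun i => monic_X_sub_C _
  · refine Fin.cases hgirr fun i => irreducible_map_X_sub_C _
  · have hne : ∀ i, g.map (Int.castRingHom (ZMod p)) ≠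
        (X - C (s i) : ℤ[X]).map (Int.castRingHom (ZMod p)) := by
      intro i hi
      have := congrArg natDegree hi
      rw [hg.natDegree_map, (monic_X_sub_C _).natDegree_map, natDegree_X_sub_C] at this
      exact hgd this
    refine Fin.cases (Fin.cases (fun _ => rfl) fun j hj => absurd hj (hne j)) fun i =>
      Fin.cases (fun hi => absurd hi.symm (hne i)) fun j hij => ?_
    by_contra hne
    refine hs i j (fun e => hne (by rw [e])) ?_
    have := map_X_sub_C_dvd_iff.1 (dvd_of_eq hij)
    simpa using this
  · exact Fin.cases one_ne_zero hm
  · refine Fin.cases (Or.inl rfl) fun i => ?_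
    have := hr i
    rw [← eval_smallPoly, ← map_X_sub_C_dvd_iff] at this
    exact this

lemma splittingType_of_quad_mul_quad (h : IsIntegralGenerator θ f) {p : ℕ} (hp : p.Prime)
    {a b a' b' : ℤ} (h₁ : ∀ x : ZMod p, x ^ 2 + a * x + b ≠ 0)
    (h₂ : ∀ x : ZMod p, x ^ 2 + a' * x + b' ≠ 0) (hne : ¬ (p : ℤ) ∣ b - b') (r₃ r₂ r₁ r₀ : ℤ)
    (hf : f = quadPoly a b * quadPoly a' b' + C (p : ℤ) * smallPoly r₃ r₂ r₁ r₀) :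
    splittingType p K = {(2, 1), (2, 1)} := by
  have := Fact.mk hp
  have key := h.splittingType_eq hp ![quadPoly a b, quadPoly a' b'] ![1, 1] _
    ?_ (by simpa [Fin.prod_univ_succ] using hf) ?_ ?_ ?_ ?_
  · rw [key]
    simp [Fin.univ_succ, natDegree_quadPoly]
  · simp [Fin.forall_fin_two, monic_quadPoly]
  · simpa [Fin.forall_fin_two] using
      ⟨irreducible_map_quadPoly h₁, irreducible_map_quadPoly h₂⟩
  · have : (quadPoly a b).map (Int.castRingHom (ZMod p)) ≠
        (quadPoly a' b').map (Int.castRingHom (ZMod p)) := by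
      intro e
      have := congrArg (eval 0) e
      simp [quadPoly] at this
      rw [← sub_eq_zero, ← Int.cast_sub, ZMod.intCast_zmod_eq_zero_iff_dvd] at this
      exact hne this
    intro i j
    fin_cases i <;> fin_cases j <;> simp [this, this.symm]
  · simp [Fin.forall_fin_two]
  · simp [Fin.forall_fin_two]

/-- Modulo the quadratic the remainder is r₁X + r₀, so Dedekind's condition is that this linear
polynomial is nonzero modulo p. -/
lemma splittingType_of_quad_sq (h : IsIntegralGenerator θ f) {p : ℕ} (hp : p.Prime)
    {a b : ℤ} (h₁ : ∀ x : ZMod p, x ^ 2 + a * x + b ≠ 0) (w : ℤ[X]) (r₁ r₀ : ℤ)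
    (hne : ¬ ((p : ℤ) ∣ r₁ ∧ (p : ℤ) ∣ r₀))
    (hf : f = quadPoly a b ^ 2 + C (p : ℤ) * (quadPoly a b * w + (C r₁ * X + C r₀))) :
    splittingType p K = {(2, 2)} := by
  have := Fact.mk hp
  have key := h.splittingType_eq hp (n := 1) (fun _ => quadPoly a b) (fun _ => 2) _
    (fun _ => monic_quadPoly a b) (by simpa using hf) (fun _ => irreducible_map_quadPoly h₁)
    (Function.injective_of_subsingleton _) (by simp) ?_
  · rw [key]
    simp [natDegree_quadPoly]
  · refine fun _ => Or.inr fun hd => hne ?_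
    rw [Polynomial.map_add, Polynomial.map_mul, dvd_add_right (dvd_mul_right _ _)] at hd
    have h0 : (C r₁ * X + C r₀ : ℤ[X]).map (Int.castRingHom (ZMod p)) = 0 := by
      refine eq_zero_of_dvd_of_natDegree_lt hd ?_
      rw [(monic_quadPoly a b).natDegree_map, natDegree_quadPoly]
      refine lt_of_le_of_lt natDegree_map_le ?_
      exact lt_of_le_of_lt natDegree_linear_le (by decide)
    rw [Polynomial.map_add, Polynomial.map_mul, map_C, map_C, map_X] at h0
    have e0 := congrArg (eval 0) h0
    have e1 := congrArg (eval 1) h0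
    simp only [eval_add, eval_mul, eval_C, eval_X, mul_zero, zero_add, mul_one, eval_zero,
      eq_intCast] at e0 e1
    rw [e0, add_zero] at e1
    exact ⟨(ZMod.intCast_zmod_eq_zero_iff_dvd _ _).1 e1,
      (ZMod.intCast_zmod_eq_zero_iff_dvd _ _).1 e0⟩

lemma exists_prime_sub_mem (h : IsIntegralGenerator θ f) {p : ℕ} (hp : p.Prime) (s : ℤ)
    (hs : (p : ℤ) ∣ f.eval s) :
    ∃ P : Ideal (𝓞 K), P.IsPrime ∧ P.LiesOver (Ideal.span {(p : ℤ)}) ∧ θ - s ∈ P := by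
  have := Fact.mk hp
  obtain ⟨P, hP, hPp, hmem, -⟩ := h.exists_prime hp (irreducible_map_X_sub_C s)
    (map_X_sub_C_dvd_iff.2 hs)
  refine ⟨P, hP, hPp, ?_⟩
  have := (hmem (X - C s)).2 dvd_rfl
  simpa using this

end IsIntegralGenerator

lemma exists_integer_of_root {K : Type*} [Field K] {x : K} {f : ℤ[X]} (hf : f.Monic) (hx : aeval x f = 0) :
    ∃ y : 𝓞 K, (y : K) = x :=
  ⟨⟨x, f, hf, hx⟩, rfl⟩

variable {K : Type*} [Field K] [NumberField K]

/-- Two elements whose product is divisible by `p` can separate three primes above `p`. -/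
theorem three_le_card_splittingType {p : ℕ} (hp : p.Prime) {ω κ ν : 𝓞 K} {f₁ f₂ f₃ : ℤ[X]}
    (h₁ : IsIntegralGenerator ω f₁) (h₂ : IsIntegralGenerator κ f₂)
    (h₃ : IsIntegralGenerator (ω + κ) f₃) (hν : ω * κ = p * ν)
    (e₁ : (p : ℤ) ∣ f₁.eval 1) (e₂ : (p : ℤ) ∣ f₂.eval 1) (e₃ : (p : ℤ) ∣ f₃.eval 0) :
    3 ≤ (splittingType p K).card := by
  obtain ⟨P₁, hP₁, hp₁, hm₁⟩ := h₁.exists_prime_sub_mem hp 1 e₁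
  obtain ⟨P₂, hP₂, hp₂, hm₂⟩ := h₂.exists_prime_sub_mem hp 1 e₂
  obtain ⟨P₃, hP₃, hp₃, hm₃⟩ := h₃.exists_prime_sub_mem hp 0 e₃
  rw [Int.cast_one] at hm₁ hm₂
  rw [Int.cast_zero, sub_zero] at hm₃
  have hone : ∀ (P : Ideal (𝓞 K)) [P.IsPrime] (x : 𝓞 K), x - 1 ∈ P → x ∉ P := by
    intro P _ x h1 hx
    exact (Ideal.ne_top_iff_one P).1 Ideal.IsPrime.ne_top' (by
      have := P.sub_mem hx h1
      rwa [sub_sub_cancel] at this)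
  have hmul : ∀ (P : Ideal (𝓞 K)) [P.IsPrime] [P.LiesOver (Ideal.span {(p : ℤ)})],
      ω ∈ P ∨ κ ∈ P := by
    intro P _ _
    refine Ideal.IsPrime.mem_or_mem ‹_› ?_
    rw [hν]
    refine P.mul_mem_right _ ?_
    have := (intCast_mem_iff_dvd (P := P) (p := p) (n := (p : ℤ))).2 dvd_rfl
    simpa using this
  have hω₁ := hone P₁ ω hm₁
  have hκ₂ := hone P₂ κ hm₂
  -- Every prime above p contains ω or κ; P₁ contains only κ, P₂ only ω, and P₃ both.
  have hκ₁ := (hmul P₁).resolve_left hω₁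
  have hω₂ := (hmul P₂).resolve_right hκ₂
  have hω₃ : ω ∈ P₃ := by
    rcases hmul P₃ with h | h
    · exact h
    · exact (Ideal.add_mem_iff_left P₃ h).1 hm₃
  have hκ₃ : κ ∈ P₃ := (Ideal.add_mem_iff_right P₃ hω₃).1 hm₃
  rw [splittingType, Multiset.card_map, Finset.card_val]
  refine Finset.two_lt_card_iff.2 ⟨P₁, P₂, P₃, (mem_primesOverFinset_span hp).2 ⟨hP₁, hp₁⟩,
    (mem_primesOverFinset_span hp).2 ⟨hP₂, hp₂⟩, (mem_primesOverFinset_span hp).2 ⟨hP₃, hp₃⟩,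
    ?_, ?_, ?_⟩
  · rintro rfl; exact hκ₂ hκ₁
  · rintro rfl; exact hω₁ hω₃
  · rintro rfl; exact hκ₂ hκ₃

/-- There is only one irreducible quadratic over 𝔽₂, so Dedekind's criterion for a single polynomial
cannot exhibit (22). Instead α reduces to a primitive cube root of unity, which makes all residue
degrees above 2 at least 2, and θ ≡ 0 and θ ≡ 1 define two different primes. -/
lemma IsIntegralGenerator.splittingType_two_of_norm_residue {θ : 𝓞 K} {f : ℤ[X]}
    (h : IsIntegralGenerator θ f) (hK : Module.finrank ℚ K = 4) (h0 : (2 : ℤ) ∣ f.eval 0)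
    (h1 : (2 : ℤ) ∣ f.eval 1) {α β : 𝓞 K} (hα : α ^ 2 + α + 1 = 2 * β) :
    splittingType 2 K = {(2, 1), (2, 1)} := by
  obtain ⟨P, hP, hp, hm⟩ := h.exists_prime_sub_mem Nat.prime_two 0 (by exact_mod_cast h0)
  obtain ⟨Q, hQ, hq, hn⟩ := h.exists_prime_sub_mem Nat.prime_two 1 (by exact_mod_cast h1)
  rw [Int.cast_one] at hn
  rw [Int.cast_zero, sub_zero] at hm
  have hPQ : P ≠ Q := by
    rintro rfl
    refine (Ideal.ne_top_iff_one P).1 Ideal.IsPrime.ne_top' ?_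
    have := P.sub_mem hm hn
    rwa [sub_sub_cancel] at this
  have key : ∀ (P : Ideal (𝓞 K)) [P.IsPrime] [P.LiesOver (Ideal.span {((2 : ℕ) : ℤ)})],
      2 ≤ P.inertiaDeg ℤ ∧ 1 ≤ P.ramificationIdx ℤ := by
    intro P _ _
    have hpos := splittingType_pos (K := K) Nat.prime_two _
      ((mem_splittingType Nat.prime_two).2 ⟨P, ‹_›, ‹_›, rfl⟩)
    simp only at hpos
    have hf := Nat.pos_of_mul_pos_right hpos
    have he := Nat.pos_of_mul_pos_left hpos
    refine ⟨?_, he⟩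
    by_contra hlt
    have hf1 : P.inertiaDeg ℤ = 1 := by omega
    have hcard := Ideal.natAbs_pow_inertiaDeg ((2 : ℕ) : ℤ) P
    rw [hf1] at hcard
    have hcard2 : Nat.card (𝓞 K ⧸ P) = 2 := hcard.symm
    obtain ⟨y, hy, huniq⟩ := (Nat.card_eq_two_iff' (0 : 𝓞 K ⧸ P)).1 hcard2
    have hone : (1 : 𝓞 K ⧸ P) = y := huniq 1 one_ne_zero
    have h2 : (2 : 𝓞 K ⧸ P) = 0 := by
      have := (intCast_mem_iff_dvd (P := P) (p := 2) (n := 2)).2 (by norm_num)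
      have := Ideal.Quotient.eq_zero_iff_mem.2 this
      rwa [Int.cast_ofNat, map_ofNat] at this
    have hα' := congrArg (Ideal.Quotient.mk P) hα
    simp only [map_add, map_pow, map_one, map_mul, map_ofNat, h2, zero_mul] at hα'
    by_cases hz : Ideal.Quotient.mk P α = 0
    · rw [hz] at hα'
      simp at hα'
    · have := huniq _ hz
      rw [this, ← hone] at hα'
      have h3 : (1 : 𝓞 K ⧸ P) = 0 := by linear_combination hα' - h2
      exact one_ne_zero h3
  have := splittingType_eq_of_primes (K := K) Nat.prime_two ![P, Q] ?_ ?_ ?_ ![2, 2] ![1, 1]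
    ?_ ?_ (by simp [hK])
  · rw [this]
    simp [Fin.univ_succ]
  · intro i j
    fin_cases i <;> fin_cases j <;> simp [hPQ, hPQ.symm]
  · simpa [Fin.forall_fin_two] using ⟨hP, hQ⟩
  · simpa [Fin.forall_fin_two] using ⟨hp, hq⟩
  · simpa [Fin.forall_fin_two] using ⟨(key P).1, (key Q).1⟩
  · simpa [Fin.forall_fin_two] using ⟨(key P).2, (key Q).2⟩

lemma IsIntegralGenerator.exists_discr_mul_sq {k : Type*} [Field k] [NumberField k] {η : 𝓞 k}
    {a b c : ℤ} (h : IsIntegralGenerator η (cubicPoly a b c)) :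
    ∃ m : ℤ, discr k * m ^ 2 = cubicDiscr a b c := by
  have hk : Module.finrank ℚ k = 3 := by rw [h.finrank, natDegree_cubicPoly]
  obtain ⟨φ⟩ := nonempty_embedding_galoisClosure k
  have hcard := card_embedding φ
  rw [hk] at hcard
  have : Finite (k →ₐ[ℚ] GaloisClosure k) := Nat.finite_of_card_ne_zero (by omega)
  let e : Fin 3 ≃ (k →ₐ[ℚ] GaloisClosure k) := (Finite.equivFinOfCardEq hcard).symm
  obtain ⟨a', b', c', ha, hb, hc⟩ := exists_coeffs η e
  have hz : aeval η (cubicPoly a' b' c') = 0 := by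
    apply RingOfIntegers.coe_injective
    apply (e 0).injective
    rw [aeval_cubicPoly]
    simp only [map_add, map_mul, map_pow, map_intCast, map_zero]
    have ha' : (a' : GaloisClosure k) = -(e 0 η + e 1 η + e 2 η) := by rw [← ha, neg_neg]
    have hc' : (c' : GaloisClosure k) = -(e 0 η * e 1 η * e 2 η) := by rw [← hc, neg_neg]
    rw [ha', hb, hc']
    change (e 0 (η : k)) ^ 3 + -(e 0 η + e 1 η + e 2 η) * (e 0 (η : k)) ^ 2 +
      (e 0 η * e 1 η + e 0 η * e 2 η + e 1 η * e 2 η) * (e 0 (η : k)) +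
      -(e 0 η * e 1 η * e 2 η) = 0
    ring
  have heq := eq_of_monic_of_dvd_of_natDegree_le h.monic (monic_cubicPoly a' b' c')
    (h.dvd_of_aeval_eq_zero hz) (by rw [natDegree_cubicPoly, natDegree_cubicPoly])
  have e0 := congrArg (eval 0) heq
  have e1 := congrArg (eval 1) heq
  have e2 := congrArg (eval (-1)) heq
  rw [eval_cubicPoly, eval_cubicPoly] at e0 e1 e2
  obtain rfl : a' = a := by linarith
  obtain rfl : b' = b := by linarith
  obtain rfl : c' = c := by linarith
  exact _root_.exists_discr_mul_sq hk η e.injective ha hb hc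

/-- The discriminants of the field and of the polynomial differ by a square, so their 2-adic
valuations have the same parity. For type (1²1) the valuation of the field discriminant is 2 or 3,
and parity decides. -/
lemma IsIntegralGenerator.discr_emod_eight {k : Type*} [Field k] [NumberField k] {η : 𝓞 k}
    {a b c : ℤ} (h : IsIntegralGenerator η (cubicPoly a b c))
    (h2 : splittingType 2 k = {(1, 2), (1, 1)}) {j : ℕ} {u : ℤ} (hu : u % 2 = 1)
    (hD : cubicDiscr a b c = 2 ^ j * u) : discr k ≡ (if Even j then 4 else 0) [ZMOD 8] := by
  have hk : Module.finrank ℚ k = 3 := by rw [h.finrank, natDegree_cubicPoly]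
  obtain ⟨m, hm⟩ := h.exists_discr_mul_sq
  have : Fact (Nat.Prime 2) := ⟨Nat.prime_two⟩
  have hu0 : u ≠ 0 := by rintro rfl; simp at hu
  have hm0 : m ≠ 0 := by
    rintro rfl
    rw [hD] at hm
    simp [hu0] at hm
  have val : ∀ (i : ℕ) (t : ℤ), t % 2 = 1 → padicValInt 2 (2 ^ i * t) = i := by
    intro i t ht
    have ht0 : t ≠ 0 := by rintro rfl; simp at ht
    rw [padicValInt, Int.natAbs_mul, Int.natAbs_pow, padicValNat.mul (by simp) (by simpa using ht0),
      padicValNat.eq_zero_of_not_dvd (n := t.natAbs) (by omega), add_zero]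
    exact padicValNat.prime_pow i
  have hv := congrArg (padicValInt 2) hm
  rw [hD, val j u hu, padicValInt.mul (discr_ne_zero k) (pow_ne_zero _ hm0), pow_two,
    padicValInt.mul hm0 hm0] at hv
  have hd : ∀ (i : ℕ) (t : ℤ), t % 2 = 1 → discr k = 2 ^ i * t → (Even j ↔ Even i) := by
    intro i t ht e
    rw [e, val i t ht] at hv
    rw [← hv]
    simp [parity_simps]
  rcases discr_mod_of_splittingType hk h2 with h8 | h16
  · have := hd 2 (discr k / 4) (by omega) (by omega)
    rw [if_pos (this.2 (by decide))]
    exact h8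
  · have := hd 3 (discr k / 8) (by omega) (by omega)
    rw [if_neg (by rw [this]; decide)]
    unfold Int.ModEq
    omega

end Evidence

/-! ### Tools for realising the listed combinations. -/

section Occurrence
open Polynomial

/-- The pair `(tk, tL)` of splitting types occurs for some odd prime. -/
def OccursOdd (tk tL : SplittingType) : Prop :=
  ∃ (p : ℕ) (L k : Type) (_ : Field L) (_ : NumberField L) (_ : Field k) (_ : NumberField k),
    p.Prime ∧ 3 ≤ p ∧ IsA4OrS4Quartic L ∧ IsCubicResolvent k L ∧
      splittingType p k = tk ∧ splittingType p L = tL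

/-- The pair `(tk, tL)` of splitting types occurs for the prime `2`, with discriminant of the
resolvent congruent to `d` modulo `8` if `2` is partially ramified in the resolvent. -/
def OccursTwo (d : ℤ) (tk tL : SplittingType) : Prop :=
  ∃ (L k : Type) (_ : Field L) (_ : NumberField L) (_ : Field k) (_ : NumberField k),
    IsA4OrS4Quartic L ∧ IsCubicResolvent k L ∧ splittingType 2 k = tk ∧ splittingType 2 L = tL ∧
      (tk = {(1, 2), (1, 1)} → discr k ≡ d [ZMOD 8])

instance fact_prime_five : Fact (Nat.Prime 5) := ⟨by norm_num⟩
instance fact_prime_seven : Fact (Nat.Prime 7) := ⟨by norm_num⟩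
instance fact_prime_eleven : Fact (Nat.Prime 11) := ⟨by norm_num⟩
instance fact_prime_thirteen : Fact (Nat.Prime 13) := ⟨by norm_num⟩

/-- `q` and `q'` only certify irreducibility of the quartic and the cubic. The restriction already
proved is passed to `H`, so that one type may be deduced from the other instead of computed. -/
lemma occursOdd_of_generators {tk tL : SplittingType} (p : ℕ) (hp : p.Prime) (h3 : 3 ≤ p)
    (q q' : ℕ) [Fact q.Prime] [Fact q'.Prime] {a b c d : ℤ} (h : NoFactorsMod q a b c d)
    {A B C : ℤ} (h' : NoRootsMod q' A B C)
    (hres : ∀ (F : Type) [Field F] [CharZero F] (t : F),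
      t ^ 3 - b * t ^ 2 + (a * c - 4 * d) * t - (a ^ 2 * d - 4 * b * d + c ^ 2) = 0 →
        ∃ y : F, y ^ 3 + A * y ^ 2 + B * y + C = 0)
    (H : ∀ (L k : Type) [Field L] [NumberField L] [Field k] [NumberField k] (θ : 𝓞 L) (η : 𝓞 k),
      IsIntegralGenerator θ (quarticPoly a b c d) → IsIntegralGenerator η (cubicPoly A B C) →
      OddListed (splittingType p k) (splittingType p L) →
        splittingType p k = tk ∧ splittingType p L = tL) : OccursOdd tk tL := by
  obtain ⟨L, k, _, _, _, _, hL, hk, ⟨θ, hθ⟩, η, hη⟩ := exists_quartic_and_resolvent q q' h h' hres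
  obtain ⟨e₁, e₂⟩ := H L k θ η hθ hη (oddListed_splittingType hL hk hp h3)
  exact ⟨p, L, k, _, _, _, _, hp, h3, hL, hk, e₁, e₂⟩

lemma occursTwo_of_generators {D : ℤ} {tk tL : SplittingType}
    (q q' : ℕ) [Fact q.Prime] [Fact q'.Prime] {a b c d : ℤ} (h : NoFactorsMod q a b c d)
    {A B C : ℤ} (h' : NoRootsMod q' A B C)
    (hres : ∀ (F : Type) [Field F] [CharZero F] (t : F),
      t ^ 3 - b * t ^ 2 + (a * c - 4 * d) * t - (a ^ 2 * d - 4 * b * d + c ^ 2) = 0 →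
        ∃ y : F, y ^ 3 + A * y ^ 2 + B * y + C = 0)
    (H : ∀ (L k : Type) [Field L] [NumberField L] [Field k] [NumberField k] (θ : 𝓞 L) (η : 𝓞 k),
      IsIntegralGenerator θ (quarticPoly a b c d) → IsIntegralGenerator η (cubicPoly A B C) →
      TwoListed (discr k) (splittingType 2 k) (splittingType 2 L) →
        splittingType 2 k = tk ∧ splittingType 2 L = tL ∧
          (tk = {(1, 2), (1, 1)} → discr k ≡ D [ZMOD 8])) : OccursTwo D tk tL := by
  obtain ⟨L, k, _, _, _, _, hL, hk, ⟨θ, hθ⟩, η, hη⟩ := exists_quartic_and_resolvent q q' h h' hres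
  obtain ⟨e₁, e₂, e₃⟩ := H L k θ η hθ hη (twoListed_splittingType hL hk)
  exact ⟨L, k, _, _, _, _, hL, hk, e₁, e₂, e₃⟩

/-- The two residues modulo 2 cannot label three primes of degree one. Such types are reached by
counting primes and eliminating the other entries of the list. -/
lemma TwoListed.left_eq_of_three_le_card {D : ℤ} {tk tL : SplittingType} (h : TwoListed D tk tL)
    (hc : 3 ≤ tk.card) : tk = {(1, 1), (1, 1), (1, 1)} := by
  rcases h with h | ⟨h, -⟩ | ⟨rfl, -⟩ | ⟨rfl, -⟩
  · rcases h with ⟨rfl, -⟩ | ⟨rfl, -⟩ | ⟨rfl, -⟩ | ⟨rfl, -⟩ | ⟨rfl, -⟩ <;>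
      first | rfl | exact absurd hc (by decide)
  · rcases h with rfl | rfl | rfl | rfl | rfl <;>
      first | rfl | exact absurd hc (by decide)
  · exact absurd hc (by decide)
  · exact absurd hc (by decide)

lemma TwoListed.right_eq_of_three_le_card {D : ℤ} {tk tL : SplittingType}
    (h : TwoListed D tk tL) (hc : 3 ≤ tL.card) :
    (tk = {(1, 1), (1, 1), (1, 1)} → tL = {(1, 1), (1, 1), (1, 1), (1, 1)}) ∧
      (tk = {(1, 2), (1, 1)} → tL = {(1, 2), (1, 1), (1, 1)}) := by
  rcases h with h | ⟨-, rfl⟩ | ⟨-, rfl⟩ | ⟨-, -, rfl⟩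
  · rcases h with ⟨rfl, rfl⟩ | ⟨rfl, rfl | rfl | rfl | rfl⟩ | ⟨rfl, rfl | rfl | rfl | rfl⟩ |
      ⟨rfl, rfl | rfl | rfl⟩ | ⟨rfl, rfl⟩ <;> revert hc <;> decide
  all_goals exact absurd hc (by decide)

/-- The cubic ring of a binary cubic form congruent to `xy(x + y)` modulo `2`. -/
lemma IsIntegralGenerator.three_le_card_of_cubicForm {k : Type*} [Field k] [NumberField k]
    {η : 𝓞 k} {a b c d B C : ℤ} (h : IsIntegralGenerator η (cubicPoly b B C))
    (hB : B = a * c) (hC : C = a ^ 2 * d)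
    (ha0 : a ≠ 0) (ha : Even a) (hb : Odd b) (hc : Odd c) (hd : Even d) (q q' : ℕ) [Fact q.Prime]
    [Fact q'.Prime] (hq : NoRootsMod q (-c) (b * d) (-(a * d ^ 2)))
    (hq' : NoRootsMod q' (b - c) (a * c + b * d - b * c + 3 * a * d)
      (d * (a + b) ^ 2 - a * (c + d) ^ 2)) : 3 ≤ (splittingType 2 k).card := by
  subst hB hC
  have hk : Module.finrank ℚ k = 3 := by rw [h.finrank, natDegree_cubicPoly]
  have hroot := congrArg (algebraMap (𝓞 k) k) h.root
  rw [aeval_cubicPoly] at hroot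
  simp only [map_add, map_mul, map_pow, map_intCast, map_zero] at hroot
  push_cast at hroot
  have ha' : (a : k) ≠ 0 := Int.cast_ne_zero.2 ha0
  -- With 1, the elements η and x span the ring attached to the binary cubic form with coefficients
  -- a, b, c, d. Their product -ad is even.
  obtain ⟨x, hx⟩ : ∃ x : k, x = ((η : k) ^ 2 + b * η + a * c) / a := ⟨_, rfl⟩
  have hax : a * x = (η : k) ^ 2 + b * η + a * c := by rw [hx]; field_simp
  have hηx : (η : k) * x = -(a * d) := by
    apply mul_left_cancel₀ ha'
    linear_combination (η : k) * hax + hroot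
  have hxx : x ^ 2 = -(d * η) - b * d + c * x := by
    apply mul_left_cancel₀ ha'
    linear_combination x * hax + ((η : k) + b) * hηx
  have hx3 : x ^ 3 + (-c : ℤ) * x ^ 2 + (b * d : ℤ) * x + (-(a * d ^ 2) : ℤ) = 0 := by
    push_cast
    linear_combination x * hxx - d * hηx
  obtain ⟨κ, rfl⟩ := exists_integer_of_root (monic_cubicPoly _ _ _)
    ((aeval_cubicPoly (-c) (b * d) (-(a * d ^ 2)) x).trans hx3)
  have hκ : κ ^ 3 + (-c : ℤ) * κ ^ 2 + (b * d : ℤ) * κ + (-(a * d ^ 2) : ℤ) = 0 := by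
    apply RingOfIntegers.coe_injective
    simpa using hx3
  have hsum : (η + κ) ^ 3 + (b - c : ℤ) * (η + κ) ^ 2 +
      (a * c + b * d - b * c + 3 * a * d : ℤ) * (η + κ) +
      (d * (a + b) ^ 2 - a * (c + d) ^ 2 : ℤ) = 0 := by
    apply RingOfIntegers.coe_injective
    simp only [map_add, map_mul, map_pow, map_intCast, map_zero]
    push_cast
    push_cast at hx3
    linear_combination hroot + hx3 + (3 * (η : k) + 3 * (κ : k) + 2 * (b - c)) * hηx + c * hax +
      b * hxx
  obtain ⟨a', ha'⟩ := ha
  obtain ⟨d', hd'⟩ := hd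
  obtain ⟨b', hb'⟩ := hb
  obtain ⟨c', hc'⟩ := hc
  refine three_le_card_splittingType Nat.prime_two (ν := ((-(a' * d) : ℤ) : 𝓞 k)) h
    (IsIntegralGenerator.of_noRootsMod q hq hk hκ) (IsIntegralGenerator.of_noRootsMod q' hq' hk hsum)
    ?_ ?_ ?_ ?_
  · apply RingOfIntegers.coe_injective
    rw [ha'] at hηx
    simp only [map_mul, map_natCast, map_intCast]
    push_cast at hηx ⊢
    linear_combination hηx
  · rw [eval_cubicPoly, ha', hb']
    exact ⟨1 + b' + a' * c + 2 * a' ^ 2 * d, by push_cast; ring⟩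
  · rw [eval_cubicPoly, ha', hc', hd']
    exact ⟨-c' + b * d' - 4 * a' * d' ^ 2, by push_cast; ring⟩
  · rw [eval_cubicPoly, ha', hd']
    exact ⟨d' * (a' + a' + b) ^ 2 - a' * (c + (d' + d')) ^ 2, by push_cast; ring⟩

/-- The auxiliary element is κ = (θ³ + aθ² + bθ + c)/2, so that θκ = -d/2 is even. `h₁` and `h₂`
supply equations for κ and θ + κ, and the parity conditions place the three primes. -/
lemma IsIntegralGenerator.three_le_card_of_quartic {L : Type} [Field L] [NumberField L]
    {θ : 𝓞 L} {a b c d a₁ b₁ c₁ d₁ a₂ b₂ c₂ d₂ : ℤ}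
    (h : IsIntegralGenerator θ (quarticPoly a b c d)) (q q' : ℕ) [Fact q.Prime]
    [Fact q'.Prime] (hq : NoFactorsMod q a₁ b₁ c₁ d₁) (hq' : NoFactorsMod q' a₂ b₂ c₂ d₂)
    (h₁ : ∀ (F : Type) [Field F] [CharZero F] (t y : F), t ^ 4 + a * t ^ 3 + b * t ^ 2 + c * t + d = 0 →
      y = (t ^ 3 + a * t ^ 2 + b * t + c) / 2 →
      y ^ 4 + a₁ * y ^ 3 + b₁ * y ^ 2 + c₁ * y + d₁ = 0)
    (h₂ : ∀ (F : Type) [Field F] [CharZero F] (t y : F), t ^ 4 + a * t ^ 3 + b * t ^ 2 + c * t + d = 0 →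
      y = t + (t ^ 3 + a * t ^ 2 + b * t + c) / 2 →
      y ^ 4 + a₂ * y ^ 3 + b₂ * y ^ 2 + c₂ * y + d₂ = 0)
    (hd : (4 : ℤ) ∣ d) (e : (2 : ℤ) ∣ 1 + a + b + c + d)
    (e₁ : (2 : ℤ) ∣ 1 + a₁ + b₁ + c₁ + d₁) (e₂ : (2 : ℤ) ∣ d₂) :
    3 ≤ (splittingType 2 L).card := by
  have hL : Module.finrank ℚ L = 4 := by rw [h.finrank, natDegree_quarticPoly]
  have hroot := congrArg (algebraMap (𝓞 L) L) h.root
  rw [aeval_quarticPoly] at hroot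
  simp only [map_add, map_mul, map_pow, map_intCast, map_zero] at hroot
  have hx := h₁ L θ _ hroot rfl
  have hs := h₂ L θ _ hroot rfl
  obtain ⟨κ, hκ⟩ := exists_integer_of_root (monic_quarticPoly _ _ _ _)
    ((aeval_quarticPoly a₁ b₁ c₁ d₁ _).trans hx)
  rw [← hκ] at hx hs
  have hκ' : κ ^ 4 + a₁ * κ ^ 3 + b₁ * κ ^ 2 + c₁ * κ + d₁ = 0 := by
    apply RingOfIntegers.coe_injective
    simpa using hx
  have hs' : (θ + κ) ^ 4 + a₂ * (θ + κ) ^ 3 + b₂ * (θ + κ) ^ 2 + c₂ * (θ + κ) + d₂ = 0 := by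
    apply RingOfIntegers.coe_injective
    simpa using hs
  obtain ⟨d', rfl⟩ := hd
  refine three_le_card_splittingType Nat.prime_two (ν := ((-d' : ℤ) : 𝓞 L)) h
    (IsIntegralGenerator.of_noFactorsMod q hq hL hκ')
    (IsIntegralGenerator.of_noFactorsMod q' hq' hL hs') ?_ ?_ ?_ ?_
  · apply RingOfIntegers.coe_injective
    simp only [map_mul, map_natCast, map_intCast]
    push_cast at hroot ⊢
    linear_combination (θ : L) * hκ + (1 / 2 : L) * hroot
  · rw [eval_quarticPoly]
    refine (dvd_of_eq rfl).trans (e.trans (dvd_of_eq ?_))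
    ring
  · rw [eval_quarticPoly]
    refine (dvd_of_eq rfl).trans (e₁.trans (dvd_of_eq ?_))
    ring
  · rw [eval_quarticPoly]
    refine (dvd_of_eq rfl).trans (e₂.trans (dvd_of_eq ?_))
    ring

end Occurrence

/-! ### Explicit examples for every listed combination. -/

section Examples
set_option linter.unusedSimpArgs false
open Polynomial

/-- The type in `L` determines that in `k`, except for (2²) and (1²1²), which are not admitted here.
-/
lemma OddListed.left_eq {tk tk' tL : SplittingType} (h : OddListed tk tL)
    (hL : (tk' = {(3, 1)} ∧ tL = {(3, 1), (1, 1)}) ∨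
      (tk' = {(2, 1), (1, 1)} ∧ (tL = {(4, 1)} ∨ tL = {(2, 1), (1, 1), (1, 1)})) ∨
      (tk' = {(1, 1), (1, 1), (1, 1)} ∧
        (tL = {(1, 1), (1, 1), (1, 1), (1, 1)} ∨ tL = {(2, 1), (2, 1)})) ∨
      (tk' = {(1, 2), (1, 1)} ∧
        (tL = {(2, 1), (1, 2)} ∨ tL = {(1, 2), (1, 1), (1, 1)} ∨ tL = {(1, 4)})) ∨
      (tk' = {(1, 3)} ∧ tL = {(1, 3), (1, 1)})) : tk = tk' := by
  rcases hL with ⟨rfl, rfl⟩ | ⟨rfl, rfl | rfl⟩ | ⟨rfl, rfl | rfl⟩ | ⟨rfl, rfl | rfl | rfl⟩ |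
    ⟨rfl, rfl⟩ <;> rcases h with ⟨rfl, h⟩ | ⟨rfl, h⟩ | ⟨rfl, h⟩ | ⟨rfl, h⟩ | ⟨rfl, h⟩ <;>
    first | rfl | exact absurd h (by decide)

/-- At 2 the type (1⁴) is ambiguous as well and is dropped. -/
lemma TwoListed.left_eq {D : ℤ} {tk tk' tL : SplittingType} (h : TwoListed D tk tL)
    (hL : (tk' = {(3, 1)} ∧ tL = {(3, 1), (1, 1)}) ∨
      (tk' = {(2, 1), (1, 1)} ∧ (tL = {(4, 1)} ∨ tL = {(2, 1), (1, 1), (1, 1)})) ∨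
      (tk' = {(1, 1), (1, 1), (1, 1)} ∧
        (tL = {(1, 1), (1, 1), (1, 1), (1, 1)} ∨ tL = {(2, 1), (2, 1)})) ∨
      (tk' = {(1, 2), (1, 1)} ∧
        (tL = {(2, 1), (1, 2)} ∨ tL = {(1, 2), (1, 1), (1, 1)})) ∨
      (tk' = {(1, 3)} ∧ tL = {(1, 3), (1, 1)})) : tk = tk' := by
  have key : OddListed tk tL := by
    rcases h with h | ⟨-, h⟩ | ⟨-, h⟩ | ⟨-, -, h⟩
    · exact h
    all_goals
      rcases hL with ⟨rfl, rfl⟩ | ⟨rfl, rfl | rfl⟩ | ⟨rfl, rfl | rfl⟩ | ⟨rfl, rfl | rfl⟩ |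
        ⟨rfl, rfl⟩ <;> exact absurd h (by decide)
  refine key.left_eq ?_
  tauto

lemma occursOdd_three_three_one :
    OccursOdd {(3, 1)} {(3, 1), (1, 1)} :=
  occursOdd_of_generators 3 Nat.prime_three (by norm_num) 5 2
    (a := 0) (b := -1) (c := 1) (d := -3) (by decide +kernel)
    (A := 1) (B := 12) (C := 11) (by decide +kernel)
    (fun F _ _ t h => ⟨t, by
      push_cast at h ⊢
      linear_combination (1) * h⟩)
    (by
      intro L k _ _ _ _ θ η hθ hη hl
      have e₂ : splittingType 3 L = {(3, 1), (1, 1)} := by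
        -- Modulo 3 the quartic is X(X³ + 2X + 1); the last four numbers are the coefficients of the
        -- difference divided by 3.
        rw [hθ.splittingType_of_linear_mul Nat.prime_three (g := cubicPoly 0 2 1) (monic_cubicPoly _ _ _)
          (irreducible_map_cubicPoly (by decide +kernel)) (by rw [natDegree_cubicPoly]; decide) ![0] ![1] 0 (-1) 0 (-1)
          (Polynomial.funext fun x => by
          simp only [quarticPoly, cubicPoly, quadPoly, smallPoly, Fin.prod_univ_succ,
            Fin.prod_univ_zero, Matrix.cons_val_zero, Matrix.cons_val_succ, eval_add, eval_mul,
            eval_pow, eval_X, eval_C, eval_sub, mul_one]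
          push_cast
          ring) (by decide) (by decide) (by decide), natDegree_cubicPoly]
        rfl
      rw [e₂] at hl
      exact ⟨hl.left_eq (by decide), e₂⟩)

lemma occursOdd_two_one_four :
    OccursOdd {(2, 1), (1, 1)} {(4, 1)} :=
  occursOdd_of_generators 3 Nat.prime_three (by norm_num) 2 7
    (a := 0) (b := 0) (c := 1) (d := -1) (by decide +kernel)
    (A := 0) (B := 4) (C := -1) (by decide +kernel)
    (fun F _ _ t h => ⟨t, by
      push_cast at h ⊢
      linear_combination (1) * h⟩)
    (by
      intro L k _ _ _ _ θ η hθ hη hl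
      have e₂ : splittingType 3 L = {(4, 1)} := by
        rw [hθ.splittingType_of_irreducible Nat.prime_three (irreducible_map_quarticPoly (by decide +kernel)), natDegree_quarticPoly]
      rw [e₂] at hl
      exact ⟨hl.left_eq (by decide), e₂⟩)

lemma occursOdd_two_one_two_one_one :
    OccursOdd {(2, 1), (1, 1)} {(2, 1), (1, 1), (1, 1)} :=
  occursOdd_of_generators 3 Nat.prime_three (by norm_num) 2 7
    (a := -1) (b := 1) (c := -1) (d := -3) (by decide +kernel)
    (A := -1) (B := 13) (C := -10) (by decide +kernel)
    (fun F _ _ t h => ⟨t, by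
      push_cast at h ⊢
      linear_combination (1) * h⟩)
    (by
      intro L k _ _ _ _ θ η hθ hη hl
      have e₂ : splittingType 3 L = {(2, 1), (1, 1), (1, 1)} := by
        rw [hθ.splittingType_of_linear_mul Nat.prime_three (g := quadPoly 0 1) (monic_quadPoly _ _)
          (irreducible_map_quadPoly (by decide +kernel)) (by rw [natDegree_quadPoly]; decide) ![0, 1] ![1, 1] 0 0 0 (-1)
          (Polynomial.funext fun x => by
          simp only [quarticPoly, cubicPoly, quadPoly, smallPoly, Fin.prod_univ_succ,
            Fin.prod_univ_zero, Matrix.cons_val_zero, Matrix.cons_val_succ, eval_add, eval_mul,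
            eval_pow, eval_X, eval_C, eval_sub, mul_one]
          push_cast
          ring) (by decide) (by decide) (by decide), natDegree_quadPoly]
        rfl
      rw [e₂] at hl
      exact ⟨hl.left_eq (by decide), e₂⟩)

lemma occursOdd_one_one_one_one_one_one_one :
    OccursOdd {(1, 1), (1, 1), (1, 1)} {(1, 1), (1, 1), (1, 1), (1, 1)} :=
  occursOdd_of_generators 5 Nat.prime_five (by norm_num) 2 11
    (a := -1) (b := 1) (c := -1) (d := -5) (by decide +kernel)
    (A := -1) (B := 21) (C := -16) (by decide +kernel)
    (fun F _ _ t h => ⟨t, by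
      push_cast at h ⊢
      linear_combination (1) * h⟩)
    (by
      intro L k _ _ _ _ θ η hθ hη hl
      have e₂ : splittingType 5 L = {(1, 1), (1, 1), (1, 1), (1, 1)} :=
        (hθ.splittingType_of_linear Nat.prime_five ![0, 1, 2, 3] ![1, 1, 1, 1] 1 (-2) 1 (-1)
        (Polynomial.funext fun x => by
          simp only [quarticPoly, cubicPoly, quadPoly, smallPoly, Fin.prod_univ_succ,
            Fin.prod_univ_zero, Matrix.cons_val_zero, Matrix.cons_val_succ, eval_add, eval_mul,
            eval_pow, eval_X, eval_C, eval_sub, mul_one]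
          push_cast
          ring) (by decide) (by decide) (by decide)).trans rfl
      rw [e₂] at hl
      exact ⟨hl.left_eq (by decide), e₂⟩)

lemma occursOdd_one_one_one_two_two :
    OccursOdd {(1, 1), (1, 1), (1, 1)} {(2, 1), (2, 1)} :=
  occursOdd_of_generators 3 Nat.prime_three (by norm_num) 5 7
    (a := 1) (b := 0) (c := -2) (d := 2) (by decide +kernel)
    (A := 0) (B := -10) (C := -6) (by decide +kernel)
    (fun F _ _ t h => ⟨t, by
      push_cast at h ⊢
      linear_combination (1) * h⟩)
    (by
      intro L k _ _ _ _ θ η hθ hη hl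
      have e₂ : splittingType 3 L = {(2, 1), (2, 1)} :=
        hθ.splittingType_of_quad_mul_quad Nat.prime_three
        (a := 0) (b := 1) (a' := 1) (b' := 2) (by decide +kernel) (by decide +kernel)
        (by decide) 0 (-1) (-1) 0 (Polynomial.funext fun x => by
          simp only [quarticPoly, cubicPoly, quadPoly, smallPoly, Fin.prod_univ_succ,
            Fin.prod_univ_zero, Matrix.cons_val_zero, Matrix.cons_val_succ, eval_add, eval_mul,
            eval_pow, eval_X, eval_C, eval_sub, mul_one]
          push_cast
          ring)
      rw [e₂] at hl
      exact ⟨hl.left_eq (by decide), e₂⟩)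

lemma occursOdd_one_sq_one_two_one_sq :
    OccursOdd {(1, 2), (1, 1)} {(2, 1), (1, 2)} :=
  occursOdd_of_generators 3 Nat.prime_three (by norm_num) 5 2
    (a := -3) (b := 1) (c := 0) (d := -3) (by decide +kernel)
    (A := -1) (B := 12) (C := 15) (by decide +kernel)
    (fun F _ _ t h => ⟨t, by
      push_cast at h ⊢
      linear_combination (1) * h⟩)
    (by
      intro L k _ _ _ _ θ η hθ hη hl
      have e₂ : splittingType 3 L = {(2, 1), (1, 2)} := by
        rw [hθ.splittingType_of_linear_mul Nat.prime_three (g := quadPoly 0 1) (monic_quadPoly _ _)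
          (irreducible_map_quadPoly (by decide +kernel)) (by rw [natDegree_quadPoly]; decide) ![0] ![2] (-1) 0 0 (-1)
          (Polynomial.funext fun x => by
          simp only [quarticPoly, cubicPoly, quadPoly, smallPoly, Fin.prod_univ_succ,
            Fin.prod_univ_zero, Matrix.cons_val_zero, Matrix.cons_val_succ, eval_add, eval_mul,
            eval_pow, eval_X, eval_C, eval_sub, mul_one]
          push_cast
          ring) (by decide) (by decide) (by decide), natDegree_quadPoly]
        rfl
      rw [e₂] at hl
      exact ⟨hl.left_eq (by decide), e₂⟩)

lemma occursOdd_one_sq_one_one_sq_one_one :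
    OccursOdd {(1, 2), (1, 1)} {(1, 2), (1, 1), (1, 1)} :=
  occursOdd_of_generators 3 Nat.prime_three (by norm_num) 2 5
    (a := -3) (b := 2) (c := 0) (d := -3) (by decide +kernel)
    (A := -2) (B := 12) (C := 3) (by decide +kernel)
    (fun F _ _ t h => ⟨t, by
      push_cast at h ⊢
      linear_combination (1) * h⟩)
    (by
      intro L k _ _ _ _ θ η hθ hη hl
      have e₂ : splittingType 3 L = {(1, 2), (1, 1), (1, 1)} :=
        (hθ.splittingType_of_linear Nat.prime_three ![0, 1, -1] ![2, 1, 1] (-1) 1 0 (-1)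
        (Polynomial.funext fun x => by
          simp only [quarticPoly, cubicPoly, quadPoly, smallPoly, Fin.prod_univ_succ,
            Fin.prod_univ_zero, Matrix.cons_val_zero, Matrix.cons_val_succ, eval_add, eval_mul,
            eval_pow, eval_X, eval_C, eval_sub, mul_one]
          push_cast
          ring) (by decide) (by decide) (by decide)).trans rfl
      rw [e₂] at hl
      exact ⟨hl.left_eq (by decide), e₂⟩)

lemma occursOdd_one_sq_one_one_pow_four :
    OccursOdd {(1, 2), (1, 1)} {(1, 4)} :=
  occursOdd_of_generators 3 Nat.prime_three (by norm_num) 2 11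
    (a := -3) (b := 0) (c := 0) (d := -3) (by decide +kernel)
    (A := 0) (B := 12) (C := 27) (by decide +kernel)
    (fun F _ _ t h => ⟨t, by
      push_cast at h ⊢
      linear_combination (1) * h⟩)
    (by
      intro L k _ _ _ _ θ η hθ hη hl
      have e₂ : splittingType 3 L = {(1, 4)} :=
        (hθ.splittingType_of_linear Nat.prime_three ![0] ![4] (-1) 0 0 (-1)
        (Polynomial.funext fun x => by
          simp only [quarticPoly, cubicPoly, quadPoly, smallPoly, Fin.prod_univ_succ,
            Fin.prod_univ_zero, Matrix.cons_val_zero, Matrix.cons_val_succ, eval_add, eval_mul,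
            eval_pow, eval_X, eval_C, eval_sub, mul_one]
          push_cast
          ring) (by decide) (by decide) (by decide)).trans rfl
      rw [e₂] at hl
      exact ⟨hl.left_eq (by decide), e₂⟩)

lemma occursOdd_one_cube_one_cube_one :
    OccursOdd {(1, 3)} {(1, 3), (1, 1)} :=
  occursOdd_of_generators 3 Nat.prime_three (by norm_num) 2 5
    (a := -1) (b := 0) (c := 0) (d := 3) (by decide +kernel)
    (A := 0) (B := -12) (C := -3) (by decide +kernel)
    (fun F _ _ t h => ⟨t, by
      push_cast at h ⊢
      linear_combination (1) * h⟩)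
    (by
      intro L k _ _ _ _ θ η hθ hη hl
      have e₂ : splittingType 3 L = {(1, 3), (1, 1)} :=
        (hθ.splittingType_of_linear Nat.prime_three ![0, 1] ![3, 1] 0 0 0 1
        (Polynomial.funext fun x => by
          simp only [quarticPoly, cubicPoly, quadPoly, smallPoly, Fin.prod_univ_succ,
            Fin.prod_univ_zero, Matrix.cons_val_zero, Matrix.cons_val_succ, eval_add, eval_mul,
            eval_pow, eval_X, eval_C, eval_sub, mul_one]
          push_cast
          ring) (by decide) (by decide) (by decide)).trans rfl
      rw [e₂] at hl
      exact ⟨hl.left_eq (by decide), e₂⟩)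

/-- The type (2²) leaves the type in `k` open, so both are computed. The resolvent cubic has the
discriminant of the quartic, which 3 divides since it ramifies in `L`; as 3 is unramified in `k`, it
divides the index of the order generated by the resolvent root. This explains the denominators 3 in
the substitution. -/
lemma occursOdd_two_one_two_sq :
    OccursOdd {(2, 1), (1, 1)} {(2, 2)} :=
  occursOdd_of_generators 3 Nat.prime_three (by norm_num) 5 2
    (a := -3) (b := -1) (c := 0) (d := 1) (by decide +kernel)
    (A := 3) (B := 10) (C := -9) (by decide +kernel)
    (fun F _ _ t h => ⟨-(1 / 3 * t ^ 2) + t + 1 / 3, by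
      push_cast at h ⊢
      linear_combination (-(1 / 27 * t ^ 3) + 10 / 27 * t ^ 2 - 29 / 27 * t + 11 / 27) * h⟩)
    (by
      intro L k _ _ _ _ θ η hθ hη hl
      have e₂ : splittingType 3 L = {(2, 2)} :=
        hθ.splittingType_of_quad_sq Nat.prime_three (a := 0) (b := 1)
        (by decide +kernel) (C (-1) * X + C (-1)) 1 1 (by decide) (Polynomial.funext fun x => by
          simp only [quarticPoly, cubicPoly, quadPoly, smallPoly, Fin.prod_univ_succ,
            Fin.prod_univ_zero, Matrix.cons_val_zero, Matrix.cons_val_succ, eval_add, eval_mul,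
            eval_pow, eval_X, eval_C, eval_sub, mul_one]
          push_cast
          ring)
      have e₁ : splittingType 3 k = {(2, 1), (1, 1)} := by
        rw [hη.splittingType_of_linear_mul Nat.prime_three (g := quadPoly 0 1) (monic_quadPoly _ _)
          (irreducible_map_quadPoly (by decide +kernel)) (by rw [natDegree_quadPoly]; decide) ![0] ![1] 0 1 3 (-3)
          (Polynomial.funext fun x => by
          simp only [quarticPoly, cubicPoly, quadPoly, smallPoly, Fin.prod_univ_succ,
            Fin.prod_univ_zero, Matrix.cons_val_zero, Matrix.cons_val_succ, eval_add, eval_mul,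
            eval_pow, eval_X, eval_C, eval_sub, mul_one]
          push_cast
          ring) (by decide) (by decide) (by decide), natDegree_quadPoly]
        rfl
      exact ⟨e₁, e₂⟩)

lemma occursOdd_two_one_one_sq_one_sq :
    OccursOdd {(2, 1), (1, 1)} {(1, 2), (1, 2)} :=
  occursOdd_of_generators 3 Nat.prime_three (by norm_num) 7 2
    (a := 1) (b := 1) (c := 0) (d := 3) (by decide +kernel)
    (A := 12) (B := 37) (C := 33) (by decide +kernel)
    (fun F _ _ t h => ⟨-(1 / 3 * t ^ 2) - 2 / 3 * t - 1, by
      push_cast at h ⊢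
      linear_combination (-(1 / 27 * t ^ 3) - 7 / 27 * t ^ 2 - 4 / 27 * t + 7 / 9) * h⟩)
    (by
      intro L k _ _ _ _ θ η hθ hη hl
      have e₂ : splittingType 3 L = {(1, 2), (1, 2)} :=
        (hθ.splittingType_of_linear Nat.prime_three ![0, 1] ![2, 2] 1 0 0 1
        (Polynomial.funext fun x => by
          simp only [quarticPoly, cubicPoly, quadPoly, smallPoly, Fin.prod_univ_succ,
            Fin.prod_univ_zero, Matrix.cons_val_zero, Matrix.cons_val_succ, eval_add, eval_mul,
            eval_pow, eval_X, eval_C, eval_sub, mul_one]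
          push_cast
          ring) (by decide) (by decide) (by decide)).trans rfl
      have e₁ : splittingType 3 k = {(2, 1), (1, 1)} := by
        rw [hη.splittingType_of_linear_mul Nat.prime_three (g := quadPoly 0 1) (monic_quadPoly _ _)
          (irreducible_map_quadPoly (by decide +kernel)) (by rw [natDegree_quadPoly]; decide) ![0] ![1] 0 4 12 11
          (Polynomial.funext fun x => by
          simp only [quarticPoly, cubicPoly, quadPoly, smallPoly, Fin.prod_univ_succ,
            Fin.prod_univ_zero, Matrix.cons_val_zero, Matrix.cons_val_succ, eval_add, eval_mul,
            eval_pow, eval_X, eval_C, eval_sub, mul_one]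
          push_cast
          ring) (by decide) (by decide) (by decide), natDegree_quadPoly]
        rfl
      exact ⟨e₁, e₂⟩)

lemma occursOdd_one_one_one_two_sq :
    OccursOdd {(1, 1), (1, 1), (1, 1)} {(2, 2)} :=
  occursOdd_of_generators 3 Nat.prime_three (by norm_num) 7 2
    (a := 0) (b := -1) (c := -3) (d := -2) (by decide +kernel)
    (A := -6) (B := 11) (C := -3) (by decide +kernel)
    (fun F _ _ t h => ⟨-(1 / 3 * t ^ 2) + 1 / 3, by
      push_cast at h ⊢
      linear_combination (-(1 / 27 * t ^ 3) + 1 / 27 * t ^ 2 - 8 / 27 * t - 1 / 27) * h⟩)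
    (by
      intro L k _ _ _ _ θ η hθ hη hl
      have e₂ : splittingType 3 L = {(2, 2)} :=
        hθ.splittingType_of_quad_sq Nat.prime_three (a := 0) (b := 1)
        (by decide +kernel) (C 0 * X + C (-1)) (-1) 0 (by decide) (Polynomial.funext fun x => by
          simp only [quarticPoly, cubicPoly, quadPoly, smallPoly, Fin.prod_univ_succ,
            Fin.prod_univ_zero, Matrix.cons_val_zero, Matrix.cons_val_succ, eval_add, eval_mul,
            eval_pow, eval_X, eval_C, eval_sub, mul_one]
          push_cast
          ring)
      have e₁ : splittingType 3 k = {(1, 1), (1, 1), (1, 1)} :=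
        (hη.splittingType_of_linear Nat.prime_three ![0, 1, -1] ![1, 1, 1] 0 (-2) 4 (-1)
        (Polynomial.funext fun x => by
          simp only [quarticPoly, cubicPoly, quadPoly, smallPoly, Fin.prod_univ_succ,
            Fin.prod_univ_zero, Matrix.cons_val_zero, Matrix.cons_val_succ, eval_add, eval_mul,
            eval_pow, eval_X, eval_C, eval_sub, mul_one]
          push_cast
          ring) (by decide) (by decide) (by decide)).trans rfl
      exact ⟨e₁, e₂⟩)

lemma occursOdd_one_one_one_one_sq_one_sq :
    OccursOdd {(1, 1), (1, 1), (1, 1)} {(1, 2), (1, 2)} :=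
  occursOdd_of_generators 3 Nat.prime_three (by norm_num) 2 5
    (a := 1) (b := -2) (c := 0) (d := -3) (by decide +kernel)
    (A := -6) (B := -1) (C := 42) (by decide +kernel)
    (fun F _ _ t h => ⟨-(1 / 3 * t ^ 2) + 1 / 3 * t, by
      push_cast at h ⊢
      linear_combination (-(1 / 27 * t ^ 3) + 5 / 27 * t ^ 2 - 19 / 27 * t + 14 / 9) * h⟩)
    (by
      intro L k _ _ _ _ θ η hθ hη hl
      have e₂ : splittingType 3 L = {(1, 2), (1, 2)} :=
        (hθ.splittingType_of_linear Nat.prime_three ![0, 1] ![2, 2] 1 (-1) 0 (-1)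
        (Polynomial.funext fun x => by
          simp only [quarticPoly, cubicPoly, quadPoly, smallPoly, Fin.prod_univ_succ,
            Fin.prod_univ_zero, Matrix.cons_val_zero, Matrix.cons_val_succ, eval_add, eval_mul,
            eval_pow, eval_X, eval_C, eval_sub, mul_one]
          push_cast
          ring) (by decide) (by decide) (by decide)).trans rfl
      have e₁ : splittingType 3 k = {(1, 1), (1, 1), (1, 1)} :=
        (hη.splittingType_of_linear Nat.prime_three ![0, 1, -1] ![1, 1, 1] 0 (-2) 0 14
        (Polynomial.funext fun x => by
          simp only [quarticPoly, cubicPoly, quadPoly, smallPoly, Fin.prod_univ_succ,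
            Fin.prod_univ_zero, Matrix.cons_val_zero, Matrix.cons_val_succ, eval_add, eval_mul,
            eval_pow, eval_X, eval_C, eval_sub, mul_one]
          push_cast
          ring) (by decide) (by decide) (by decide)).trans rfl
      exact ⟨e₁, e₂⟩)

/-- When 2 is not (1²1) in `k`, the congruence for the discriminant is void, so `d` stays arbitrary.
-/
lemma occursTwo_three_three_one (d : ℤ) :
    OccursTwo d {(3, 1)} {(3, 1), (1, 1)} :=
  occursTwo_of_generators 5 2
    (a := 0) (b := -1) (c := -1) (d := -2) (by decide +kernel)
    (A := 1) (B := 8) (C := 7) (by decide +kernel)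
    (fun F _ _ t h => ⟨t, by
      push_cast at h ⊢
      linear_combination (1) * h⟩)
    (by
      intro L k _ _ _ _ θ η hθ hη hl
      have e₂ : splittingType 2 L = {(3, 1), (1, 1)} := by
        rw [hθ.splittingType_of_linear_mul Nat.prime_two (g := cubicPoly 0 1 1) (monic_cubicPoly _ _ _)
          (irreducible_map_cubicPoly (by decide +kernel)) (by rw [natDegree_cubicPoly]; decide) ![0] ![1] 0 (-1) (-1) (-1)
          (Polynomial.funext fun x => by
          simp only [quarticPoly, cubicPoly, quadPoly, smallPoly, Fin.prod_univ_succ,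
            Fin.prod_univ_zero, Matrix.cons_val_zero, Matrix.cons_val_succ, eval_add, eval_mul,
            eval_pow, eval_X, eval_C, eval_sub, mul_one]
          push_cast
          ring) (by decide) (by decide) (by decide), natDegree_cubicPoly]
        rfl
      rw [e₂] at hl
      exact ⟨hl.left_eq (by decide), e₂, fun e => absurd e (by decide)⟩)

lemma occursTwo_two_one_four (d : ℤ) :
    OccursTwo d {(2, 1), (1, 1)} {(4, 1)} :=
  occursTwo_of_generators 2 7
    (a := 0) (b := 0) (c := -1) (d := -1) (by decide +kernel)
    (A := 0) (B := 4) (C := -1) (by decide +kernel)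
    (fun F _ _ t h => ⟨t, by
      push_cast at h ⊢
      linear_combination (1) * h⟩)
    (by
      intro L k _ _ _ _ θ η hθ hη hl
      have e₂ : splittingType 2 L = {(4, 1)} := by
        rw [hθ.splittingType_of_irreducible Nat.prime_two (irreducible_map_quarticPoly (by decide +kernel)), natDegree_quarticPoly]
      rw [e₂] at hl
      exact ⟨hl.left_eq (by decide), e₂, fun e => absurd e (by decide)⟩)

lemma occursTwo_two_one_two_one_one (d : ℤ) :
    OccursTwo d {(2, 1), (1, 1)} {(2, 1), (1, 1), (1, 1)} :=
  occursTwo_of_generators 3 5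
    (a := 0) (b := 0) (c := -1) (d := 2) (by decide +kernel)
    (A := 0) (B := -8) (C := -1) (by decide +kernel)
    (fun F _ _ t h => ⟨t, by
      push_cast at h ⊢
      linear_combination (1) * h⟩)
    (by
      intro L k _ _ _ _ θ η hθ hη hl
      have e₂ : splittingType 2 L = {(2, 1), (1, 1), (1, 1)} := by
        rw [hθ.splittingType_of_linear_mul Nat.prime_two (g := quadPoly 1 1) (monic_quadPoly _ _)
          (irreducible_map_quadPoly (by decide +kernel)) (by rw [natDegree_quadPoly]; decide) ![0, 1] ![1, 1] 0 0 0 1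
          (Polynomial.funext fun x => by
          simp only [quarticPoly, cubicPoly, quadPoly, smallPoly, Fin.prod_univ_succ,
            Fin.prod_univ_zero, Matrix.cons_val_zero, Matrix.cons_val_succ, eval_add, eval_mul,
            eval_pow, eval_X, eval_C, eval_sub, mul_one]
          push_cast
          ring) (by decide) (by decide) (by decide), natDegree_quadPoly]
        rfl
      rw [e₂] at hl
      exact ⟨hl.left_eq (by decide), e₂, fun e => absurd e (by decide)⟩)

lemma occursTwo_one_cube_one_cube_one (d : ℤ) :
    OccursTwo d {(1, 3)} {(1, 3), (1, 1)} :=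
  occursTwo_of_generators 3 7
    (a := -1) (b := 0) (c := 0) (d := 2) (by decide +kernel)
    (A := 0) (B := -8) (C := -2) (by decide +kernel)
    (fun F _ _ t h => ⟨t, by
      push_cast at h ⊢
      linear_combination (1) * h⟩)
    (by
      intro L k _ _ _ _ θ η hθ hη hl
      have e₂ : splittingType 2 L = {(1, 3), (1, 1)} :=
        (hθ.splittingType_of_linear Nat.prime_two ![0, 1] ![3, 1] 0 0 0 1
        (Polynomial.funext fun x => by
          simp only [quarticPoly, cubicPoly, quadPoly, smallPoly, Fin.prod_univ_succ,
            Fin.prod_univ_zero, Matrix.cons_val_zero, Matrix.cons_val_succ, eval_add, eval_mul,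
            eval_pow, eval_X, eval_C, eval_sub, mul_one]
          push_cast
          ring) (by decide) (by decide) (by decide)).trans rfl
      rw [e₂] at hl
      exact ⟨hl.left_eq (by decide), e₂, fun e => absurd e (by decide)⟩)

/-- Since (1⁴) is compatible with every type in `k`, the latter is computed from a second
polynomial, obtained by halving the resolvent root. -/
lemma occursTwo_three_one_pow_four (d : ℤ) :
    OccursTwo d {(3, 1)} {(1, 4)} :=
  occursTwo_of_generators 3 2
    (a := -2) (b := -2) (c := 0) (d := -2) (by decide +kernel)
    (A := 2) (B := 3) (C := -1) (by decide +kernel)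
    (fun F _ _ t h => ⟨-(1 / 2 * t) - 1, by
      push_cast at h ⊢
      linear_combination (-1 / 8) * h⟩)
    (by
      intro L k _ _ _ _ θ η hθ hη hl
      have e₂ : splittingType 2 L = {(1, 4)} :=
        (hθ.splittingType_of_linear Nat.prime_two ![0] ![4] (-1) (-1) 0 (-1)
        (Polynomial.funext fun x => by
          simp only [quarticPoly, cubicPoly, quadPoly, smallPoly, Fin.prod_univ_succ,
            Fin.prod_univ_zero, Matrix.cons_val_zero, Matrix.cons_val_succ, eval_add, eval_mul,
            eval_pow, eval_X, eval_C, eval_sub, mul_one]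
          push_cast
          ring) (by decide) (by decide) (by decide)).trans rfl
      have e₁ : splittingType 2 k = {(3, 1)} := by
        rw [hη.splittingType_of_irreducible Nat.prime_two (irreducible_map_cubicPoly (by decide +kernel)), natDegree_cubicPoly]
      exact ⟨e₁, e₂, fun e => absurd e (by decide)⟩)

lemma occursTwo_two_one_two_sq (d : ℤ) :
    OccursTwo d {(2, 1), (1, 1)} {(2, 2)} :=
  occursTwo_of_generators 5 3
    (a := -2) (b := -3) (c := 0) (d := 1) (by decide +kernel)
    (A := 5) (B := 9) (C := 4) (by decide +kernel)
    (fun F _ _ t h => ⟨-(1 / 4 * t ^ 2) + 1 / 4 * t, by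
      push_cast at h ⊢
      linear_combination (-(1 / 64 * t ^ 3) + 3 / 32 * t ^ 2 - 5 / 64 * t - 1 / 4) * h⟩)
    (by
      intro L k _ _ _ _ θ η hθ hη hl
      have e₂ : splittingType 2 L = {(2, 2)} :=
        hθ.splittingType_of_quad_sq Nat.prime_two (a := 1) (b := 1)
        (by decide +kernel) (C (-2) * X + C (-1)) 2 1 (by decide) (Polynomial.funext fun x => by
          simp only [quarticPoly, cubicPoly, quadPoly, smallPoly, Fin.prod_univ_succ,
            Fin.prod_univ_zero, Matrix.cons_val_zero, Matrix.cons_val_succ, eval_add, eval_mul,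
            eval_pow, eval_X, eval_C, eval_sub, mul_one]
          push_cast
          ring)
      have e₁ : splittingType 2 k = {(2, 1), (1, 1)} := by
        rw [hη.splittingType_of_linear_mul Nat.prime_two (g := quadPoly 1 1) (monic_quadPoly _ _)
          (irreducible_map_quadPoly (by decide +kernel)) (by rw [natDegree_quadPoly]; decide) ![0] ![1] 0 2 4 2
          (Polynomial.funext fun x => by
          simp only [quarticPoly, cubicPoly, quadPoly, smallPoly, Fin.prod_univ_succ,
            Fin.prod_univ_zero, Matrix.cons_val_zero, Matrix.cons_val_succ, eval_add, eval_mul,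
            eval_pow, eval_X, eval_C, eval_sub, mul_one]
          push_cast
          ring) (by decide) (by decide) (by decide), natDegree_quadPoly]
        rfl
      exact ⟨e₁, e₂, fun e => absurd e (by decide)⟩)

lemma occursTwo_two_one_one_sq_one_sq (d : ℤ) :
    OccursTwo d {(2, 1), (1, 1)} {(1, 2), (1, 2)} :=
  occursTwo_of_generators 5 3
    (a := -2) (b := -1) (c := -2) (d := 2) (by decide +kernel)
    (A := 1) (B := 5) (C := 4) (by decide +kernel)
    (fun F _ _ t h => ⟨-(1 / 4 * t ^ 2) + 1 / 4 * t + 1 / 2, by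
      push_cast at h ⊢
      linear_combination (-(1 / 64 * t ^ 3) + 1 / 16 * t ^ 2 - 1 / 64 * t - 11 / 32) * h⟩)
    (by
      intro L k _ _ _ _ θ η hθ hη hl
      have e₂ : splittingType 2 L = {(1, 2), (1, 2)} :=
        (hθ.splittingType_of_linear Nat.prime_two ![0, 1] ![2, 2] 0 (-1) (-1) 1
        (Polynomial.funext fun x => by
          simp only [quarticPoly, cubicPoly, quadPoly, smallPoly, Fin.prod_univ_succ,
            Fin.prod_univ_zero, Matrix.cons_val_zero, Matrix.cons_val_succ, eval_add, eval_mul,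
            eval_pow, eval_X, eval_C, eval_sub, mul_one]
          push_cast
          ring) (by decide) (by decide) (by decide)).trans rfl
      have e₁ : splittingType 2 k = {(2, 1), (1, 1)} := by
        rw [hη.splittingType_of_linear_mul Nat.prime_two (g := quadPoly 1 1) (monic_quadPoly _ _)
          (irreducible_map_quadPoly (by decide +kernel)) (by rw [natDegree_quadPoly]; decide) ![0] ![1] 0 0 2 2
          (Polynomial.funext fun x => by
          simp only [quarticPoly, cubicPoly, quadPoly, smallPoly, Fin.prod_univ_succ,
            Fin.prod_univ_zero, Matrix.cons_val_zero, Matrix.cons_val_succ, eval_add, eval_mul,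
            eval_pow, eval_X, eval_C, eval_sub, mul_one]
          push_cast
          ring) (by decide) (by decide) (by decide), natDegree_quadPoly]
        rfl
      exact ⟨e₁, e₂, fun e => absurd e (by decide)⟩)

lemma occursTwo_two_one_one_pow_four (d : ℤ) :
    OccursTwo d {(2, 1), (1, 1)} {(1, 4)} :=
  occursTwo_of_generators 5 3
    (a := -2) (b := -4) (c := 0) (d := 2) (by decide +kernel)
    (A := 1) (B := -3) (C := 2) (by decide +kernel)
    (fun F _ _ t h => ⟨-(1 / 2 * t) - 1, by
      push_cast at h ⊢
      linear_combination (-1 / 8) * h⟩)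
    (by
      intro L k _ _ _ _ θ η hθ hη hl
      have e₂ : splittingType 2 L = {(1, 4)} :=
        (hθ.splittingType_of_linear Nat.prime_two ![0] ![4] (-1) (-2) 0 1
        (Polynomial.funext fun x => by
          simp only [quarticPoly, cubicPoly, quadPoly, smallPoly, Fin.prod_univ_succ,
            Fin.prod_univ_zero, Matrix.cons_val_zero, Matrix.cons_val_succ, eval_add, eval_mul,
            eval_pow, eval_X, eval_C, eval_sub, mul_one]
          push_cast
          ring) (by decide) (by decide) (by decide)).trans rfl
      have e₁ : splittingType 2 k = {(2, 1), (1, 1)} := by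
        rw [hη.splittingType_of_linear_mul Nat.prime_two (g := quadPoly 1 1) (monic_quadPoly _ _)
          (irreducible_map_quadPoly (by decide +kernel)) (by rw [natDegree_quadPoly]; decide) ![0] ![1] 0 0 (-2) 1
          (Polynomial.funext fun x => by
          simp only [quarticPoly, cubicPoly, quadPoly, smallPoly, Fin.prod_univ_succ,
            Fin.prod_univ_zero, Matrix.cons_val_zero, Matrix.cons_val_succ, eval_add, eval_mul,
            eval_pow, eval_X, eval_C, eval_sub, mul_one]
          push_cast
          ring) (by decide) (by decide) (by decide), natDegree_quadPoly]
        rfl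
      exact ⟨e₁, e₂, fun e => absurd e (by decide)⟩)

lemma occursTwo_one_cube_one_pow_four (d : ℤ) :
    OccursTwo d {(1, 3)} {(1, 4)} :=
  occursTwo_of_generators 7 3
    (a := 0) (b := 0) (c := -2) (d := -2) (by decide +kernel)
    (A := -8) (B := 16) (C := 2) (by decide +kernel)
    (fun F _ _ t h => ⟨-(1 / 2 * t ^ 2), by
      push_cast at h ⊢
      linear_combination (-(1 / 8 * t ^ 3) - t - 1 / 2) * h⟩)
    (by
      intro L k _ _ _ _ θ η hθ hη hl
      have e₂ : splittingType 2 L = {(1, 4)} :=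
        (hθ.splittingType_of_linear Nat.prime_two ![0] ![4] 0 0 (-1) (-1)
        (Polynomial.funext fun x => by
          simp only [quarticPoly, cubicPoly, quadPoly, smallPoly, Fin.prod_univ_succ,
            Fin.prod_univ_zero, Matrix.cons_val_zero, Matrix.cons_val_succ, eval_add, eval_mul,
            eval_pow, eval_X, eval_C, eval_sub, mul_one]
          push_cast
          ring) (by decide) (by decide) (by decide)).trans rfl
      have e₁ : splittingType 2 k = {(1, 3)} :=
        (hη.splittingType_of_linear Nat.prime_two ![0] ![3] 0 (-4) 8 1
        (Polynomial.funext fun x => by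
          simp only [quarticPoly, cubicPoly, quadPoly, smallPoly, Fin.prod_univ_succ,
            Fin.prod_univ_zero, Matrix.cons_val_zero, Matrix.cons_val_succ, eval_add, eval_mul,
            eval_pow, eval_X, eval_C, eval_sub, mul_one]
          push_cast
          ring) (by decide) (by decide) (by decide)).trans rfl
      exact ⟨e₁, e₂, fun e => absurd e (by decide)⟩)

lemma occursTwo_one_sq_one_two_one_sq_zero :
    OccursTwo 0 {(1, 2), (1, 1)} {(2, 1), (1, 2)} :=
  occursTwo_of_generators 7 5
    (a := -1) (b := -1) (c := -2) (d := -2) (by decide +kernel)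
    (A := -1) (B := 10) (C := -6) (by decide +kernel)
    (fun F _ _ t h => ⟨-t, by
      push_cast at h ⊢
      linear_combination (-1) * h⟩)
    (by
      intro L k _ _ _ _ θ η hθ hη hl
      have e₂ : splittingType 2 L = {(2, 1), (1, 2)} := by
        rw [hθ.splittingType_of_linear_mul Nat.prime_two (g := quadPoly 1 1) (monic_quadPoly _ _)
          (irreducible_map_quadPoly (by decide +kernel)) (by rw [natDegree_quadPoly]; decide) ![0] ![2] (-1) (-1) (-1) (-1)
          (Polynomial.funext fun x => by
          simp only [quarticPoly, cubicPoly, quadPoly, smallPoly, Fin.prod_univ_succ,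
            Fin.prod_univ_zero, Matrix.cons_val_zero, Matrix.cons_val_succ, eval_add, eval_mul,
            eval_pow, eval_X, eval_C, eval_sub, mul_one]
          push_cast
          ring) (by decide) (by decide) (by decide), natDegree_quadPoly]
        rfl
      have e₁ : splittingType 2 k = {(1, 2), (1, 1)} :=
        (hη.splittingType_of_linear Nat.prime_two ![0, 1] ![2, 1] 0 0 5 (-3)
        (Polynomial.funext fun x => by
          simp only [quarticPoly, cubicPoly, quadPoly, smallPoly, Fin.prod_univ_succ,
            Fin.prod_univ_zero, Matrix.cons_val_zero, Matrix.cons_val_succ, eval_add, eval_mul,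
            eval_pow, eval_X, eval_C, eval_sub, mul_one]
          push_cast
          ring) (by decide) (by decide) (by decide)).trans rfl
      -- The discriminant of the cubic is 2³·(-477); the odd exponent gives residue 0 modulo 8.
      exact ⟨e₁, e₂, fun _ => hη.discr_emod_eight e₁ (j := 3) (u := -477) (by decide) (by decide)⟩)

lemma occursTwo_one_sq_one_one_pow_four_zero :
    OccursTwo 0 {(1, 2), (1, 1)} {(1, 4)} :=
  occursTwo_of_generators 3 7
    (a := -4) (b := -2) (c := 0) (d := -2) (by decide +kernel)
    (A := -1) (B := 2) (C := -6) (by decide +kernel)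
    (fun F _ _ t h => ⟨-(1 / 2 * t), by
      push_cast at h ⊢
      linear_combination (-1 / 8) * h⟩)
    (by
      intro L k _ _ _ _ θ η hθ hη hl
      have e₂ : splittingType 2 L = {(1, 4)} :=
        (hθ.splittingType_of_linear Nat.prime_two ![0] ![4] (-2) (-1) 0 (-1)
        (Polynomial.funext fun x => by
          simp only [quarticPoly, cubicPoly, quadPoly, smallPoly, Fin.prod_univ_succ,
            Fin.prod_univ_zero, Matrix.cons_val_zero, Matrix.cons_val_succ, eval_add, eval_mul,
            eval_pow, eval_X, eval_C, eval_sub, mul_one]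
          push_cast
          ring) (by decide) (by decide) (by decide)).trans rfl
      have e₁ : splittingType 2 k = {(1, 2), (1, 1)} :=
        (hη.splittingType_of_linear Nat.prime_two ![0, 1] ![2, 1] 0 0 1 (-3)
        (Polynomial.funext fun x => by
          simp only [quarticPoly, cubicPoly, quadPoly, smallPoly, Fin.prod_univ_succ,
            Fin.prod_univ_zero, Matrix.cons_val_zero, Matrix.cons_val_succ, eval_add, eval_mul,
            eval_pow, eval_X, eval_C, eval_sub, mul_one]
          push_cast
          ring) (by decide) (by decide) (by decide)).trans rfl
      exact ⟨e₁, e₂, fun _ => hη.discr_emod_eight e₁ (j := 3) (u := -101) (by decide) (by decide)⟩)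

lemma occursTwo_one_sq_one_one_sq_one_sq_zero :
    OccursTwo 0 {(1, 2), (1, 1)} {(1, 2), (1, 2)} :=
  occursTwo_of_generators 3 7
    (a := 0) (b := 1) (c := -2) (d := -2) (by decide +kernel)
    (A := -5) (B := 6) (C := 18) (by decide +kernel)
    (fun F _ _ t h => ⟨-(1 / 2 * t ^ 2) + 1 / 2 * t - 1, by
      push_cast at h ⊢
      linear_combination (-(1 / 8 * t ^ 3) + 1 / 4 * t ^ 2 - 9 / 8 * t - 1 / 2) * h⟩)
    (by
      intro L k _ _ _ _ θ η hθ hη hl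
      have e₂ : splittingType 2 L = {(1, 2), (1, 2)} :=
        (hθ.splittingType_of_linear Nat.prime_two ![0, 1] ![2, 2] 1 0 (-1) (-1)
        (Polynomial.funext fun x => by
          simp only [quarticPoly, cubicPoly, quadPoly, smallPoly, Fin.prod_univ_succ,
            Fin.prod_univ_zero, Matrix.cons_val_zero, Matrix.cons_val_succ, eval_add, eval_mul,
            eval_pow, eval_X, eval_C, eval_sub, mul_one]
          push_cast
          ring) (by decide) (by decide) (by decide)).trans rfl
      have e₁ : splittingType 2 k = {(1, 2), (1, 1)} :=
        (hη.splittingType_of_linear Nat.prime_two ![0, 1] ![2, 1] 0 (-2) 3 9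
        (Polynomial.funext fun x => by
          simp only [quarticPoly, cubicPoly, quadPoly, smallPoly, Fin.prod_univ_succ,
            Fin.prod_univ_zero, Matrix.cons_val_zero, Matrix.cons_val_succ, eval_add, eval_mul,
            eval_pow, eval_X, eval_C, eval_sub, mul_one]
          push_cast
          ring) (by decide) (by decide) (by decide)).trans rfl
      exact ⟨e₁, e₂, fun _ => hη.discr_emod_eight e₁ (j := 3) (u := -1179) (by decide) (by decide)⟩)

lemma occursTwo_one_sq_one_two_one_sq_four :
    OccursTwo 4 {(1, 2), (1, 1)} {(2, 1), (1, 2)} :=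
  occursTwo_of_generators 7 3
    (a := -1) (b := -1) (c := 0) (d := -2) (by decide +kernel)
    (A := -1) (B := 8) (C := -10) (by decide +kernel)
    (fun F _ _ t h => ⟨-t, by
      push_cast at h ⊢
      linear_combination (-1) * h⟩)
    (by
      intro L k _ _ _ _ θ η hθ hη hl
      have e₂ : splittingType 2 L = {(2, 1), (1, 2)} := by
        rw [hθ.splittingType_of_linear_mul Nat.prime_two (g := quadPoly 1 1) (monic_quadPoly _ _)
          (irreducible_map_quadPoly (by decide +kernel)) (by rw [natDegree_quadPoly]; decide) ![0] ![2] (-1) (-1) 0 (-1)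
          (Polynomial.funext fun x => by
          simp only [quarticPoly, cubicPoly, quadPoly, smallPoly, Fin.prod_univ_succ,
            Fin.prod_univ_zero, Matrix.cons_val_zero, Matrix.cons_val_succ, eval_add, eval_mul,
            eval_pow, eval_X, eval_C, eval_sub, mul_one]
          push_cast
          ring) (by decide) (by decide) (by decide), natDegree_quadPoly]
        rfl
      have e₁ : splittingType 2 k = {(1, 2), (1, 1)} :=
        (hη.splittingType_of_linear Nat.prime_two ![0, 1] ![2, 1] 0 0 4 (-5)
        (Polynomial.funext fun x => by
          simp only [quarticPoly, cubicPoly, quadPoly, smallPoly, Fin.prod_univ_succ,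
            Fin.prod_univ_zero, Matrix.cons_val_zero, Matrix.cons_val_succ, eval_add, eval_mul,
            eval_pow, eval_X, eval_C, eval_sub, mul_one]
          push_cast
          ring) (by decide) (by decide) (by decide)).trans rfl
      exact ⟨e₁, e₂, fun _ => hη.discr_emod_eight e₁ (j := 2) (u := -821) (by decide) (by decide)⟩)

lemma occursTwo_one_sq_one_one_pow_four_four :
    OccursTwo 4 {(1, 2), (1, 1)} {(1, 4)} :=
  occursTwo_of_generators 7 3
    (a := -4) (b := 0) (c := 0) (d := -2) (by decide +kernel)
    (A := 1) (B := 0) (C := 2) (by decide +kernel)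
    (fun F _ _ t h => ⟨-(1 / 8 * t ^ 2) - 1, by
      push_cast at h ⊢
      linear_combination (-(1 / 512 * t ^ 3) - 1 / 64 * t + 1 / 16) * h⟩)
    (by
      intro L k _ _ _ _ θ η hθ hη hl
      have e₂ : splittingType 2 L = {(1, 4)} :=
        (hθ.splittingType_of_linear Nat.prime_two ![0] ![4] (-2) 0 0 (-1)
        (Polynomial.funext fun x => by
          simp only [quarticPoly, cubicPoly, quadPoly, smallPoly, Fin.prod_univ_succ,
            Fin.prod_univ_zero, Matrix.cons_val_zero, Matrix.cons_val_succ, eval_add, eval_mul,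
            eval_pow, eval_X, eval_C, eval_sub, mul_one]
          push_cast
          ring) (by decide) (by decide) (by decide)).trans rfl
      have e₁ : splittingType 2 k = {(1, 2), (1, 1)} :=
        (hη.splittingType_of_linear Nat.prime_two ![0, 1] ![2, 1] 0 1 0 1
        (Polynomial.funext fun x => by
          simp only [quarticPoly, cubicPoly, quadPoly, smallPoly, Fin.prod_univ_succ,
            Fin.prod_univ_zero, Matrix.cons_val_zero, Matrix.cons_val_succ, eval_add, eval_mul,
            eval_pow, eval_X, eval_C, eval_sub, mul_one]
          push_cast
          ring) (by decide) (by decide) (by decide)).trans rfl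
      exact ⟨e₁, e₂, fun _ => hη.discr_emod_eight e₁ (j := 2) (u := -29) (by decide) (by decide)⟩)

lemma occursTwo_one_sq_one_one_sq_one_sq_four :
    OccursTwo 4 {(1, 2), (1, 1)} {(1, 2), (1, 2)} :=
  occursTwo_of_generators 5 3
    (a := -2) (b := -3) (c := 0) (d := -2) (by decide +kernel)
    (A := -1) (B := -12) (C := 22) (by decide +kernel)
    (fun F _ _ t h => ⟨-(1 / 4 * t ^ 2) + 1 / 4 * t, by
      push_cast at h ⊢
      linear_combination (-(1 / 64 * t ^ 3) + 3 / 32 * t ^ 2 - 17 / 64 * t + 11 / 16) * h⟩)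
    (by
      intro L k _ _ _ _ θ η hθ hη hl
      have e₂ : splittingType 2 L = {(1, 2), (1, 2)} :=
        (hθ.splittingType_of_linear Nat.prime_two ![0, 1] ![2, 2] 0 (-2) 0 (-1)
        (Polynomial.funext fun x => by
          simp only [quarticPoly, cubicPoly, quadPoly, smallPoly, Fin.prod_univ_succ,
            Fin.prod_univ_zero, Matrix.cons_val_zero, Matrix.cons_val_succ, eval_add, eval_mul,
            eval_pow, eval_X, eval_C, eval_sub, mul_one]
          push_cast
          ring) (by decide) (by decide) (by decide)).trans rfl
      have e₁ : splittingType 2 k = {(1, 2), (1, 1)} :=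
        (hη.splittingType_of_linear Nat.prime_two ![0, 1] ![2, 1] 0 0 (-6) 11
        (Polynomial.funext fun x => by
          simp only [quarticPoly, cubicPoly, quadPoly, smallPoly, Fin.prod_univ_succ,
            Fin.prod_univ_zero, Matrix.cons_val_zero, Matrix.cons_val_succ, eval_add, eval_mul,
            eval_pow, eval_X, eval_C, eval_sub, mul_one]
          push_cast
          ring) (by decide) (by decide) (by decide)).trans rfl
      exact ⟨e₁, e₂, fun _ => hη.discr_emod_eight e₁ (j := 2) (u := -293) (by decide) (by decide)⟩)

lemma occursTwo_one_sq_one_two_sq_four :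
    OccursTwo 4 {(1, 2), (1, 1)} {(2, 2)} :=
  occursTwo_of_generators 5 3
    (a := -2) (b := -1) (c := 0) (d := 1) (by decide +kernel)
    (A := 5) (B := 12) (C := 10) (by decide +kernel)
    (fun F _ _ t h => ⟨-(1 / 2 * t ^ 2) + 1 / 2 * t, by
      push_cast at h ⊢
      linear_combination (-(1 / 8 * t ^ 3) + 1 / 2 * t ^ 2 - 1 / 8 * t - 5 / 4) * h⟩)
    (by
      intro L k _ _ _ _ θ η hθ hη hl
      have e₂ : splittingType 2 L = {(2, 2)} :=
        hθ.splittingType_of_quad_sq Nat.prime_two (a := 1) (b := 1)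
        (by decide +kernel) (C (-2) * X + C 0) 1 0 (by decide) (Polynomial.funext fun x => by
          simp only [quarticPoly, cubicPoly, quadPoly, smallPoly, Fin.prod_univ_succ,
            Fin.prod_univ_zero, Matrix.cons_val_zero, Matrix.cons_val_succ, eval_add, eval_mul,
            eval_pow, eval_X, eval_C, eval_sub, mul_one]
          push_cast
          ring)
      have e₁ : splittingType 2 k = {(1, 2), (1, 1)} :=
        (hη.splittingType_of_linear Nat.prime_two ![0, 1] ![2, 1] 0 3 6 5
        (Polynomial.funext fun x => by
          simp only [quarticPoly, cubicPoly, quadPoly, smallPoly, Fin.prod_univ_succ,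
            Fin.prod_univ_zero, Matrix.cons_val_zero, Matrix.cons_val_succ, eval_add, eval_mul,
            eval_pow, eval_X, eval_C, eval_sub, mul_one]
          push_cast
          ring) (by decide) (by decide) (by decide)).trans rfl
      exact ⟨e₁, e₂, fun _ => hη.discr_emod_eight e₁ (j := 2) (u := -53) (by decide) (by decide)⟩)

/-- Three primes of degree one above 2 in `L` are beyond Dedekind's criterion, so they are counted
with auxiliary integers. -/
lemma occursTwo_one_sq_one_one_sq_one_one_zero :
    OccursTwo 0 {(1, 2), (1, 1)} {(1, 2), (1, 1), (1, 1)} :=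
  occursTwo_of_generators 3 13
    (a := -3) (b := 0) (c := -2) (d := -4) (by decide +kernel)
    (A := -19) (B := 150) (C := 90) (by decide +kernel)
    (fun F _ _ t h => ⟨-(1 / 2 * t ^ 2) - t - 1, by
      push_cast at h ⊢
      linear_combination (-(1 / 8 * t ^ 3) - 3 / 4 * t ^ 2 - 17 / 4 * t - 5 / 2) * h⟩)
    (by
      intro L k _ _ _ _ θ η hθ hη hl
      have e₃ := hθ.three_le_card_of_quartic (a₁ := 1) (b₁ := 0) (c₁ := 6)
        (d₁ := -4) (a₂ := -2) (b₂ := -11) (c₂ := 16) (d₂ := -8) 3 3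
        (by decide +kernel) (by decide +kernel)
        (by
          rintro F _ _ t _ h rfl
          push_cast at h ⊢
          -- The factor is the exact quotient by the quartic of the polynomial substituted into.
          linear_combination (1 / 16 * t ^ 8 - 9 / 16 * t ^ 7 + 27 / 16 * t ^ 6 - 31 / 16 * t ^ 5 +
            7 / 4 * t ^ 4 - 15 / 4 * t ^ 3 + 5 / 2 * t ^ 2 - 5 / 4 * t + 5 / 2) * h)
        (by
          rintro F _ _ t _ h rfl
          push_cast at h ⊢
          linear_combination (1 / 16 * t ^ 8 - 9 / 16 * t ^ 7 + 35 / 16 * t ^ 6 - 85 / 16 * t ^ 5 +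
            10 * t ^ 4 - 121 / 8 * t ^ 3 + 63 / 4 * t ^ 2 - 11 * t + 8) * h)
        (by decide) (by decide) (by decide) (by decide)
      have e₁ : splittingType 2 k = {(1, 2), (1, 1)} :=
        (hη.splittingType_of_linear Nat.prime_two ![0, 1] ![2, 1] 0 (-9) 75 45
        (Polynomial.funext fun x => by
          simp only [quarticPoly, cubicPoly, quadPoly, smallPoly, Fin.prod_univ_succ,
            Fin.prod_univ_zero, Matrix.cons_val_zero, Matrix.cons_val_succ, eval_add, eval_mul,
            eval_pow, eval_X, eval_C, eval_sub, mul_one]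
          push_cast
          ring) (by decide) (by decide) (by decide)).trans rfl
      have e₂ := (hl.right_eq_of_three_le_card e₃).2 e₁
      exact ⟨e₁, e₂, fun _ => hη.discr_emod_eight e₁ (j := 3) (u := -967995) (by decide) (by decide)⟩)

lemma occursTwo_one_sq_one_one_sq_one_one_four :
    OccursTwo 4 {(1, 2), (1, 1)} {(1, 2), (1, 1), (1, 1)} :=
  occursTwo_of_generators 3 13
    (a := -1) (b := -2) (c := -2) (d := -4) (by decide +kernel)
    (A := -13) (B := 20) (C := 162) (by decide +kernel)
    (fun F _ _ t h => ⟨-(1 / 2 * t ^ 2) - 1, by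
      push_cast at h ⊢
      linear_combination (-(1 / 8 * t ^ 3) + 1 / 4 * t ^ 2 - 9 / 4 * t + 4) * h⟩)
    (by
      intro L k _ _ _ _ θ η hθ hη hl
      have e₃ := hθ.three_le_card_of_quartic (a₁ := 1) (b₁ := 2) (c₁ := 2)
        (d₁ := -4) (a₂ := 0) (b₂ := -9) (c₂ := -4) (d₂ := -4) 3 3
        (by decide +kernel) (by decide +kernel)
        (by
          rintro F _ _ t _ h rfl
          push_cast at h ⊢
          linear_combination (1 / 16 * t ^ 8 - 3 / 16 * t ^ 7 - 3 / 16 * t ^ 6 + 7 / 16 * t ^ 5 + 9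
            / 8 * t ^ 4 - 1 / 2 * t ^ 3 - 3 / 2 * t ^ 2 - 5 / 4 * t + 1) * h)
        (by
          rintro F _ _ t _ h rfl
          push_cast at h ⊢
          linear_combination (1 / 16 * t ^ 8 - 3 / 16 * t ^ 7 + 5 / 16 * t ^ 6 - 11 / 16 * t ^ 5 +
            11 / 8 * t ^ 4 - 13 / 8 * t ^ 3 + 3 / 4 * t ^ 2 - t + 2) * h)
        (by decide) (by decide) (by decide) (by decide)
      have e₁ : splittingType 2 k = {(1, 2), (1, 1)} :=
        (hη.splittingType_of_linear Nat.prime_two ![0, 1] ![2, 1] 0 (-6) 10 81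
        (Polynomial.funext fun x => by
          simp only [quarticPoly, cubicPoly, quadPoly, smallPoly, Fin.prod_univ_succ,
            Fin.prod_univ_zero, Matrix.cons_val_zero, Matrix.cons_val_succ, eval_add, eval_mul,
            eval_pow, eval_X, eval_C, eval_sub, mul_one]
          push_cast
          ring) (by decide) (by decide) (by decide)).trans rfl
      have e₂ := (hl.right_eq_of_three_le_card e₃).2 e₁
      exact ⟨e₁, e₂, fun _ => hη.discr_emod_eight e₁ (j := 2) (u := -1873) (by decide) (by decide)⟩)

/-- Three primes in each field are exhibited; the list then leaves no choice but complete splitting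
in both. -/
lemma occursTwo_one_one_one_one_one_one_one (d : ℤ) :
    OccursTwo d {(1, 1), (1, 1), (1, 1)} {(1, 1), (1, 1), (1, 1), (1, 1)} :=
  occursTwo_of_generators 3 11
    (a := -2) (b := -5) (c := -2) (d := -8) (by decide +kernel)
    (A := -57) (B := 328) (C := 24064) (by decide +kernel)
    (fun F _ _ t h => ⟨-t ^ 2 - 2 * t, by
      push_cast at h ⊢
      linear_combination (-t ^ 3 - t ^ 2 - 28 * t + 128) * h⟩)
    (by
      intro L k _ _ _ _ θ η hθ hη hl
      have e₃ := hθ.three_le_card_of_quartic (a₁ := 1) (b₁ := 10) (c₁ := 16)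
        (d₁ := -32) (a₂ := -1) (b₂ := -13) (c₂ := 1) (d₂ := -116) 3 5
        (by decide +kernel) (by decide +kernel)
        (by
          rintro F _ _ t _ h rfl
          push_cast at h ⊢
          linear_combination (1 / 16 * t ^ 8 - 3 / 8 * t ^ 7 - 3 / 16 * t ^ 6 + 3 * t ^ 5 + 39 / 16
            * t ^ 4 - 79 / 8 * t ^ 3 - 209 / 16 * t ^ 2 - 11 / 4 * t + 19 / 4) * h)
        (by
          rintro F _ _ t _ h rfl
          push_cast at h ⊢
          linear_combination (1 / 16 * t ^ 8 - 3 / 8 * t ^ 7 + 5 / 16 * t ^ 6 + 3 / 4 * t ^ 5 + 31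
            / 16 * t ^ 4 - 33 / 8 * t ^ 3 - 101 / 16 * t ^ 2 - 1 / 4 * t + 16) * h)
        (by decide) (by decide) (by decide) (by decide)
      have e₁ : splittingType 2 k = {(1, 1), (1, 1), (1, 1)} := hl.left_eq_of_three_le_card
        (IsIntegralGenerator.three_le_card_of_cubicForm (a := 8) (b := -57) (c := 41) (d := 376) hη
          (by norm_num) (by norm_num) (by decide) (by decide) (by decide) (by decide) (by decide) 11 11 (by decide +kernel)
          (by decide +kernel))
      have e₂ := (hl.right_eq_of_three_le_card e₃).1 e₁
      exact ⟨e₁, e₂, fun e => absurd e (by decide)⟩)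

lemma occursTwo_one_one_one_two_sq (d : ℤ) :
    OccursTwo d {(1, 1), (1, 1), (1, 1)} {(2, 2)} :=
  occursTwo_of_generators 5 7
    (a := -4) (b := -1) (c := 0) (d := -3) (by decide +kernel)
    (A := -9) (B := 30) (C := 400) (by decide +kernel)
    (fun F _ _ t h => ⟨-(1 / 2 * t ^ 2) - 1 / 2 * t - 1, by
      push_cast at h ⊢
      linear_combination (-(1 / 8 * t ^ 3) - 1 / 4 * t ^ 2 - 13 / 8 * t + 6) * h⟩)
    (by
      intro L k _ _ _ _ θ η hθ hη hl
      have e₂ : splittingType 2 L = {(2, 2)} :=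
        hθ.splittingType_of_quad_sq Nat.prime_two (a := 1) (b := 1)
        (by decide +kernel) (C (-3) * X + C 1) 1 (-3) (by decide) (Polynomial.funext fun x => by
          simp only [quarticPoly, cubicPoly, quadPoly, smallPoly, Fin.prod_univ_succ,
            Fin.prod_univ_zero, Matrix.cons_val_zero, Matrix.cons_val_succ, eval_add, eval_mul,
            eval_pow, eval_X, eval_C, eval_sub, mul_one]
          push_cast
          ring)
      have e₁ : splittingType 2 k = {(1, 1), (1, 1), (1, 1)} := hl.left_eq_of_three_le_card
        (IsIntegralGenerator.three_le_card_of_cubicForm (a := 2) (b := -9) (c := 15) (d := 100) hη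
          (by norm_num) (by norm_num) (by decide) (by decide) (by decide) (by decide) (by decide) 7 7 (by decide +kernel)
          (by decide +kernel))
      exact ⟨e₁, e₂, fun e => absurd e (by decide)⟩)

lemma occursTwo_one_one_one_one_sq_one_sq (d : ℤ) :
    OccursTwo d {(1, 1), (1, 1), (1, 1)} {(1, 2), (1, 2)} :=
  occursTwo_of_generators 3 5
    (a := -6) (b := -7) (c := 0) (d := 2) (by decide +kernel)
    (A := -7) (B := -8) (C := 128) (by decide +kernel)
    (fun F _ _ t h => ⟨-t, by
      push_cast at h ⊢
      linear_combination (-1) * h⟩)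
    (by
      intro L k _ _ _ _ θ η hθ hη hl
      have e₂ : splittingType 2 L = {(1, 2), (1, 2)} :=
        (hθ.splittingType_of_linear Nat.prime_two ![0, 1] ![2, 2] (-2) (-4) 0 1
        (Polynomial.funext fun x => by
          simp only [quarticPoly, cubicPoly, quadPoly, smallPoly, Fin.prod_univ_succ,
            Fin.prod_univ_zero, Matrix.cons_val_zero, Matrix.cons_val_succ, eval_add, eval_mul,
            eval_pow, eval_X, eval_C, eval_sub, mul_one]
          push_cast
          ring) (by decide) (by decide) (by decide)).trans rfl
      have e₁ : splittingType 2 k = {(1, 1), (1, 1), (1, 1)} := hl.left_eq_of_three_le_card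
        (IsIntegralGenerator.three_le_card_of_cubicForm (a := 8) (b := -7) (c := -1) (d := 2) hη
          (by norm_num) (by norm_num) (by decide) (by decide) (by decide) (by decide) (by decide) 5 5 (by decide +kernel)
          (by decide +kernel))
      exact ⟨e₁, e₂, fun e => absurd e (by decide)⟩)

lemma occursTwo_one_one_one_one_pow_four (d : ℤ) :
    OccursTwo d {(1, 1), (1, 1), (1, 1)} {(1, 4)} :=
  occursTwo_of_generators 7 3
    (a := 0) (b := 6) (c := -4) (d := -2) (by decide +kernel)
    (A := 3) (B := 2) (C := 8) (by decide +kernel)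
    (fun F _ _ t h => ⟨-(1 / 2 * t), by
      push_cast at h ⊢
      linear_combination (-1 / 8) * h⟩)
    (by
      intro L k _ _ _ _ θ η hθ hη hl
      have e₂ : splittingType 2 L = {(1, 4)} :=
        (hθ.splittingType_of_linear Nat.prime_two ![0] ![4] 0 3 (-2) (-1)
        (Polynomial.funext fun x => by
          simp only [quarticPoly, cubicPoly, quadPoly, smallPoly, Fin.prod_univ_succ,
            Fin.prod_univ_zero, Matrix.cons_val_zero, Matrix.cons_val_succ, eval_add, eval_mul,
            eval_pow, eval_X, eval_C, eval_sub, mul_one]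
          push_cast
          ring) (by decide) (by decide) (by decide)).trans rfl
      have e₁ : splittingType 2 k = {(1, 1), (1, 1), (1, 1)} := hl.left_eq_of_three_le_card
        (IsIntegralGenerator.three_le_card_of_cubicForm (a := 2) (b := 3) (c := 1) (d := 2) hη
          (by norm_num) (by norm_num) (by decide) (by decide) (by decide) (by decide) (by decide) 3 3 (by decide +kernel)
          (by decide +kernel))
      exact ⟨e₁, e₂, fun e => absurd e (by decide)⟩)

/-- The integer α = -(θ² + θ - 4)/2 satisfies α² + α + 1 = 2(α + 1 - 2θ), so it reduces to a
primitive cube root of unity at every prime above 2. -/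
lemma occursTwo_one_one_one_two_two (d : ℤ) :
    OccursTwo d {(1, 1), (1, 1), (1, 1)} {(2, 1), (2, 1)} :=
  occursTwo_of_generators 5 11
    (a := 2) (b := -5) (c := 10) (d := 4) (by decide +kernel)
    (A := 5) (B := 4) (C := -196) (by decide +kernel)
    (fun F _ _ t h => ⟨t, by
      push_cast at h ⊢
      linear_combination (1) * h⟩)
    (by
      intro L k _ _ _ _ θ η hθ hη hl
      have hL : Module.finrank ℚ L = 4 := by rw [hθ.finrank, natDegree_quarticPoly]
      have h := congrArg (algebraMap (𝓞 L) L) hθ.root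
      rw [aeval_quarticPoly] at h
      simp only [map_add, map_mul, map_pow, map_intCast, map_zero] at h
      push_cast at h
      have hx : aeval (-((θ : L) ^ 2 + θ - 4) / 2) (quarticPoly (-2) (-5) 38 (-59)) = 0 := by
        rw [aeval_quarticPoly]
        push_cast
        linear_combination (1 / 16 * (θ : L) ^ 4 + 1 / 8 * (θ : L) ^ 3 - 5 / 16 * (θ : L) ^ 2 - 11
          / 8 * (θ : L) - 3 / 4) * h
      obtain ⟨α, hα⟩ := exists_integer_of_root (monic_quarticPoly _ _ _ _) hx
      have e₂ : splittingType 2 L = {(2, 1), (2, 1)} :=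
        hθ.splittingType_two_of_norm_residue hL (by rw [eval_quarticPoly]; decide)
          (by rw [eval_quarticPoly]; decide) (α := α) (β := α + 1 - 2 * θ) (by
            apply RingOfIntegers.coe_injective
            simp only [map_add, map_mul, map_pow, map_sub, map_one, map_ofNat]
            linear_combination (α - 1 + (-((θ : L) ^ 2 + θ - 4) / 2)) * hα + 1 / 4 * h)
      rw [e₂] at hl
      exact ⟨hl.left_eq (by decide), e₂, fun e => absurd e (by decide)⟩)

end Examples

/-! ### Assembly of the examples. -/

section Main

lemma occursOdd_of_oddListed {tk tL : SplittingType} (h : OddListed tk tL) : OccursOdd tk tL := by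
  rcases h with ⟨rfl, rfl⟩ | ⟨rfl, rfl | rfl | rfl | rfl⟩ | ⟨rfl, rfl | rfl | rfl | rfl⟩ |
    ⟨rfl, rfl | rfl | rfl⟩ | ⟨rfl, rfl⟩
  · exact occursOdd_three_three_one
  · exact occursOdd_two_one_four
  · exact occursOdd_two_one_two_one_one
  · exact occursOdd_two_one_two_sq
  · exact occursOdd_two_one_one_sq_one_sq
  · exact occursOdd_one_one_one_one_one_one_one
  · exact occursOdd_one_one_one_two_two
  · exact occursOdd_one_one_one_two_sq
  · exact occursOdd_one_one_one_one_sq_one_sq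
  · exact occursOdd_one_sq_one_two_one_sq
  · exact occursOdd_one_sq_one_one_sq_one_one
  · exact occursOdd_one_sq_one_one_pow_four
  · exact occursOdd_one_cube_one_cube_one

lemma occursTwo_of_twoListed {d : ℤ} {tk tL : SplittingType} (hd : d = 0 ∨ d = 4)
    (h : TwoListed d tk tL) : OccursTwo d tk tL := by
  rcases h with h | ⟨rfl | rfl | rfl | rfl | rfl, rfl⟩ | ⟨rfl, rfl⟩ | ⟨rfl, h4, rfl⟩
  · rcases h with ⟨rfl, rfl⟩ | ⟨rfl, rfl | rfl | rfl | rfl⟩ | ⟨rfl, rfl | rfl | rfl | rfl⟩ |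
      ⟨rfl, rfl | rfl | rfl⟩ | ⟨rfl, rfl⟩
    · exact occursTwo_three_three_one d
    · exact occursTwo_two_one_four d
    · exact occursTwo_two_one_two_one_one d
    · exact occursTwo_two_one_two_sq d
    · exact occursTwo_two_one_one_sq_one_sq d
    · exact occursTwo_one_one_one_one_one_one_one d
    · exact occursTwo_one_one_one_two_two d
    · exact occursTwo_one_one_one_two_sq d
    · exact occursTwo_one_one_one_one_sq_one_sq d
    · rcases hd with rfl | rfl
      · exact occursTwo_one_sq_one_two_one_sq_zero
      · exact occursTwo_one_sq_one_two_one_sq_four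
    · rcases hd with rfl | rfl
      · exact occursTwo_one_sq_one_one_sq_one_one_zero
      · exact occursTwo_one_sq_one_one_sq_one_one_four
    · rcases hd with rfl | rfl
      · exact occursTwo_one_sq_one_one_pow_four_zero
      · exact occursTwo_one_sq_one_one_pow_four_four
    · exact occursTwo_one_cube_one_cube_one d
  · exact occursTwo_three_one_pow_four d
  · exact occursTwo_two_one_one_pow_four d
  · exact occursTwo_one_one_one_one_pow_four d
  · rcases hd with rfl | rfl
    · exact occursTwo_one_sq_one_one_pow_four_zero
    · exact occursTwo_one_sq_one_one_pow_four_four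
  · exact occursTwo_one_cube_one_pow_four d
  · rcases hd with rfl | rfl
    · exact occursTwo_one_sq_one_one_sq_one_sq_zero
    · exact occursTwo_one_sq_one_one_sq_one_sq_four
  · rcases hd with rfl | rfl
    -- For d = 0 the pair is not listed, as 0 and 4 differ modulo 8.
    · exact absurd h4 (by decide)
    · exact occursTwo_one_sq_one_two_sq_four

end Main

end

theorem theorem4p3 :
    -- no other splitting types are possible
    (∀ (L : Type u) (k : Type v) [Field L] [NumberField L] [Field k] [NumberField k],
      IsA4OrS4Quartic L → IsCubicResolvent k L →
        (∀ p : ℕ, p.Prime → 3 ≤ p → OddListed (splittingType p k) (splittingType p L)) ∧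
        TwoListed (NumberField.discr k) (splittingType 2 k) (splittingType 2 L)) ∧
    -- all the listed splitting types occur, for odd primes
    (∀ tk tL : SplittingType, OddListed tk tL →
      ∃ (p : ℕ) (L k : Type) (_ : Field L) (_ : NumberField L) (_ : Field k) (_ : NumberField k),
        p.Prime ∧ 3 ≤ p ∧ IsA4OrS4Quartic L ∧ IsCubicResolvent k L ∧
          splittingType p k = tk ∧ splittingType p L = tL) ∧
    -- and for `2`, where the type `(1²1)` is subdivided into `(1²1)₀` and `(1²1)₄`
    (∀ (d : ℤ) (tk tL : SplittingType), d = 0 ∨ d = 4 → TwoListed d tk tL →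
      ∃ (L k : Type) (_ : Field L) (_ : NumberField L) (_ : Field k) (_ : NumberField k),
        IsA4OrS4Quartic L ∧ IsCubicResolvent k L ∧
          splittingType 2 k = tk ∧ splittingType 2 L = tL ∧
          (tk = {(1, 2), (1, 1)} → NumberField.discr k ≡ d [ZMOD 8])) ∧
    -- the Artin relation
    (∀ (L : Type u) (k : Type v) (K₆ : Type w) [Field L] [NumberField L] [Field k] [NumberField k]
      [Field K₆] [NumberField K₆] [Algebra k K₆],
      IsA4OrS4Quartic L → IsAssociatedPair L k K₆ →
        (∀ s : ℂ, 1 < s.re → dedekindZeta k s ≠ 0 ∧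
          dedekindZeta L s = riemannZeta s * dedekindZeta K₆ s / dedekindZeta k s) ∧
        -- the same relation for the meromorphic continuations to the whole plane
        (∀ ZL Zk ZK : ℂ → ℂ, Meromorphic ZL → Meromorphic Zk → Meromorphic ZK →
          (∀ s : ℂ, 1 < s.re → ZL s = dedekindZeta L s) →
          (∀ s : ℂ, 1 < s.re → Zk s = dedekindZeta k s) →
          (∀ s : ℂ, 1 < s.re → ZK s = dedekindZeta K₆ s) →
          ZL =ᶠ[Filter.codiscrete ℂ] fun s => riemannZeta s * ZK s / Zk s)) ∧
    -- the splitting type in any one of `k`, `L`, `K₆` is determined by those in the other two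
    (∀ (L L' : Type u) (k k' : Type v) (K₆ K₆' : Type w)
      [Field L] [NumberField L] [Field k] [NumberField k]
      [Field K₆] [NumberField K₆] [Algebra k K₆]
      [Field L'] [NumberField L'] [Field k'] [NumberField k']
      [Field K₆'] [NumberField K₆'] [Algebra k' K₆'] (p p' : ℕ),
      IsA4OrS4Quartic L → IsAssociatedPair L k K₆ →
      IsA4OrS4Quartic L' → IsAssociatedPair L' k' K₆' → p.Prime → p'.Prime →
        (splittingType p k = splittingType p' k' → splittingType p L = splittingType p' L' →
          splittingType p K₆ = splittingType p' K₆') ∧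
        (splittingType p k = splittingType p' k' → splittingType p K₆ = splittingType p' K₆' →
          splittingType p L = splittingType p' L') ∧
        (splittingType p L = splittingType p' L' → splittingType p K₆ = splittingType p' K₆' →
          splittingType p k = splittingType p' k')) := by
  refine ⟨fun L k _ _ _ _ hL hk => ⟨fun p hp hp3 => oddListed_splittingType hL hk hp hp3,
      twoListed_splittingType hL hk⟩, fun tk tL h => occursOdd_of_oddListed h,
    fun d tk tL hd h => occursTwo_of_twoListed hd h, ?_, ?_⟩
  · intro L k K₆ _ _ _ _ _ _ _ hL h
    have hzeta : ∀ s : ℂ, 1 < s.re →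
        dedekindZeta L s = riemannZeta s * dedekindZeta K₆ s / dedekindZeta k s := fun s hs => by
      rw [eq_div_iff (dedekindZeta_ne_zero hs), dedekindZeta_mul_eq hL h hs]
    refine ⟨fun s hs => ⟨dedekindZeta_ne_zero hs, hzeta s hs⟩, ?_⟩
    intro ZL Zk ZK hZL hZk hZK eL ek eK
    refine eventuallyEq_codiscrete_of_eq_on (c := 1) hZL
      ((meromorphic_riemannZeta.mul hZK).div hZk) fun s hs => ?_
    rw [eL s hs, ek s hs, eK s hs, hzeta s hs]
  · intro L L' k k' K₆ K₆' _ _ _ _ _ _ _ _ _ _ _ _ _ _ p p' hL h hL' h' hp hp'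
    exact splittingType_determined hL h hL' h' hp hp'
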